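/- For odd $m\ge 1$ let $\varepsilon_m=1$ if $m\equiv 1\pmod 4$ and $\varepsilon_m=i$ if $m\equiv 3\pmod 4$; $\left(\frac{\cdot}{\cdot}\right)$ is the Jacobi symbol and all powers are taken with the principal branch. Let $k\in\mathbb Z$, $k\neq 0$. For $\tau=u+iv\in\mathbb H$ and $s\in\mathbb C$ with $\operatorname{Re}(s)>\frac34-\frac k2$ put $$E_{k+1/2,s}(\tau)=\sum_{\substack{m\ge 1\\ m\text{ odd}}}\ \sum_{\substack{n\in\mathbb Z\\ \gcd(n,m)=1}}\frac{\left(\frac nm\right)\varepsilon_m^{-2k-1}}{(m\tau+n)^{k+1/2}|m\tau+n|^{2s}},\qquad F_{k+1/2,s}(\tau)=\tau^{-k-1/2}|\tau|^{-2s}E_{k+1/2,s}\!\left(\tfrac{-1}{4\tau}\right),$$ $$H_{k+1/2,s}(\tau)=\frac{\zeta(1-2k)}{2^{2k+1}}\Big[(1+i^{2k+1})E_{k+1/2,s}(\tau)+i^{2k+1}F_{k+1/2,s}(\tau)\Big].$$ For positive integers $a,c$ let $\lambda(a,c)=i^{(1-c)/2}\left(\frac ac\right)$ if $c$ is odd and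 $a$ even, $\lambda(a,c)=i^{a/2}\left(\frac ca\right)$ if $a$ is odd and $c$ even, and $\lambda(a,c)=0$ otherwise; for $n\in\mathbb Z$ let $$\gamma_c(n)=\frac1{\sqrt c}\sum_{a=1}^{2c}\lambda(a,c)e^{-\pi i na/c},\qquad E_n(w)=\frac12\sum_{c\text{ odd}}\frac{\gamma_c(n)}{c^{w}}+\frac12\sum_{c\ge 2\text{ even}}\frac{\gamma_c(n)}{(c/2)^{w}}$$ (Zagier's Dirichlet series). For $h\in\mathbb Z$ let $\Upsilon_m^k(h)=\varepsilon_m^{-2k-1}m^{-1/2}\sum_{n\bmod m}\left(\frac nm\right)e^{2\pi i nh/m}$ for odd $m$ and $\Upsilon_m^k(h)=\gamma_m((-1)^kh)$ for even $m$, and let $$E_h(k,w)=\frac12\sum_{m\text{ odd}}\Upsilon^k_m(h)m^{-w}+\frac12\sum_{m\ge 2\text{ even}}\Upsilon^k_m(h)(m/2)^{-w}.$$ Finally, for $v>0$ let $$\varrho_h^{k+1/2}(s,v)=\int_{iv-\infty}^{iv+\infty}z^{-k-1/2}|z|^{-2s}e^{-2\pi ihz}\,dz .$$ Then for all $\tau=u+iv\in\mathbb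 H$ and all $s$ with $\operatorname{Re}(s)>\frac34-\frac k2$ the series and integrals above (the Dirichlet series taken at $w=k+2s$) converge absolutely, $E_h(k,k+2s)=E_{(-1)^kh}(k+2s)$ for every $h\in\mathbb Z$, and $$H_{k+1/2,s}(\tau)=\zeta(1-2k)\,2^{4s}+\frac{(1+i^{2k+1})\,\zeta(1-2k)}{2^{2k}}\sum_{h=-\infty}^{\infty}E_h(k,k+2s)\,\varrho_h^{k+1/2}(s,v)\,e^{2\pi ih\tau},$$ where the series over $h$ converges absolutely. In particular $H_{k+1/2,s}$ can be meromorphically continued to the whole $s$-plane: there are a closed discrete set $P\subset\mathbb C$, independent of $\tau$, and for every $\tau\in\mathbb H$ a meromorphic function of $s$ on $\mathbb C$, holomorphic outside $P$, that equals $H_{k+1/2,s}(\tau)$ for $\operatorname{Re}(s)>\frac34-\frac k2$. -/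

import Mathlib

noncomputable section

namespace CohenEisenstein

open Complex

/-- `ε_m = √(-1/m)` for odd `m`: it is `1` if `m ≡ 1 (mod 4)` and `i` if `m ≡ 3 (mod 4)`. -/
def eps (m : ℕ) : ℂ := if m % 4 = 1 then 1 else I

/-- The factor `w ^ (k + 1/2) * |w| ^ (2 s)`, with the principal branch. -/
def autFactor (k : ℤ) (s w : ℂ) : ℂ :=
  w ^ ((k : ℂ) + 1 / 2) * ((‖w‖ : ℝ) : ℂ) ^ (2 * s)

/-- The summand of `E_{k+1/2,s}(z)` at the pair `(m, n)`; the sum runs over odd `m ≥ 1` and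
integers `n` prime to `m`, every other pair contributes `0`. -/
def eisTerm (k : ℤ) (s z : ℂ) (p : ℕ × ℤ) : ℂ :=
  if Odd p.1 ∧ Int.gcd p.2 p.1 = 1 then
    ((jacobiSym p.2 p.1 : ℤ) : ℂ) * eps p.1 ^ (-2 * k - 1) /
      autFactor k s ((p.1 : ℂ) * z + (p.2 : ℂ))
  else 0

/-- `E_{k+1/2,s}(z)`. -/
def eisE (k : ℤ) (s z : ℂ) : ℂ := ∑' p : ℕ × ℤ, eisTerm k s z p

/-- `F_{k+1/2,s}(z) = z ^ (-k-1/2) |z| ^ (-2s) E_{k+1/2,s}(-1/(4z))`. -/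
def eisF (k : ℤ) (s z : ℂ) : ℂ := (autFactor k s z)⁻¹ * eisE k s (-1 / (4 * z))

/-- `H_{k+1/2,s}(z)`. -/
def eisH (k : ℤ) (s z : ℂ) : ℂ :=
  riemannZeta (1 - 2 * (k : ℂ)) / (2 : ℂ) ^ (2 * k + 1) *
    ((1 + I ^ (2 * k + 1)) * eisE k s z + I ^ (2 * k + 1) * eisF k s z)

/-- Zagier's `λ(a, c)`, for positive integers `a` and `c`. -/
def lam (a c : ℕ) : ℂ :=
  if Odd c ∧ Even a then I ^ ((1 - (c : ℂ)) / 2) * ((jacobiSym a c : ℤ) : ℂ)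
  else if Odd a ∧ Even c then I ^ ((a : ℂ) / 2) * ((jacobiSym c a : ℤ) : ℂ)
  else 0

/-- The Gauss sum `γ_c(n)`. -/
def gaussGamma (c : ℕ) (n : ℤ) : ℂ :=
  1 / ((Real.sqrt c : ℝ) : ℂ) *
    ∑ a ∈ Finset.Icc 1 (2 * c), lam a c * exp (-(Real.pi * I * n * a / c))

/-- The term at `c` of `∑_{c odd} g(c) c ^ (-w)`. -/
def oddTerm (g : ℕ → ℂ) (w : ℂ) (c : ℕ) : ℂ :=
  if Odd c then g c / (c : ℂ) ^ w else 0

/-- The term at `c` of `∑_{c even, c ≥ 2} g(c) (c/2) ^ (-w)`. -/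
def evenTerm (g : ℕ → ℂ) (w : ℂ) (c : ℕ) : ℂ :=
  if Even c ∧ 2 ≤ c then g c / ((c : ℂ) / 2) ^ w else 0

/-- Half the sum of the odd and the even Dirichlet series attached to `g`. -/
def dirichletE (g : ℕ → ℂ) (w : ℂ) : ℂ :=
  1 / 2 * (∑' c : ℕ, oddTerm g w c + ∑' c : ℕ, evenTerm g w c)

/-- Zagier's Dirichlet series `E_n(w)`. -/
def zagierE (n : ℤ) (w : ℂ) : ℂ := dirichletE (fun c => gaussGamma c n) w

/-- `(-1) ^ k * h` for integers `k`, `h`. -/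
def signed (k h : ℤ) : ℤ := (k.negOnePow : ℤ) * h

/-- The Gauss sum `Υ_m^k(h)`: for odd `m` it is
`ε_m ^ (-2k-1) m ^ (-1/2) ∑_{n mod m} (n/m) e ^ (2 π i n h / m)`, and for even `m` it is
`γ_m((-1)^k h)`. -/
def upsilon (k : ℤ) (h : ℤ) (m : ℕ) : ℂ :=
  if Odd m then
    eps m ^ (-2 * k - 1) * (1 / ((Real.sqrt m : ℝ) : ℂ)) *
      ∑ n ∈ Finset.range m, ((jacobiSym n m : ℤ) : ℂ) * exp (2 * Real.pi * I * n * h / m)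
  else gaussGamma m (signed k h)

/-- The Dirichlet series `E_h(k, w)`. -/
def twistedE (k h : ℤ) (w : ℂ) : ℂ := dirichletE (upsilon k h) w

/-- The integrand of `ϱ_h^{k+1/2}(s, v)`, at the point `u + i v` of the line of integration. -/
def rhoIntegrand (k h : ℤ) (s : ℂ) (v u : ℝ) : ℂ :=
  (autFactor k s ((u : ℂ) + v * I))⁻¹ * exp (-(2 * Real.pi * I * h * ((u : ℂ) + v * I)))

/-- `ϱ_h^{k+1/2}(s, v)`, the integral of `τ ^ (-k-1/2) |τ| ^ (-2s) e ^ (-2 π i h τ)` over the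
horizontal line `Im τ = v`. -/
def rho (k h : ℤ) (s : ℂ) (v : ℝ) : ℂ := ∫ u : ℝ, rhoIntegrand k h s v u

/-- The `h`-th term of the Fourier series, without the common factor. -/
def fourierTerm (k : ℤ) (s : ℂ) (τ : UpperHalfPlane) (h : ℤ) : ℂ :=
  twistedE k h ((k : ℂ) + 2 * s) * rho k h s τ.im * exp (2 * Real.pi * I * h * (τ : ℂ))

end CohenEisenstein

end

/-! Put w = k + 2s. The expansion is Poisson summation on each row of a lattice sum. On a horizontal
line, z^(-k-1/2)|z|^(-2s) is the product of z^(-k-1/2-s) and the conjugate of z to the power -s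
(`autFactor_inv_eq_lineFun`), a smooth function of Re z with enough decay. For odd m the
coefficients of E are m-periodic in n, so summing over n gives the Gauss sum Υ_m(h) m^(-w) times ϱ_h
e^(2πihτ) (`tsum_periodic_autFactor`, `eisE_expansion`).

For F, inversion sends the pair (m, ±n) to (4n, ∓m), so that n becomes the row index. The pair (1,
0) alone has second entry 0 and supplies the constant term (`eisF_eq_lattice`). Reciprocity makes
the new coefficients 4n-periodic, and their Gauss sum is (1 + i^(2k+1)) γ_{2n}((-1)^k h)
(`gaussGamma_even`). Thus E supplies the odd moduli of E_h(k, w), F the even ones, and H weighs them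
equally (`two_mul_twistedE`). Agreement with Zagier's series holds term by term
(`upsilon_eq_gaussGamma`).

For the continuation, three ingredients are made explicit in h. The transform ϱ_h with h ≠ 0
continues by repeated integration by parts, each use gaining a factor 1/|h|
(`exists_continuation_lineFT`); for h = 0 a recursion shows that division by Γ(w - 1/2) removes the
poles (`exists_continuation_lineFT_zero`). The series over even moduli is the odd one times an Euler
factor at 2, which is a finite sum if h ≠ 0 and a geometric series if h = 0 (`tsum_bTerm_eq`). The
odd series, times ζ(2w) without its factor at 2, is a finite combination of L-series of the symbols
of (-1)^k h/f², for odd f with f² dividing h. This rests on the identity `sqUpsilon_eq_sqJac`, which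
needs the exact value of quadratic Gauss sums, obtained here from the theta function near a rational
point. For h = 0 the result is a quotient of zeta values.

L-series with periodic coefficients continue by iterated Abel summation, with bounds polynomial in
the period (`exists_continuation_periodic`). The coefficients therefore grow polynomially in h, the
transforms decay faster, and the series over h converges locally uniformly in s. Multiplying by
`poleReg`, an entire function independent of τ, makes everything entire; its zeros form the
exceptional set. -/

noncomputable section

namespace CohenEisenstein

section
open Complex

/-! ### Additive characters and sums of periodic functions -/

/-- The additive character `n ↦ e ^ (2 π i n / m)`. -/
def ech (m : ℕ) (n : ℤ) : ℂ := exp (2 * Real.pi * I * n / m)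

lemma ech_add (m : ℕ) (a b : ℤ) : ech m (a + b) = ech m a * ech m b := by
  rw [ech, ech, ech, ← exp_add]; congr 1; push_cast; ring

lemma ech_zero (m : ℕ) : ech m 0 = 1 := by simp [ech]

lemma ech_self_mul {m : ℕ} (hm : m ≠ 0) (t : ℤ) : ech m (m * t) = 1 := by
  have : (m : ℂ) ≠ 0 := by exact_mod_cast hm
  rw [ech, Complex.exp_eq_one_iff]
  exact ⟨t, by push_cast; field_simp⟩

lemma ech_of_dvd {m : ℕ} (hm : m ≠ 0) {t : ℤ} (h : (m : ℤ) ∣ t) : ech m t = 1 := by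
  obtain ⟨t, rfl⟩ := h; exact ech_self_mul hm t

lemma ech_mul_left (m : ℕ) {q : ℕ} (hq : q ≠ 0) (n : ℤ) : ech (q * m) (q * n) = ech m n := by
  have : (q : ℂ) ≠ 0 := by exact_mod_cast hq
  rw [ech, ech]; congr 1
  rcases eq_or_ne m 0 with rfl | hm
  · simp
  have : (m : ℂ) ≠ 0 := by exact_mod_cast hm
  push_cast; field_simp

lemma norm_ech (m : ℕ) (n : ℤ) : ‖ech m n‖ = 1 := by
  have : (2 * Real.pi * I * n / m : ℂ) = ((2 * Real.pi * n / m : ℝ) : ℂ) * I := by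
    push_cast; ring
  rw [ech, this, norm_exp_ofReal_mul_I]

lemma ech_congr {m : ℕ} (hm : m ≠ 0) {a b : ℤ} (h : (m : ℤ) ∣ a - b) : ech m a = ech m b := by
  rw [← sub_add_cancel a b, ech_add, ech_of_dvd hm h, one_mul]

lemma ech_periodic {m : ℕ} (hm : m ≠ 0) (h : ℤ) :
    Function.Periodic (fun n : ℤ => ech m (n * h)) m := fun n =>
  ech_congr hm ⟨h, by ring⟩

lemma ech_nat_mul (m t : ℕ) (h : ℤ) : ech m (t * h) = ech m h ^ t := by
  rw [ech, ech, ← Complex.exp_nat_mul]; congr 1; push_cast; ring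

lemma sum_ech {q : ℕ} (hq : q ≠ 0) (h : ℤ) :
    ∑ t ∈ Finset.range q, ech q (t * h) = if (q : ℤ) ∣ h then (q : ℂ) else 0 := by
  have hq' : (q : ℂ) ≠ 0 := by exact_mod_cast hq
  split_ifs with hd
  · rw [Finset.sum_congr rfl fun t _ => ech_of_dvd hq (hd.mul_left _)]
    simp
  · have h1 : ech q h ≠ 1 := by
      intro h1
      rw [ech, Complex.exp_eq_one_iff] at h1
      obtain ⟨n, hn⟩ := h1
      apply hd
      refine ⟨n, ?_⟩
      have h2 : (h : ℂ) = q * n := by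
        have := two_pi_I_ne_zero
        field_simp at hn
        linear_combination hn
      exact_mod_cast h2
    have h3 : (ech q h) ^ q = 1 := by
      rw [← ech_nat_mul]; exact ech_self_mul hq h
    simp_rw [ech_nat_mul]
    rw [geom_sum_eq h1, h3]; simp

lemma periodic_int_eq {c : ℤ → ℂ} {m : ℕ} (hc : Function.Periodic c m) {a b : ℤ}
    (h : (m : ℤ) ∣ a - b) : c a = c b := by
  obtain ⟨t, ht⟩ := h
  have := (hc.int_mul t) b
  rw [← this]; congr 1; simp only [Int.cast_id]; linear_combination ht

/-- A sum of an `m`-periodic function over `m` residues given by an injective parametrisation. -/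
lemma sum_eq_sum_range_of_inj {ι : Type*} (s : Finset ι) {m : ℕ} (hm : m ≠ 0) (φ : ι → ℤ)
    (hcard : s.card = m) (hφ : ∀ i ∈ s, ∀ j ∈ s, (m : ℤ) ∣ φ i - φ j → i = j)
    {c : ℤ → ℂ} (hc : Function.Periodic c m) :
    ∑ i ∈ s, c (φ i) = ∑ n ∈ Finset.range m, c n := by
  have hm0 : (m : ℤ) ≠ 0 := by exact_mod_cast hm
  have hmod : ∀ i, (((φ i % m).toNat : ℕ) : ℤ) = φ i % m := fun i =>
    Int.toNat_of_nonneg (Int.emod_nonneg _ hm0)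
  have hmaps : Set.MapsTo (fun i => (φ i % m).toNat) s (Finset.range m) := by
    intro i _
    have := Int.emod_lt_of_pos (φ i) (by positivity : (0 : ℤ) < m)
    simp only [Finset.coe_range, Set.mem_Iio]
    have := hmod i
    omega
  have hinj : Set.InjOn (fun i => (φ i % m).toNat) s := by
    intro i hi j hj hij
    refine hφ i hi j hj ?_
    have : φ i % m = φ j % m := by
      rw [← hmod i, ← hmod j]; exact_mod_cast hij
    exact Int.ModEq.dvd this.symm
  refine Finset.sum_nbij (fun i => (φ i % m).toNat) hmaps hinj
    (Finset.surjOn_of_injOn_of_card_le _ hmaps hinj (by simp [hcard])) ?_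
  intro i _
  apply periodic_int_eq hc
  rw [hmod i]
  exact Int.dvd_self_sub_emod

lemma sum_range_mul_eq (c : ℤ → ℂ) {m q : ℕ} (hm : m ≠ 0) (hq : q ≠ 0)
    (hc : Function.Periodic c ((m * q : ℕ) : ℤ)) :
    ∑ n ∈ Finset.range (m * q), c n =
      ∑ a ∈ Finset.range m, ∑ t ∈ Finset.range q, c (a + m * t) := by
  rw [← Finset.sum_product', ← sum_eq_sum_range_of_inj (Finset.range m ×ˢ Finset.range q)
    (mul_ne_zero hm hq) (fun p => (p.1 : ℤ) + m * p.2) (by simp) ?_ hc]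
  rintro ⟨a, t⟩ h1 ⟨b, u⟩ h2 h
  simp only [Finset.mem_product, Finset.mem_range] at h1 h2
  push_cast at h
  have hab : (m : ℤ) ∣ (a : ℤ) - b := by
    have h3 : (m : ℤ) ∣ (a : ℤ) + m * t - (b + m * u) := (Dvd.intro _ rfl).trans h
    have h4 : (a : ℤ) - b = ((a : ℤ) + m * t - (b + m * u)) - m * (t - u) := by ring
    rw [h4]; exact dvd_sub h3 (Dvd.intro _ rfl)
  have hab' : a = b := by
    have := Int.eq_zero_of_abs_lt_dvd hab (by rw [abs_lt]; constructor <;> omega)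
    omega
  subst hab'
  have htu : (q : ℤ) ∣ (t : ℤ) - u := by
    have h5 : (a : ℤ) + m * t - (a + m * u) = m * (t - u) := by ring
    rw [h5] at h
    exact (mul_dvd_mul_iff_left (by exact_mod_cast hm)).1 h
  have := Int.eq_zero_of_abs_lt_dvd htu (by rw [abs_lt]; constructor <;> omega)
  simp only [Prod.mk.injEq, true_and]; omega

lemma sum_range_mul_coprime (c : ℤ → ℂ) {m q : ℕ} (hm : m ≠ 0) (hq : q ≠ 0)
    (hmq : Nat.Coprime m q) (hc : Function.Periodic c ((m * q : ℕ) : ℤ)) :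
    ∑ n ∈ Finset.range (m * q), c n =
      ∑ a ∈ Finset.range m, ∑ b ∈ Finset.range q, c (q * a + m * b) := by
  rw [← Finset.sum_product', ← sum_eq_sum_range_of_inj (Finset.range m ×ˢ Finset.range q)
    (mul_ne_zero hm hq) (fun p => (q : ℤ) * p.1 + m * p.2) (by simp) ?_ hc]
  rintro ⟨a, t⟩ h1 ⟨b, u⟩ h2 h
  simp only [Finset.mem_product, Finset.mem_range] at h1 h2
  push_cast at h
  have hcop : IsCoprime (m : ℤ) (q : ℤ) := Nat.isCoprime_iff_coprime.2 hmq
  have hab : (m : ℤ) ∣ (a : ℤ) - b := by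
    have h3 : (m : ℤ) ∣ (q : ℤ) * a + m * t - (q * b + m * u) := (Dvd.intro _ rfl).trans h
    have h4 : (q : ℤ) * ((a : ℤ) - b) = ((q : ℤ) * a + m * t - (q * b + m * u)) - m * (t - u) := by
      ring
    exact hcop.dvd_of_dvd_mul_left (h4 ▸ dvd_sub h3 (Dvd.intro _ rfl))
  have htu : (q : ℤ) ∣ (t : ℤ) - u := by
    have h3 : (q : ℤ) ∣ (q : ℤ) * a + m * t - (q * b + m * u) := (Dvd.intro_left _ rfl).trans h
    have h4 : (m : ℤ) * ((t : ℤ) - u) = ((q : ℤ) * a + m * t - (q * b + m * u)) - q * (a - b) := by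
      ring
    exact hcop.symm.dvd_of_dvd_mul_left (h4 ▸ dvd_sub h3 (Dvd.intro _ rfl))
  have h5 := Int.eq_zero_of_abs_lt_dvd hab (by rw [abs_lt]; constructor <;> omega)
  have h6 := Int.eq_zero_of_abs_lt_dvd htu (by rw [abs_lt]; constructor <;> omega)
  simp only [Prod.mk.injEq]; omega

lemma sum_range_unit_mul {c : ℤ → ℂ} {m : ℕ} (hm : m ≠ 0) {u : ℤ} (hu : IsCoprime (m : ℤ) u)
    (hc : Function.Periodic c (m : ℤ)) :
    ∑ n ∈ Finset.range m, c (u * n) = ∑ n ∈ Finset.range m, c n := by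
  refine sum_eq_sum_range_of_inj (Finset.range m) hm (fun n => u * n) (by simp) ?_ hc
  intro i hi j hj h
  simp only [Finset.mem_range] at hi hj
  rw [← mul_sub] at h
  have h5 := Int.eq_zero_of_abs_lt_dvd (hu.dvd_of_dvd_mul_left h)
    (by rw [abs_lt]; constructor <;> omega)
  omega

/-! ### Gauss sums of Jacobi symbols -/

/-- The Jacobi symbol as a complex number. -/
def jac (a : ℤ) (m : ℕ) : ℂ := ((jacobiSym a m : ℤ) : ℂ)

lemma jac_mul_left (a b : ℤ) (m : ℕ) : jac (a * b) m = jac a m * jac b m := by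
  simp [jac, jacobiSym.mul_left]

lemma jac_mul_right (a : ℤ) {m n : ℕ} (hm : m ≠ 0) (hn : n ≠ 0) :
    jac a (m * n) = jac a m * jac a n := by
  simp [jac, jacobiSym.mul_right' a hm hn]

lemma jac_periodic (m : ℕ) : Function.Periodic (fun n : ℤ => jac n m) (m : ℤ) := fun n => by
  simp only [jac]; rw [jacobiSym.mod_left' (a₂ := n)]; simp

lemma jac_congr {a b : ℤ} {m : ℕ} (h : (m : ℤ) ∣ a - b) : jac a m = jac b m :=
  periodic_int_eq (jac_periodic m) h

lemma norm_jac_le (a : ℤ) (m : ℕ) : ‖jac a m‖ ≤ 1 := by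
  rcases jacobiSym.trichotomy a m with h | h | h <;> simp [jac, h]

lemma jac_sq {a : ℤ} {m : ℕ} (h : a.gcd m = 1) : jac a m * jac a m = 1 := by
  rw [jac, ← Int.cast_mul, ← sq, jacobiSym.sq_one h]; simp

lemma jac_eq_zero {a : ℤ} {m : ℕ} (hm : m ≠ 0) (h : a.gcd m ≠ 1) : jac a m = 0 := by
  rw [jac, jacobiSym.eq_zero_iff.2 ⟨hm, h⟩]; simp

lemma jac_one_left (m : ℕ) : jac 1 m = 1 := by simp [jac]

lemma jac_one_right (a : ℤ) : jac a 1 = 1 := by simp [jac]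

/-- The Gauss sum `∑_{n mod m} (n/m) e ^ (2 π i n h / m)`. -/
def jacGauss (m : ℕ) (h : ℤ) : ℂ := ∑ n ∈ Finset.range m, jac n m * ech m (n * h)

lemma jacGauss_one (h : ℤ) : jacGauss 1 h = 1 := by simp [jacGauss, jac_one_right, ech_zero]

lemma norm_jacGauss_le (m : ℕ) (h : ℤ) : ‖jacGauss m h‖ ≤ m := by
  refine (norm_sum_le _ _).trans ?_
  calc _ ≤ ∑ n ∈ Finset.range m, (1 : ℝ) := Finset.sum_le_sum fun n _ => by
        rw [norm_mul, norm_ech, mul_one]; exact norm_jac_le _ _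
    _ = m := by simp

lemma jac_mul_ech_periodic {m : ℕ} (hm : m ≠ 0) (h : ℤ) :
    Function.Periodic (fun n : ℤ => jac n m * ech m (n * h)) (m : ℤ) :=
  (jac_periodic m).mul (ech_periodic hm h)

/-- Chinese remainder theorem with n = qa + mb. The mixed symbols (q/m)(m/q) are kept so that
`jac_mul_eps` can absorb them. -/
lemma jacGauss_mul {m q : ℕ} (hm : m ≠ 0) (hq : q ≠ 0) (hmq : Nat.Coprime m q) (h : ℤ) :
    jacGauss (m * q) h = jac q m * jac m q * (jacGauss m h * jacGauss q h) := by
  have hmq0 := mul_ne_zero hm hq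
  rw [jacGauss, sum_range_mul_coprime _ hm hq hmq (jac_mul_ech_periodic hmq0 h), jacGauss,
    jacGauss, Finset.sum_mul_sum, Finset.mul_sum]
  refine Finset.sum_congr rfl fun a _ => ?_
  rw [Finset.mul_sum]
  refine Finset.sum_congr rfl fun b _ => ?_
  have h1 : jac (q * a + m * b) m = jac q m * jac a m := by
    rw [← jac_mul_left]; exact jac_congr ⟨b, by ring⟩
  have h2 : jac (q * a + m * b) q = jac m q * jac b q := by
    rw [← jac_mul_left]; exact jac_congr ⟨a, by ring⟩
  have h3 : ech (m * q) ((q * a + m * b) * h) = ech m (a * h) * ech q (b * h) := by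
    rw [← ech_mul_left m hq, ← ech_mul_left q hm, mul_comm q m, ← ech_add]; congr 1; ring
  rw [jac_mul_right _ hm hq, h1, h2, h3]; ring

lemma jacGauss_unit_mul {m : ℕ} (hm : m ≠ 0) {u : ℤ} (hu : u.gcd m = 1) (h : ℤ) :
    jacGauss m (u * h) = jac u m * jacGauss m h := by
  have hcop : IsCoprime (m : ℤ) u := (Int.isCoprime_iff_gcd_eq_one.2 hu).symm
  have key := sum_range_unit_mul hm hcop (jac_mul_ech_periodic hm h)
  rw [jacGauss, jacGauss, ← key, Finset.mul_sum]
  refine Finset.sum_congr rfl fun n _ => ?_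
  rw [jac_mul_left, show (n : ℤ) * (u * h) = u * n * h by ring]
  linear_combination (-jac n m * ech m (u * n * h)) * jac_sq hu

lemma jacGauss_coprime {m : ℕ} (hm : m ≠ 0) {h : ℤ} (hh : h.gcd m = 1) :
    jacGauss m h = jac h m * jacGauss m 1 := by
  rw [← jacGauss_unit_mul hm hh, mul_one]

lemma jac_eq_zero_of_dvd {p m : ℕ} (hp : p.Prime) (hm : m ≠ 0) (hpm : p ∣ m) {n : ℤ}
    (hn : (p : ℤ) ∣ n) : jac n m = 0 := by
  apply jac_eq_zero hm
  intro h
  have : p ∣ Int.gcd n m := Int.dvd_gcd hn (by exact_mod_cast hpm)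
  rw [h] at this
  exact hp.one_lt.ne' (Nat.dvd_one.1 this)

lemma jac_sq_mul {p m : ℕ} (hp : p.Prime) (hm : m ≠ 0) (n : ℤ) :
    jac n (p * (p * m)) = if (p : ℤ) ∣ n then 0 else jac n m := by
  have hp0 := hp.ne_zero
  split_ifs with h
  · exact jac_eq_zero_of_dvd hp (by positivity) (Dvd.intro _ rfl) h
  · rw [jac_mul_right _ hp0 (by positivity), jac_mul_right _ hp0 hm, ← mul_assoc, jac_sq, one_mul]
    rw [Int.gcd_comm, ← Int.isCoprime_iff_gcd_eq_one]
    exact (Nat.prime_iff_prime_int.1 hp).irreducible.coprime_iff_not_dvd.2 h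

/-- If `(·/m)` has the smaller period `q`, where `m = q r`, the Gauss sum is supported on the
multiples of `r`. -/
lemma sum_periodic_ech (c : ℤ → ℂ) {q r : ℕ} (hq : q ≠ 0) (hr : r ≠ 0)
    (hc : Function.Periodic c (q : ℤ)) (h : ℤ) :
    ∑ n ∈ Finset.range (q * r), c n * ech (q * r) (n * h) =
      (if (r : ℤ) ∣ h then (r : ℂ) else 0) *
        ∑ n ∈ Finset.range q, c n * ech (q * r) (n * h) := by
  have hqr := mul_ne_zero hq hr
  have hper : Function.Periodic (fun n : ℤ => c n * ech (q * r) (n * h)) ((q * r : ℕ) : ℤ) := by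
    refine Function.Periodic.mul ?_ (ech_periodic hqr h)
    intro n
    exact periodic_int_eq hc ⟨r, by push_cast; ring⟩
  rw [sum_range_mul_eq _ hq hr hper, Finset.mul_sum]
  refine Finset.sum_congr rfl fun a _ => ?_
  rw [← sum_ech hr, Finset.sum_mul]
  refine Finset.sum_congr rfl fun t _ => ?_
  have h1 : c (a + q * t) = c a := periodic_int_eq hc ⟨t, by ring⟩
  have h2 : ech (q * r) ((a + q * t) * h) = ech (q * r) (a * h) * ech r (t * h) := by
    rw [← ech_mul_left r hq, ← ech_add]; congr 1; ring
  rw [h1, h2]; ring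

/-- Modulo p²m the symbol is (n/m) restricted to n prime to p, hence already pm-periodic; this
forces p ∣ h and gives one factor p. The two remaining terms are the sum over all n minus the sum
over multiples of p. -/
lemma jacGauss_prime_sq {p m : ℕ} (hp : p.Prime) (hm : m ≠ 0) (h : ℤ) :
    jacGauss (p * (p * m)) h = (if (p : ℤ) ∣ h then (p : ℂ) else 0) *
      ((if ((p ^ 2 : ℕ) : ℤ) ∣ h then (p : ℂ) * jacGauss m (h / (p ^ 2 : ℕ)) else 0) -
        (if p ∣ m then 0 else jacGauss m h)) := by
  have hp0 := hp.ne_zero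
  have hpz : (p : ℤ) ≠ 0 := by exact_mod_cast hp0
  have hpm : p * m ≠ 0 := by positivity
  have hper : Function.Periodic (fun n : ℤ => jac n (p * (p * m))) ((p * m : ℕ) : ℤ) := by
    intro n
    simp only [jac_sq_mul hp hm]
    have h1 : ((p : ℤ) ∣ n + ((p * m : ℕ) : ℤ)) ↔ (p : ℤ) ∣ n := by
      rw [Int.dvd_add_left]; push_cast; exact Dvd.intro _ rfl
    simp only [h1]
    rw [jac_congr (m := m) (a := n + ((p * m : ℕ) : ℤ)) (b := n) ⟨p, by push_cast; ring⟩]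
  have h0 : jacGauss (p * (p * m)) h = (if (p : ℤ) ∣ h then (p : ℂ) else 0) *
      ∑ n ∈ Finset.range (p * m), jac n (p * (p * m)) * ech (p * (p * m)) (n * h) := by
    have := sum_periodic_ech _ hpm hp0 hper h
    rw [mul_comm (p * m) p] at this
    rw [jacGauss, this]
  rw [h0]
  by_cases hd : (p : ℤ) ∣ h
  swap; · simp [hd]
  congr 1
  obtain ⟨h1, rfl⟩ := hd
  have h2 : ∀ n : ℤ, ech (p * (p * m)) (n * (p * h1)) = ech (p * m) (n * h1) := fun n => by
    rw [← ech_mul_left (p * m) hp0]; congr 1; ring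
  simp only [h2, jac_sq_mul hp hm]
  have h3 : ∀ n : ℤ, (if (p : ℤ) ∣ n then 0 else jac n m) * ech (p * m) (n * h1) =
      jac n m * ech (p * m) (n * h1) -
        (if (p : ℤ) ∣ n then jac n m * ech (p * m) (n * h1) else 0) := by
    intro n; split_ifs <;> simp
  simp only [h3, Finset.sum_sub_distrib]
  congr 1
  · have := sum_periodic_ech _ hm hp0 (jac_periodic m) h1
    rw [mul_comm m p] at this
    rw [this]
    have h4 : ((p ^ 2 : ℕ) : ℤ) ∣ p * h1 ↔ (p : ℤ) ∣ h1 := by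
      push_cast; rw [sq]; exact mul_dvd_mul_iff_left hpz
    simp only [h4]
    split_ifs with hd
    · obtain ⟨h7, rfl⟩ := hd
      have h5 : ((p : ℤ) * (p * h7)) / ((p ^ 2 : ℕ) : ℤ) = h7 := by
        rw [← mul_assoc]; push_cast; rw [← sq]; exact Int.mul_ediv_cancel_left _ (by positivity)
      rw [h5, jacGauss]
      congr 1
      refine Finset.sum_congr rfl fun n _ => ?_
      rw [← ech_mul_left m hp0]; congr 2; ring
    · simp
  · have hper2 : Function.Periodic (fun n : ℤ => if (p : ℤ) ∣ n then
        jac n m * ech (p * m) (n * h1) else 0) ((p * m : ℕ) : ℤ) := by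
      intro n
      have h1' : ((p : ℤ) ∣ n + ((p * m : ℕ) : ℤ)) ↔ (p : ℤ) ∣ n := by
        rw [Int.dvd_add_left]; push_cast; exact Dvd.intro _ rfl
      simp only [h1']
      rw [jac_congr (m := m) (a := n + ((p * m : ℕ) : ℤ)) (b := n) ⟨p, by push_cast; ring⟩]
      rw [ech_congr (m := p * m) hpm (a := (n + ((p * m : ℕ) : ℤ)) * h1) (b := n * h1)
        ⟨h1, by push_cast; ring⟩]
    rw [sum_range_mul_eq _ hp0 hm hper2]
    have h6 : ∀ a ∈ Finset.range p, a ≠ 0 → ∑ t ∈ Finset.range m,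
        (if (p : ℤ) ∣ (a : ℤ) + p * t then
          jac (a + p * t) m * ech (p * m) ((a + p * t) * h1) else 0) = 0 := by
      intro a ha ha0
      refine Finset.sum_eq_zero fun t _ => if_neg ?_
      rw [Int.dvd_add_left (Dvd.intro _ rfl)]
      intro hd
      have := Nat.le_of_dvd (Nat.pos_of_ne_zero ha0) (Int.natCast_dvd_natCast.1 hd)
      simp at ha; omega
    rw [Finset.sum_eq_single 0 h6 (by simp [hp0])]
    simp only [Nat.cast_zero, zero_add, dvd_mul_right, if_true]
    split_ifs with hpm'
    · exact Finset.sum_eq_zero fun t _ => by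
        rw [jac_eq_zero_of_dvd hp hm hpm' (Dvd.intro _ rfl), zero_mul]
    · have hcop : (p : ℤ).gcd m = 1 := by
        rw [Int.gcd_natCast_natCast]; exact hp.coprime_iff_not_dvd.2 hpm'
      rw [jacGauss_unit_mul hm hcop, jacGauss, Finset.mul_sum]
      refine Finset.sum_congr rfl fun t _ => ?_
      rw [← ech_mul_left m hp0, jac_mul_left, mul_assoc]; congr 3; ring

/-- By multiplicativity the sum has the factor ∑ (n/p), the character being trivial modulo p;
multiplying n by a non-residue changes its sign. -/
lemma jacGauss_prime_mul {p m : ℕ} (hp : p.Prime) (hp2 : p ≠ 2) (hm : m ≠ 0) (hpm : ¬ p ∣ m)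
    {h : ℤ} (hh : (p : ℤ) ∣ h) : jacGauss (p * m) h = 0 := by
  rw [jacGauss_mul hp.ne_zero hm (hp.coprime_iff_not_dvd.2 hpm)]
  have : jacGauss p h = 0 := by
    have := Fact.mk hp
    obtain ⟨a, ha⟩ := quadraticChar_exists_neg_one' (F := ZMod p) (by rwa [ZMod.ringChar_zmod_n])
    have ha' : jac (a : ZMod p).val p = -1 := by
      rw [jac, ← jacobiSym.legendreSym.to_jacobiSym, legendreSym]
      simp [ha]
    have hcop : IsCoprime (p : ℤ) (a : ZMod p).val := by
      rw [Nat.isCoprime_iff_coprime, hp.coprime_iff_not_dvd]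
      intro hd
      have : (a : ZMod p) = 0 := by
        rw [← ZMod.natCast_zmod_val (a : ZMod p)]
        exact (ZMod.natCast_eq_zero_iff _ _).2 hd
      simp at this
    have key := sum_range_unit_mul hp.ne_zero hcop (jac_periodic p)
    simp only [jac_mul_left, ha', ← Finset.mul_sum] at key
    have h0 : jacGauss p h = ∑ n ∈ Finset.range p, jac n p :=
      Finset.sum_congr rfl fun n _ => by rw [ech_of_dvd hp.ne_zero (hh.mul_left _), mul_one]
    rw [h0]
    linear_combination -key / 2
  rw [this]; simp

end

section
open Complex Filter Topology

lemma ofReal_mul_cpow {r : ℝ} (hr : 0 < r) {x : ℂ} (hx : x ≠ 0) (w : ℂ) :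
    ((r : ℂ) * x) ^ w = (r : ℂ) ^ w * x ^ w := by
  have hr' : (r : ℂ) ≠ 0 := by exact_mod_cast hr.ne'
  rw [cpow_def_of_ne_zero (mul_ne_zero hr' hx), cpow_def_of_ne_zero hr', cpow_def_of_ne_zero hx,
    log_ofReal_mul hr hx, ofReal_log hr.le, ← exp_add]
  congr 1; ring

lemma tsum_int_residue {g : ℤ → ℂ} (hg : Summable g) {m : ℕ} (hm : m ≠ 0) :
    ∑' n, g n = ∑ r ∈ Finset.range m, ∑' l : ℤ, g (r + m * l) := by
  have : NeZero m := ⟨hm⟩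
  have h1 : ∀ l : ℤ, ∀ r : Fin m, (Int.divModEquiv m).symm (l, r) = (r : ℤ) + m * l := by
    intro l r; simp [Int.divModEquiv]; ring
  have h2 : Summable fun p : ℤ × Fin m => g ((p.2 : ℕ) + m * p.1) := by
    have := (Int.divModEquiv m).symm.summable_iff.2 hg
    refine this.congr fun p => ?_
    simp only [Function.comp]
    rw [h1]
  rw [← (Int.divModEquiv m).symm.tsum_eq]
  have h3 : ∀ p : ℤ × Fin m, g ((Int.divModEquiv m).symm p) = g ((p.2 : ℕ) + m * p.1) :=
    fun p => by rw [← h1]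
  simp_rw [h3]
  rw [← (Equiv.prodComm _ _).tsum_eq]
  have h4 : Summable fun c : Fin m × ℤ => g ((c.1 : ℕ) + m * c.2) :=
    (Equiv.prodComm (Fin m) ℤ).summable_iff.2 h2
  refine h4.tsum_prod.trans ?_
  rw [tsum_fintype, ← Fin.sum_univ_eq_sum_range (fun r => ∑' l : ℤ, g (r + m * l))]

/-! ### Quadratic Gauss sums from the asymptotics of theta functions -/

lemma tendsto_jacobiTheta₂_one {ι : Type*} {l : Filter ι} (x : ℝ) {τ : ι → ℂ}
    (hτ : Tendsto (fun i => (τ i).im) l atTop) :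
    Tendsto (fun i => jacobiTheta₂ x (τ i)) l (𝓝 1) := by
  have h1 : ∀ᶠ i in l, 1 ≤ (τ i).im := hτ.eventually_ge_atTop 1
  have key := tendsto_tsum_of_dominated_convergence (𝓕 := l)
    (f := fun i (n : ℤ) => jacobiTheta₂_term n x (τ i)) (g := fun n : ℤ => if n = 0 then (1 : ℂ) else 0)
    (summable_pow_mul_jacobiTheta₂_term_bound 0 one_pos 0) ?_ ?_
  · simpa [jacobiTheta₂] using key
  · intro n
    by_cases hn : n = 0
    · simp [hn, jacobiTheta₂_term, tendsto_const_nhds]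
    · simp only [hn, if_false]
      rw [tendsto_zero_iff_norm_tendsto_zero]
      simp only [norm_jacobiTheta₂_term, ofReal_im, mul_zero, sub_zero]
      refine Real.tendsto_exp_atBot.comp ?_
      have hn2 : (0 : ℝ) < Real.pi * (n : ℝ) ^ 2 := by positivity
      have := (hτ.const_mul_atTop hn2)
      rw [← tendsto_neg_atTop_iff]
      refine this.congr fun i => ?_
      ring
  · filter_upwards [h1] with i hi n
    have := norm_jacobiTheta₂_term_le (S := 0) (T := 1) one_pos (z := x) (τ := τ i) (by simp) hi n
    simpa using this

/-- On the class r + Mℤ the exponent is that of a two-variable theta function at (rMz, M²z). In the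
functional equation the exponential prefactor cancels e^(πi r² z). -/
lemma tsum_periodic_theta {M : ℕ} (hM : M ≠ 0) {c : ℤ → ℂ} (hc : Function.Periodic c (M : ℤ))
    {z : ℂ} (hz : 0 < z.im) :
    (-I * z) ^ (1 / 2 : ℂ) * ∑' n : ℤ, c n * exp (Real.pi * I * n ^ 2 * z) =
      1 / M * ∑ r ∈ Finset.range M, c r * jacobiTheta₂ ((r / M : ℝ) : ℂ) (-1 / (M ^ 2 * z)) := by
  have hM' : (M : ℂ) ≠ 0 := by exact_mod_cast hM
  have hz0 : z ≠ 0 := by rintro rfl; simp at hz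
  have hIz : -I * z ≠ 0 := mul_ne_zero (neg_ne_zero.2 I_ne_zero) hz0
  have hpow : (-I * z) ^ (1 / 2 : ℂ) ≠ 0 := by
    rw [Ne, cpow_eq_zero_iff]; tauto
  have hsum : Summable fun n : ℤ => c n * exp (Real.pi * I * n ^ 2 * z) := by
    obtain ⟨B, hB⟩ : ∃ B, ∀ n, ‖c n‖ ≤ B := by
      refine ⟨∑ r ∈ Finset.range M, ‖c r‖, fun n => ?_⟩
      have h0 : (M : ℤ) ≠ 0 := by exact_mod_cast hM
      have h1 : c n = c ((n % M).toNat : ℕ) := by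
        apply periodic_int_eq hc
        rw [Int.toNat_of_nonneg (Int.emod_nonneg _ h0)]
        exact Int.dvd_self_sub_emod
      rw [h1]
      refine Finset.single_le_sum (f := fun r : ℕ => ‖c r‖) (fun _ _ => norm_nonneg _) ?_
      have := Int.emod_lt_of_pos n (by positivity : (0 : ℤ) < M)
      have := Int.emod_nonneg n h0
      simp only [Finset.mem_range]; omega
    have h1 := ((summable_jacobiTheta₂_term_iff 0 z).2 hz).norm.mul_left B
    refine Summable.of_norm_bounded h1 fun n => ?_
    rw [norm_mul]
    refine mul_le_mul (hB n) (le_of_eq ?_) (norm_nonneg _) ((norm_nonneg _).trans (hB n))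
    simp [jacobiTheta₂_term]
  rw [tsum_int_residue hsum hM, Finset.mul_sum, Finset.mul_sum]
  refine Finset.sum_congr rfl fun r _ => ?_
  have h1 : ∀ l : ℤ, c (r + M * l) * exp (Real.pi * I * ((r + M * l : ℤ) : ℂ) ^ 2 * z) =
      c r * exp (Real.pi * I * r ^ 2 * z) * jacobiTheta₂_term l (r * M * z) (M ^ 2 * z) := by
    intro l
    rw [periodic_int_eq hc (a := r + M * l) (b := r) ⟨l, by ring⟩, mul_assoc (c r), jacobiTheta₂_term,
      ← exp_add]
    congr 2; push_cast; ring
  simp_rw [h1]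
  rw [tsum_mul_left]
  change _ * (_ * jacobiTheta₂ (r * M * z) (M ^ 2 * z)) = _
  rw [jacobiTheta₂_functional_equation]
  have h2 : (-I * (M ^ 2 * z)) ^ (1 / 2 : ℂ) = M * (-I * z) ^ (1 / 2 : ℂ) := by
    have : -I * (M ^ 2 * z) = (((M : ℝ) ^ 2 : ℝ) : ℂ) * (-I * z) := by push_cast; ring
    rw [this, ofReal_mul_cpow (by positivity) hIz]
    congr 1
    rw [one_div, ofReal_pow, ofReal_natCast]
    apply Complex.sq_cpow_two_inv
    simp only [natCast_re]; positivity
  have h3 : exp (-Real.pi * I * (r * M * z) ^ 2 / (M ^ 2 * z)) =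
      (exp (Real.pi * I * r ^ 2 * z))⁻¹ := by
    rw [← exp_neg]; congr 1; field_simp
  have h4 : (r * M * z : ℂ) / (M ^ 2 * z) = ((r / M : ℝ) : ℂ) := by push_cast; field_simp
  rw [h2, h3, h4]
  have := exp_ne_zero (Real.pi * I * r ^ 2 * z)
  field_simp

/-- The theta functions on the right of `tsum_periodic_theta` tend to 1 high in the half-plane, so
the asymptotics at the real point 0 reads off the mean of the coefficients. -/
lemma tendsto_periodic_theta {ι : Type*} {l : Filter ι} {M : ℕ} (hM : M ≠ 0) {c : ℤ → ℂ}
    (hc : Function.Periodic c (M : ℤ)) {z : ι → ℂ} (hz : ∀ᶠ i in l, 0 < (z i).im)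
    (hz' : Tendsto (fun i => (-1 / z i).im) l atTop) :
    Tendsto (fun i => (-I * z i) ^ (1 / 2 : ℂ) * ∑' n : ℤ, c n * exp (Real.pi * I * n ^ 2 * z i))
      l (𝓝 (1 / M * ∑ r ∈ Finset.range M, c r)) := by
  have h1 : Tendsto (fun i => 1 / (M : ℂ) * ∑ r ∈ Finset.range M,
      c r * jacobiTheta₂ ((r / M : ℝ) : ℂ) (-1 / (M ^ 2 * z i))) l
      (𝓝 (1 / M * ∑ r ∈ Finset.range M, c r * 1)) := by
    refine Tendsto.const_mul _ (tendsto_finsetSum _ fun r _ => Tendsto.const_mul _ ?_)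
    apply tendsto_jacobiTheta₂_one
    have h2 : ∀ i, (-1 / ((M : ℂ) ^ 2 * z i)).im = (1 / (M : ℝ) ^ 2) * (-1 / z i).im := by
      intro i
      rw [← im_ofReal_mul]; congr 1; push_cast; rw [div_mul_div_comm, one_mul]
    simp_rw [h2]
    exact hz'.const_mul_atTop (by positivity)
  simp only [mul_one] at h1
  refine h1.congr' ?_
  filter_upwards [hz] with i hi
  rw [tsum_periodic_theta hM hc hi]

/-- Let 2/N + iδ approach 2/N. The theta function there has coefficients e(n²/N), so its growth
involves the Gauss sum modulo N; inversion carries it to a neighbourhood of -N/2, where the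
coefficients have period 2 and the mean is elementary. Comparing the limits is Landsberg–Schaar
reciprocity. -/
theorem sum_ech_sq {N : ℕ} (hN : Odd N) :
    ∑ x ∈ Finset.range N, ech N (x ^ 2) = eps N * (Real.sqrt N : ℝ) := by
  have hN0 : N ≠ 0 := by rintro rfl; simp at hN
  have hNC : (N : ℂ) ≠ 0 := by exact_mod_cast hN0
  have hNpos : (0 : ℝ) < N := by positivity
  set z : ℝ → ℂ := fun δ => I * δ with hz
  -- This is -1/(2/N + iδ) + N/2, the inverted point measured from its limit -N/2.
  set z' : ℝ → ℂ := fun δ => (δ : ℂ) * I * (N ^ 2 / (2 * (2 + N * I * δ))) with hz'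
  have hden : ∀ δ : ℝ, (2 + N * I * δ : ℂ) ≠ 0 := by
    intro δ h
    have := congrArg re h
    simp at this
  have hc1 : Function.Periodic (fun n : ℤ => ech N (n ^ 2)) (N : ℤ) := fun n =>
    ech_congr hN0 ⟨2 * n + N, by ring⟩
  have hc2 : Function.Periodic (fun n : ℤ => exp (-(Real.pi * I * n ^ 2 * N / 2))) ((2 : ℕ) : ℤ) := by
    intro n
    simp only
    rw [Complex.exp_eq_exp_iff_exists_int]
    exact ⟨-N * (n + 1), by push_cast; ring⟩
  have e0 : Tendsto (fun δ : ℝ => (δ : ℂ)) (𝓝[>] 0) (𝓝 0) := by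
    have : Tendsto (fun δ : ℝ => (δ : ℂ)) (𝓝 0) (𝓝 ((0 : ℝ) : ℂ)) := continuous_ofReal.tendsto 0
    simpa using this.mono_left nhdsWithin_le_nhds
  have t1 := tendsto_periodic_theta (l := 𝓝[>] (0 : ℝ)) hN0 hc1 (z := z)
    (by filter_upwards [self_mem_nhdsWithin] with δ hδ; simpa [hz] using hδ)
    (by
      have : ∀ δ : ℝ, (-1 / z δ).im = δ⁻¹ := by
        intro δ
        have : -1 / z δ = ((δ⁻¹ : ℝ) : ℂ) * I := by
          simp only [hz]; rcases eq_or_ne δ 0 with rfl | h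
          · simp
          · have : (δ : ℂ) ≠ 0 := by exact_mod_cast h
            push_cast; field_simp; rw [I_sq]
        rw [this]; simp
      simp_rw [this]; exact tendsto_inv_nhdsGT_zero)
  have hinv : ∀ δ : ℝ, 0 < δ → -1 / z' δ = ((2 * 2 / (N ^ 2 * δ) : ℝ) : ℂ) * I - (2 / N : ℝ) := by
    intro δ hδ
    have hδ' : (δ : ℂ) ≠ 0 := by exact_mod_cast hδ.ne'
    have := hden δ
    simp only [hz']; push_cast
    field_simp
    linear_combination (-(2:ℂ)) * I_sq
  have t2 := tendsto_periodic_theta (l := 𝓝[>] (0 : ℝ)) two_ne_zero hc2 (z := z')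
    (by
      filter_upwards [self_mem_nhdsWithin] with δ hδ
      have h1 : (-1 / z' δ).im = 2 * 2 / (N ^ 2 * δ) := by rw [hinv δ hδ, sub_im, im_ofReal_mul, I_im, ofReal_im]; ring
      have h2 : 0 < (-1 / z' δ).im := by
        rw [h1]; have : (0 : ℝ) < δ := hδ
        positivity
      by_contra hcon
      rw [neg_div, neg_im, one_div, inv_im] at h2
      have := normSq_nonneg (z' δ)
      have : 0 ≤ - (-(z' δ).im / normSq (z' δ)) * -1 := by
        rw [neg_mul_neg, mul_one]; exact div_nonneg (by linarith) this
      linarith)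
    (by
      have h1 : Tendsto (fun δ : ℝ => (2 * 2 / (N : ℝ) ^ 2) * δ⁻¹) (𝓝[>] 0) atTop :=
        tendsto_inv_nhdsGT_zero.const_mul_atTop (by positivity)
      refine h1.congr' ?_
      filter_upwards [self_mem_nhdsWithin] with δ hδ
      rw [hinv δ hδ, sub_im, im_ofReal_mul, I_im, ofReal_im]; field_simp; ring)
  -- The theta functional equation at 2/N + iδ, with the square roots arranged so that both sides
  -- carry the normalisation of `tendsto_periodic_theta`.
  have hrel : ∀ᶠ δ : ℝ in 𝓝[>] 0,
      (N ^ 2 / (2 * (2 + N * I * δ)) : ℂ) ^ (1 / 2 : ℂ) * (-I * (2 / N + z δ)) ^ (1 / 2 : ℂ) *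
        ((-I * z δ) ^ (1 / 2 : ℂ) * ∑' n : ℤ, ech N (n ^ 2) * exp (Real.pi * I * n ^ 2 * z δ)) =
      (-I * z' δ) ^ (1 / 2 : ℂ) *
        ∑' n : ℤ, exp (-(Real.pi * I * n ^ 2 * N / 2)) * exp (Real.pi * I * n ^ 2 * z' δ) := by
    filter_upwards [self_mem_nhdsWithin] with δ hδ
    have hδ0 : (0 : ℝ) < δ := hδ
    have hδ' : (δ : ℂ) ≠ 0 := by exact_mod_cast hδ0.ne'
    have hd := hden δ
    have h1 : -I * z δ = δ := by simp only [hz]; linear_combination (-(δ : ℂ)) * I_sq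
    have h2 : -I * z' δ = δ * (N ^ 2 / (2 * (2 + N * I * δ))) := by
      simp only [hz']; linear_combination (-(δ : ℂ) * (N ^ 2 / (2 * (2 + N * I * δ)))) * I_sq
    have hτ0 : (2 / N + z δ : ℂ) ≠ 0 := by
      intro h
      have h3 := congrArg im h
      have h4 : ((2 : ℂ) / N).im = 0 := by
        have : ((2 : ℂ) / N) = ((2 / N : ℝ) : ℂ) := by push_cast; rfl
        rw [this, ofReal_im]
      simp [hz, h4] at h3
      exact hδ0.ne' h3
    have h5 : ∑' n : ℤ, ech N (n ^ 2) * exp (Real.pi * I * n ^ 2 * z δ) =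
        jacobiTheta₂ 0 (2 / N + z δ) := by
      refine tsum_congr fun n => ?_
      rw [ech, jacobiTheta₂_term, ← exp_add]; congr 1; push_cast; ring
    have h6 : ∑' n : ℤ, exp (-(Real.pi * I * n ^ 2 * N / 2)) * exp (Real.pi * I * n ^ 2 * z' δ) =
        jacobiTheta₂ 0 (-1 / (2 / N + z δ)) := by
      refine tsum_congr fun n => ?_
      rw [jacobiTheta₂_term, ← exp_add]; congr 1
      have h7 : -1 / (2 / N + z δ) = -N / 2 + z' δ := by
        rw [div_eq_iff hτ0]
        simp only [hz, hz']
        have hd' : (2 + N * δ * I : ℂ) ≠ 0 := by convert hd using 1; ring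
        field_simp
        ring
      rw [h7]; ring
    rw [h5, h6, jacobiTheta₂_functional_equation 0 (2 / N + z δ), h1, h2,
      ofReal_mul_cpow hδ0 (by
        refine div_ne_zero (pow_ne_zero _ hNC) (mul_ne_zero two_ne_zero hd))]
    have h8 : (-I * (2 / N + z δ)) ^ (1 / 2 : ℂ) ≠ 0 := by
      rw [Ne, cpow_eq_zero_iff]
      simp [hτ0]
    simp only [zero_div, ne_eq, OfNat.ofNat_ne_zero, not_false_eq_true, zero_pow, mul_zero,
      exp_zero, mul_one]
    set X := (-I * (2 / N + z δ)) ^ (1 / 2 : ℂ)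
    rw [one_div X]
    linear_combination ((N ^ 2 / (2 * (2 + N * I * δ)) : ℂ) ^ (1 / 2 : ℂ) * (δ : ℂ) ^ (1 / 2 : ℂ) *
      jacobiTheta₂ 0 (-1 / (2 / N + z δ))) * mul_inv_cancel₀ h8
  have hA : Tendsto (fun δ : ℝ => (N ^ 2 / (2 * (2 + N * I * δ)) : ℂ) ^ (1 / 2 : ℂ)) (𝓝[>] 0)
      (𝓝 (N / 2)) := by
    have h1 : (((N : ℂ) / 2) ^ 2) ^ (1 / 2 : ℂ) = N / 2 := by
      rw [one_div]; apply Complex.sq_cpow_two_inv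
      have : ((N : ℂ) / 2) = ((N / 2 : ℝ) : ℂ) := by push_cast; rfl
      rw [this, ofReal_re]; positivity
    rw [← h1]
    have h2 : Tendsto (fun δ : ℝ => (N ^ 2 / (2 * (2 + N * I * δ)) : ℂ)) (𝓝[>] 0)
        (𝓝 ((N / 2) ^ 2)) := by
      have h3 : ((N : ℂ) / 2) ^ 2 = N ^ 2 / (2 * (2 + N * I * 0)) := by ring
      rw [h3]
      refine Tendsto.div tendsto_const_nhds ?_ (by simp)
      exact (((e0.const_mul _).const_add _).const_mul _)
    refine (continuousAt_cpow_const ?_).tendsto.comp h2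
    left
    have : ((N : ℂ) / 2) ^ 2 = (((N / 2) ^ 2 : ℝ) : ℂ) := by push_cast; rfl
    rw [this, ofReal_re]; positivity
  have hB : Tendsto (fun δ : ℝ => (-I * (2 / N + z δ)) ^ (1 / 2 : ℂ)) (𝓝[>] 0)
      (𝓝 ((1 - I) / (Real.sqrt N : ℝ))) := by
    have hs : ((Real.sqrt N : ℝ) : ℂ) ^ 2 = N := by
      rw [← ofReal_pow, Real.sq_sqrt hNpos.le]; simp
    have hs0 : ((Real.sqrt N : ℝ) : ℂ) ≠ 0 := by
      intro h; rw [h] at hs; simp at hs; exact hNC hs.symm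
    have h0 : ((1 - I) / (Real.sqrt N : ℝ) : ℂ) ^ 2 = -I * (2 / N + I * 0) := by
      rw [div_pow, hs]; field_simp; linear_combination I_sq
    -- (1 - i)/√N is the square root of -2i/N with positive real part, hence the principal one.
    have h1 : (((1 - I) / (Real.sqrt N : ℝ) : ℂ) ^ 2) ^ (1 / 2 : ℂ) = (1 - I) / (Real.sqrt N : ℝ) := by
      rw [one_div]; apply Complex.sq_cpow_two_inv
      rw [div_ofReal_re]; simp; positivity
    rw [← h1, h0]
    have h2 : Tendsto (fun δ : ℝ => -I * (2 / N + z δ)) (𝓝[>] 0) (𝓝 (-I * (2 / N + I * 0))) :=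
      ((e0.const_mul I).const_add _).const_mul _
    refine (continuousAt_cpow_const ?_).tendsto.comp h2
    right
    have : (-I * (2 / N + I * 0) : ℂ) = ((-(2 / N) : ℝ) : ℂ) * I := by push_cast; ring
    rw [this]; simp; exact hN0
  have lim1 := ((hA.mul hB).mul t1).congr' hrel
  have heq := tendsto_nhds_unique lim1 t2
  have hs : ((Real.sqrt N : ℝ) : ℂ) ^ 2 = N := by
    rw [← ofReal_pow, Real.sq_sqrt hNpos.le]; simp
  have hs0 : ((Real.sqrt N : ℝ) : ℂ) ≠ 0 := by
    intro h; rw [h] at hs; simp at hs; exact hNC hs.symm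
  have hI1 : (1 - I : ℂ) ≠ 0 := by
    intro h; have := congrArg re h; simp at this
  simp only [Finset.sum_range_succ, Finset.sum_range_zero, Int.cast_natCast, Nat.cast_zero,
    Nat.cast_one, Nat.cast_ofNat] at heq
  have hval : (1 + exp (-(Real.pi * I * N / 2)) : ℂ) = (1 - I) * eps N := by
    have h1 : exp (-(Real.pi * I * N / 2)) = (-I) ^ N := by
      rw [← Complex.exp_neg_pi_div_two_mul_I, ← Complex.exp_nat_mul]; congr 1; ring
    rw [h1]
    obtain ⟨j, hj | hj⟩ : ∃ j, N = 4 * j + 1 ∨ N = 4 * j + 3 := ⟨N / 4, by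
      obtain ⟨t, ht⟩ := hN; omega⟩
    · have : eps N = 1 := by rw [eps, if_pos (by omega)]
      rw [this, hj, pow_succ, pow_mul]
      have : (-I) ^ 4 = 1 := by rw [neg_pow, I_pow_four]; norm_num
      rw [this]; simp; ring
    · have : eps N = I := by rw [eps, if_neg (by omega)]
      rw [this, hj, pow_add, pow_mul]
      have : (-I) ^ 4 = 1 := by rw [neg_pow, I_pow_four]; norm_num
      rw [this, one_pow, one_mul]
      linear_combination (-I + 1) * I_sq
  have heq2 : (1 - I) * ∑ x ∈ Finset.range N, ech N (x ^ 2) =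
      (Real.sqrt N : ℝ) * (1 + exp (-(Real.pi * I * N / 2))) := by
    norm_num at heq
    field_simp at heq
    rw [heq]; congr 4; ring
  rw [hval] at heq2
  apply mul_left_cancel₀ hI1
  rw [heq2]; ring

/-- The residue a has 1 + (a/p) square roots, so the sum of e(x²/p) is that of (1 + (a/p)) e(a/p),
where the constant 1 contributes 0. -/
lemma jacGauss_prime_one {p : ℕ} (hp : p.Prime) (hp2 : p ≠ 2) :
    jacGauss p 1 = eps p * (Real.sqrt p : ℝ) := by
  have := Fact.mk hp
  rw [← sum_ech_sq (hp.odd_of_ne_two hp2)]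
  have hz : ∀ c : ℤ → ℂ, Function.Periodic c (p : ℤ) →
      ∑ n ∈ Finset.range p, c n = ∑ x : ZMod p, c (x.val) := by
    intro c hc
    refine (sum_eq_sum_range_of_inj Finset.univ hp.ne_zero (fun x : ZMod p => (x.val : ℤ))
      (by simp [ZMod.card]) ?_ hc).symm
    intro x _ y _ h
    have h2 : ((x.val : ℤ) : ZMod p) = ((y.val : ℤ) : ZMod p) := by
      rw [ZMod.intCast_eq_intCast_iff_dvd_sub, ← dvd_neg]; simpa using h
    simpa using h2
  have hsq : ∑ x ∈ Finset.range p, ech p (x ^ 2) = ∑ x : ZMod p, ech p ((x ^ 2).val) := by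
    rw [hz (fun n => ech p (n ^ 2)) fun n => ech_congr hp.ne_zero ⟨2 * n + p, by ring⟩]
    refine Finset.sum_congr rfl fun x _ => ech_congr hp.ne_zero ?_
    rw [← ZMod.intCast_eq_intCast_iff_dvd_sub]
    simp
  rw [hsq, jacGauss, hz _ (jac_mul_ech_periodic hp.ne_zero 1)]
  simp only [mul_one]
  have h1 : ∑ x : ZMod p, ech p ((x ^ 2).val) =
      ∑ a : ZMod p, (jac a.val p + 1) * ech p (a.val) := by
    rw [← Finset.sum_fiberwise (s := Finset.univ) (g := fun x : ZMod p => x ^ 2)]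
    refine Finset.sum_congr rfl fun a _ => ?_
    rw [Finset.sum_congr rfl (g := fun _ => ech p (a.val))
      (fun x hx => by rw [(Finset.mem_filter.1 hx).2]), Finset.sum_const, nsmul_eq_mul]
    congr 1
    have h2 := quadraticChar_card_sqrts (F := ZMod p) (by rwa [ZMod.ringChar_zmod_n]) a
    rw [jac, ← jacobiSym.legendreSym.to_jacobiSym, legendreSym]
    rw [Int.cast_natCast, ZMod.natCast_zmod_val]
    have h3 : (((Finset.univ.filter fun x : ZMod p => x ^ 2 = a).card : ℤ) : ℂ) =
        ((quadraticChar (ZMod p) a + 1 : ℤ) : ℂ) := by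
      rw [← h2]; congr 3; ext; simp
    push_cast at h3
    exact h3
  rw [h1]
  simp only [add_mul, one_mul, Finset.sum_add_distrib]
  have h4 : ∑ a : ZMod p, ech p (a.val) = 0 := by
    have h5 := sum_ech hp.ne_zero 1
    have h6 : ¬ ((p : ℤ) ∣ 1) := by
      intro h; exact hp.one_lt.ne' (Nat.dvd_one.1 (by exact_mod_cast h))
    rw [if_neg h6, hz (fun n => ech p (n * 1)) (ech_periodic hp.ne_zero 1)] at h5
    simpa using h5
  rw [h4, add_zero]

/-- Quadratic reciprocity, in the shape that cancels the mixed symbols of `jacGauss_mul` and carries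
the value at primes to squarefree moduli. -/
lemma jac_mul_eps {m n : ℕ} (hm : Odd m) (hn : Odd n) (hmn : Nat.Coprime m n) :
    jac n m * jac m n * (eps m * eps n) = eps (m * n) := by
  have hn1 : jac m n * jac m n = 1 := jac_sq (by rwa [Int.gcd_natCast_natCast])
  have hm1 : jac n m * jac n m = 1 := jac_sq (by rwa [Int.gcd_natCast_natCast, Nat.gcd_comm])
  have hm4 : m % 4 = 1 ∨ m % 4 = 3 := by obtain ⟨t, ht⟩ := hm; omega
  have hn4 : n % 4 = 1 ∨ n % 4 = 3 := by obtain ⟨t, ht⟩ := hn; omega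
  rcases hm4 with h1 | h1
  · have h3 : jac m n = jac n m := by
      rw [jac, jac, jacobiSym.quadratic_reciprocity_one_mod_four h1 hn]
    have h4 : (m * n) % 4 = n % 4 := by rw [Nat.mul_mod, h1]; simp
    simp only [eps, h4, h1, if_true, h3, hm1]; simp
  · rcases hn4 with h2 | h2
    · have h3 : jac m n = jac n m := by
        rw [jac, jac, jacobiSym.quadratic_reciprocity_one_mod_four h2 hm]
      have h4 : (m * n) % 4 = 3 := by rw [Nat.mul_mod, h1, h2]
      simp only [eps, h4, h1, h2, h3, hm1]; simp
    · have h3 : jac m n = - jac n m := by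
        rw [jac, jac, jacobiSym.quadratic_reciprocity_three_mod_four h1 h2]; simp
      have h4 : (m * n) % 4 = 1 := by rw [Nat.mul_mod, h1, h2]
      have h5 : jac n m * jac m n = -1 := by rw [h3]; linear_combination -hm1
      simp [eps, h4, h1, h2, h5]

lemma jacGauss_squarefree_one {m : ℕ} (hm : Odd m) (hsq : Squarefree m) :
    jacGauss m 1 = eps m * (Real.sqrt m : ℝ) := by
  induction m using Nat.strong_induction_on with
  | _ m ih =>
  have hm0 : m ≠ 0 := by rintro rfl; simp at hm
  rcases eq_or_ne m 1 with rfl | hm1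
  · simp [jacGauss_one, eps]
  obtain ⟨p, hp, q, rfl⟩ := Nat.exists_prime_and_dvd hm1
  have hpo := (Nat.odd_mul.1 hm).1
  have hqo := (Nat.odd_mul.1 hm).2
  have hp2 : p ≠ 2 := by rintro rfl; exact absurd hpo (by decide)
  have hq0 : q ≠ 0 := right_ne_zero_of_mul hm0
  have hcop : Nat.Coprime p q := Nat.coprime_of_squarefree_mul hsq
  rw [jacGauss_mul hp.ne_zero hq0 hcop, jacGauss_prime_one hp hp2,
    ih q (lt_mul_of_one_lt_left (Nat.pos_of_ne_zero hq0) hp.one_lt) hqo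
      (hsq.squarefree_of_dvd (Dvd.intro_left _ rfl)), ← jac_mul_eps hpo hqo hcop]
  push_cast
  rw [Real.sqrt_mul (by positivity)]
  push_cast; ring

end

section
open Complex Filter Topology MeasureTheory FourierTransform

/-! ### Holomorphic dependence of integrals on a parameter -/

/-- A local bound on the integrand alone suffices: Cauchy's estimate on discs of radius r/3 converts
it into an integrable bound for the derivative. -/
lemma differentiableOn_integral_of_locally_dominated {U : Set ℂ} (hU : IsOpen U) {F : ℂ → ℝ → ℂ}
    (hmeas : ∀ s ∈ U, AEStronglyMeasurable (F s)) (hdiff : ∀ u, DifferentiableOn ℂ (F · u) U)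
    (hb : ∀ s ∈ U, ∃ bound : ℝ → ℝ, Integrable bound ∧ ∀ᶠ t in 𝓝 s, ∀ u, ‖F t u‖ ≤ bound u) :
    DifferentiableOn ℂ (fun s => ∫ u, F s u) U := by
  intro s hs
  obtain ⟨bound, hbi, hbe⟩ := hb s hs
  obtain ⟨r, hr, hball⟩ := Metric.eventually_nhds_iff_ball.1 (hbe.and (hU.mem_nhds hs))
  have hr2 : 0 < r / 2 := by positivity
  have hmem : ∀ t ∈ Metric.ball s (r / 2), ∀ z ∈ Metric.closedBall t (r / 3), z ∈ Metric.ball s r := by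
    intro t ht z hz
    simp only [Metric.mem_ball, Metric.mem_closedBall] at *
    linarith [dist_triangle z t s]
  have hderiv : ∀ u, ∀ t ∈ Metric.ball s (r / 2), HasDerivAt (F · u) (deriv (F · u) t) t := by
    intro u t ht
    have h1 := (hball t (hmem t ht t (Metric.mem_closedBall_self (by positivity)))).2
    exact ((hdiff u).differentiableAt (hU.mem_nhds h1)).hasDerivAt
  have key := hasDerivAt_integral_of_dominated_loc_of_deriv_le (μ := volume) (F := F)
    (F' := fun t u => deriv (F · u) t) (x₀ := s) (s := Metric.ball s (r / 2))
    (bound := fun u => bound u / (r / 3)) (Metric.ball_mem_nhds s hr2)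
    (by filter_upwards [hU.mem_nhds hs] with t ht using hmeas t ht)
    (hbi.mono' (hmeas s hs) (Eventually.of_forall (hball s (Metric.mem_ball_self hr)).1))
    ?_ ?_ (hbi.div_const _) (Eventually.of_forall fun u t ht => hderiv u t ht)
  · exact key.2.differentiableAt.differentiableWithinAt
  -- The derivative is measurable in u as a pointwise limit of difference quotients along a sequence
  -- of increments tending to 0.
  · obtain ⟨x, hx, hx0⟩ : ∃ x : ℕ → ℂ, (∀ n, x n ≠ 0) ∧ Tendsto x atTop (𝓝 0) :=
      ⟨fun n => 1 / ((n : ℂ) + 1), fun n => one_div_ne_zero (Nat.cast_add_one_ne_zero n),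
        tendsto_one_div_add_atTop_nhds_zero_nat⟩
    have hx1 : Tendsto x atTop (𝓝[≠] 0) :=
      tendsto_nhdsWithin_iff.2 ⟨hx0, Eventually.of_forall hx⟩
    have hev : ∀ᶠ n in atTop, s + x n ∈ U := by
      have : Tendsto (fun n => s + x n) atTop (𝓝 (s + 0)) := hx0.const_add s
      rw [add_zero] at this
      exact this.eventually (hU.mem_nhds hs)
    obtain ⟨n0, hn0⟩ := eventually_atTop.1 hev
    refine aestronglyMeasurable_of_tendsto_ae atTop
      (f := fun n u => (x (n + n0))⁻¹ • (F (s + x (n + n0)) u - F s u)) (fun n => ?_) ?_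
    · exact ((hmeas _ (hn0 (n + n0) (by omega))).sub (hmeas s hs)).const_smul ((x (n + n0))⁻¹ : ℂ)
    · refine Eventually.of_forall fun u => ?_
      have h1 := (hderiv u s (Metric.mem_ball_self hr2)).tendsto_slope_zero
      exact (h1.comp hx1).comp (tendsto_add_atTop_nat n0)
  · refine Eventually.of_forall fun u t ht => ?_
    apply Complex.norm_deriv_le_of_forall_mem_sphere_norm_le (by positivity)
    · refine DifferentiableOn.diffContOnCl ?_
      rw [closure_ball _ (by positivity)]
      exact fun z hz => ((hdiff u).differentiableAt
        (hU.mem_nhds (hball z (hmem t ht z hz)).2)).differentiableWithinAt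
    · intro z hz
      exact (hball z (hmem t ht z (Metric.sphere_subset_closedBall hz))).1 u

/-! ### The functions `(u + iv) ^ (-a) (u - iv) ^ (-b)` and their Fourier transforms -/

/-- The function `u ↦ (u + iv) ^ (-a) (u - iv) ^ (-b)`. -/
def lineFun (v : ℝ) (a b : ℂ) (u : ℝ) : ℂ := ((u : ℂ) + v * I) ^ (-a) * ((u : ℂ) - v * I) ^ (-b)

variable {v : ℝ}

lemma line_slit (hv : 0 < v) (u : ℝ) : (u : ℂ) + v * I ∈ slitPlane := by
  right; simp [hv.ne']

lemma line_slit' (hv : 0 < v) (u : ℝ) : (u : ℂ) - v * I ∈ slitPlane := by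
  right; simp [hv.ne']

lemma norm_line_conj (v u : ℝ) : ‖(u : ℂ) - v * I‖ = ‖(u : ℂ) + v * I‖ := by
  have : (u : ℂ) - v * I = (starRingEnd ℂ) (u + v * I) := by simp [sub_eq_add_neg]
  rw [this, norm_conj]

lemma hasDerivAt_lineFun (hv : 0 < v) (a b : ℂ) (u : ℝ) :
    HasDerivAt (lineFun v a b) (-a * lineFun v (a + 1) b u - b * lineFun v a (b + 1) u) u := by
  have h1 : HasDerivAt (fun z : ℂ => z + v * I) 1 (u : ℂ) := (hasDerivAt_id _).add_const _
  have h2 : HasDerivAt (fun z : ℂ => z - v * I) 1 (u : ℂ) := (hasDerivAt_id _).sub_const _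
  have h3 := ((HasDerivAt.cpow_const (c := -a) h1 (line_slit hv u)).mul
    (HasDerivAt.cpow_const (f := fun z : ℂ => z - v * I) (c := -b) h2 (line_slit' hv u))).comp_ofReal
  refine h3.congr_deriv ?_
  simp only [lineFun]
  rw [show -(a + 1) = -a - 1 by ring, show -(b + 1) = -b - 1 by ring]
  ring

lemma continuous_lineFun (hv : 0 < v) (a b : ℂ) : Continuous (lineFun v a b) :=
  continuous_iff_continuousAt.2 fun u => (hasDerivAt_lineFun hv a b u).continuousAt

lemma deriv_lineFun (hv : 0 < v) (a b : ℂ) : deriv (lineFun v a b) =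
    fun u => -a * lineFun v (a + 1) b u - b * lineFun v a (b + 1) u :=
  funext fun u => (hasDerivAt_lineFun hv a b u).deriv

lemma lineFun_sub (hv : 0 < v) (a b : ℂ) (u : ℝ) :
    lineFun v a (b + 1) u - lineFun v (a + 1) b u = 2 * v * I * lineFun v (a + 1) (b + 1) u := by
  simp only [lineFun]
  have h1 := slitPlane_ne_zero (line_slit hv u)
  have h2 := slitPlane_ne_zero (line_slit' hv u)
  rw [show -a = -(a + 1) + 1 by ring, show -b = -(b + 1) + 1 by ring, cpow_add _ _ h1,
    cpow_add _ _ h2, cpow_one, cpow_one]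
  ring

/-- Arguments are at most π in absolute value, so the imaginary parts of the exponents cost only a
constant, and both factors have the same modulus. -/
lemma norm_lineFun_le (hv : 0 < v) (a b : ℂ) (u : ℝ) :
    ‖lineFun v a b u‖ ≤ Real.exp (Real.pi * (|a.im| + |b.im|)) *
      ‖(u : ℂ) + v * I‖ ^ (-(a.re + b.re)) := by
  have h1 := slitPlane_ne_zero (line_slit hv u)
  have h2 := slitPlane_ne_zero (line_slit' hv u)
  have h3 : ∀ z : ℂ, z ≠ 0 → ∀ w : ℂ, ‖z ^ (-w)‖ ≤ Real.exp (Real.pi * |w.im|) * ‖z‖ ^ (-w.re) := by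
    intro z hz w
    rw [norm_cpow_of_ne_zero hz, div_eq_mul_inv, ← Real.exp_neg, mul_comm]
    refine mul_le_mul_of_nonneg_right (Real.exp_le_exp.2 ?_) (by positivity)
    simp only [neg_im, mul_neg, neg_neg]
    calc z.arg * w.im ≤ |z.arg * w.im| := le_abs_self _
      _ = |z.arg| * |w.im| := abs_mul _ _
      _ ≤ _ := mul_le_mul_of_nonneg_right (abs_arg_le_pi z) (abs_nonneg _)
  rw [lineFun, norm_mul, mul_add, Real.exp_add, neg_add, Real.rpow_add (norm_pos_iff.2 h1)]
  calc _ ≤ (Real.exp (Real.pi * |a.im|) * ‖(u : ℂ) + v * I‖ ^ (-a.re)) *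
        (Real.exp (Real.pi * |b.im|) * ‖(u : ℂ) + v * I‖ ^ (-b.re)) := by
        refine mul_le_mul (h3 _ h1 a) ?_ (norm_nonneg _) (by positivity)
        rw [← norm_line_conj]; exact h3 _ h2 b
    _ = _ := by ring

lemma norm_line_ge (hv : 0 < v) : ∃ c : ℝ, 0 < c ∧ c ≤ 1 ∧
    ∀ u : ℝ, c * (1 + ‖u‖) ≤ ‖(u : ℂ) + v * I‖ := by
  refine ⟨min v 1 / 2, by positivity, by linarith [min_le_right v 1], fun u => ?_⟩
  have h1 : |u| ≤ ‖(u : ℂ) + v * I‖ := by simpa using abs_re_le_norm ((u : ℂ) + v * I)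
  have h2 : v ≤ ‖(u : ℂ) + v * I‖ := by
    have := abs_im_le_norm ((u : ℂ) + v * I)
    simp only [add_im, ofReal_im, mul_im, ofReal_re, I_im, mul_one, I_re, mul_zero, add_zero,
      zero_add] at this
    exact (le_abs_self v).trans this
  rw [Real.norm_eq_abs]
  have h3 := min_le_left v 1
  have h4 := min_le_right v 1
  have h5 : 0 < min v 1 := by positivity
  nlinarith [abs_nonneg u]

/-- Bracketing Re a + Re b between x0 and x1 keeps the bound uniform while a and b vary, as
domination under the integral requires. -/
lemma norm_lineFun_le' (hv : 0 < v) : ∃ c : ℝ, 0 < c ∧ c ≤ 1 ∧ ∀ (a b : ℂ) (x0 x1 : ℝ), 0 ≤ x0 →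
    x0 ≤ a.re + b.re → a.re + b.re ≤ x1 → ∀ u, ‖lineFun v a b u‖ ≤
      Real.exp (Real.pi * (|a.im| + |b.im|)) * (c ^ (-x1) * (1 + ‖u‖) ^ (-x0)) := by
  obtain ⟨c, hc, hc1, hcu⟩ := norm_line_ge hv
  refine ⟨c, hc, hc1, fun a b x0 x1 h0 h01 h1 u => (norm_lineFun_le hv a b u).trans ?_⟩
  refine mul_le_mul_of_nonneg_left ?_ (Real.exp_pos _).le
  have hu : 1 ≤ 1 + ‖u‖ := by linarith [norm_nonneg u]
  calc _ ≤ (c * (1 + ‖u‖)) ^ (-(a.re + b.re)) :=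
        Real.rpow_le_rpow_of_nonpos (by positivity) (hcu u) (by linarith)
    _ = c ^ (-(a.re + b.re)) * (1 + ‖u‖) ^ (-(a.re + b.re)) :=
        Real.mul_rpow hc.le (by positivity)
    _ ≤ _ := mul_le_mul (Real.rpow_le_rpow_of_exponent_ge hc hc1 (by linarith))
        (Real.rpow_le_rpow_of_exponent_le hu (by linarith)) (by positivity) (by positivity)

lemma integrable_lineFun (hv : 0 < v) {a b : ℂ} (hab : 1 < a.re + b.re) :
    Integrable (lineFun v a b) := by
  obtain ⟨c, hc, hc1, hcu⟩ := norm_lineFun_le' hv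
  have h1 : Integrable (fun u : ℝ => (1 + ‖u‖) ^ (-(a.re + b.re))) :=
    integrable_one_add_norm (by simpa using hab)
  refine ((h1.const_mul _).const_mul _).mono' (continuous_lineFun hv a b).aestronglyMeasurable
    (Eventually.of_forall (hcu a b _ _ (by linarith) le_rfl le_rfl))

/-- The Fourier transform of `lineFun` at the integer `h`. -/
def lineFT (v : ℝ) (a b : ℂ) (h : ℤ) : ℂ := 𝓕 (lineFun v a b) (h : ℝ)

lemma lineFT_eq (v : ℝ) (a b : ℂ) (h : ℤ) :
    lineFT v a b h = ∫ u : ℝ, exp (-(2 * Real.pi * I * h * u)) * lineFun v a b u := by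
  rw [lineFT, Real.fourier_real_eq_integral_exp_smul]
  congr 1; ext u; rw [smul_eq_mul]; congr 2; push_cast; ring

lemma norm_lineFT_le (a b : ℂ) (h : ℤ) : ‖lineFT v a b h‖ ≤ ∫ u, ‖lineFun v a b u‖ := by
  rw [lineFT_eq]
  refine (norm_integral_le_integral_norm _).trans (le_of_eq ?_)
  congr 1; ext u
  have : (-(2 * Real.pi * I * h * u) : ℂ) = ((-(2 * Real.pi * h * u) : ℝ) : ℂ) * I := by
    push_cast; ring
  rw [norm_mul, this, norm_exp_ofReal_mul_I, one_mul]

lemma integrable_char_mul {f : ℝ → ℂ} (hf : Integrable f) (h : ℤ) :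
    Integrable fun u : ℝ => exp (-(2 * Real.pi * I * h * u)) * f u := by
  refine hf.bdd_mul (c := 1) (by fun_prop) (Eventually.of_forall fun u => ?_)
  have : (-(2 * Real.pi * I * h * u) : ℂ) = ((-(2 * Real.pi * h * u) : ℝ) : ℂ) * I := by
    push_cast; ring
  rw [this, norm_exp_ofReal_mul_I]

/-- The transform of the derivative. Each term on the right has total exponent larger by 1, so it
exists in a wider half-plane; this drives the continuation at h ≠ 0. -/
lemma lineFT_by_parts (hv : 0 < v) {a b : ℂ} (hab : 1 < a.re + b.re) (h : ℤ) :
    2 * Real.pi * I * h * lineFT v a b h =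
      -a * lineFT v (a + 1) b h - b * lineFT v a (b + 1) h := by
  have i1 : Integrable (lineFun v (a + 1) b) := integrable_lineFun hv (by simp; linarith)
  have i2 : Integrable (lineFun v a (b + 1)) := integrable_lineFun hv (by simp; linarith)
  have h1 := Real.fourier_deriv (integrable_lineFun hv hab)
    (fun u => (hasDerivAt_lineFun hv a b u).differentiableAt)
    (by rw [deriv_lineFun hv]; exact (i1.const_mul _).sub (i2.const_mul _))
  have h2 := congrFun h1 (h : ℝ)
  simp only [smul_eq_mul, ofReal_intCast] at h2
  rw [lineFT, ← h2, deriv_lineFun hv, lineFT_eq, lineFT_eq, Real.fourier_real_eq_integral_exp_smul,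
    ← integral_const_mul, ← integral_const_mul, ← integral_sub]
  · congr 1; ext u; rw [smul_eq_mul]
    have : ((-2 * Real.pi * u * h : ℝ) : ℂ) * I = -(2 * Real.pi * I * h * u) := by push_cast; ring
    rw [this]; ring
  · exact (integrable_char_mul i1 h).const_mul _
  · exact (integrable_char_mul i2 h).const_mul _


/-- At frequency 0 integration by parts gives only a linear relation, because the derivative of
`lineFun v (a - 1) b` has integral 0. Eliminating the transform at (a - 1, b + 1) by means of (u +
iv) - (u - iv) = 2iv leaves a recursion in b. -/
lemma lineFT_zero_rec (hv : 0 < v) {a b : ℂ} (hab : 1 < a.re + b.re) :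
    (a + b - 1) * lineFT v a b 0 = -2 * v * I * b * lineFT v a (b + 1) 0 := by
  have h0 := fun a b : ℂ => lineFT_eq v a b 0
  simp only [Int.cast_zero, mul_zero, zero_mul, neg_zero, exp_zero, one_mul] at h0
  have i1 : Integrable (lineFun v a b) := integrable_lineFun hv hab
  have i2 : Integrable (lineFun v (a - 1) (b + 1)) := integrable_lineFun hv (by simp; linarith)
  have i3 : Integrable (lineFun v a (b + 1)) := integrable_lineFun hv (by simp; linarith)
  have h1 : lineFT v (a - 1) (b + 1) 0 - lineFT v a b 0 = 2 * v * I * lineFT v a (b + 1) 0 := by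
    rw [h0, h0, h0, ← integral_sub i2 i1, ← integral_const_mul]
    congr 1; ext u
    have := lineFun_sub hv (a - 1) b u
    rwa [sub_add_cancel] at this
  have h2 : (a - 1) * lineFT v a b 0 + b * lineFT v (a - 1) (b + 1) 0 = 0 := by
    have hint : Integrable fun u => -(a - 1) * lineFun v a b u - b * lineFun v (a - 1) (b + 1) u :=
      (i1.const_mul _).sub (i2.const_mul _)
    have hder : ∀ u, HasDerivAt (lineFun v (a - 1) b)
        (-(a - 1) * lineFun v a b u - b * lineFun v (a - 1) (b + 1) u) u := fun u => by
      have := hasDerivAt_lineFun hv (a - 1) b u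
      rwa [sub_add_cancel] at this
    have hz : ∀ l : Filter ℝ, Tendsto (fun u => ‖u‖) l atTop →
        Tendsto (lineFun v (a - 1) b) l (𝓝 0) := by
      intro l hl
      obtain ⟨c, hc, hc1, hcu⟩ := norm_lineFun_le' hv
      have hx : 0 < (a - 1).re + b.re := by simp; linarith
      refine squeeze_zero_norm (hcu (a - 1) b _ _ hx.le le_rfl le_rfl) ?_
      have h5 : Tendsto (fun u : ℝ => (1 + ‖u‖) ^ (-((a - 1).re + b.re))) l (𝓝 0) :=
        (tendsto_rpow_neg_atTop hx).comp (tendsto_atTop_add_const_left _ 1 hl)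
      simpa using (h5.const_mul _).const_mul _
    have h4 := integral_of_hasDerivAt_of_tendsto hder hint
      (hz atBot tendsto_abs_atBot_atTop) (hz atTop tendsto_abs_atTop_atTop)
    rw [integral_sub (i1.const_mul _) (i2.const_mul _), integral_const_mul, integral_const_mul,
      ← h0, ← h0] at h4
    linear_combination -h4
  linear_combination h2 - b * h1

lemma differentiable_lineFun_param (hv : 0 < v) (a₀ b₀ : ℂ) (u : ℝ) :
    Differentiable ℂ fun s => lineFun v (a₀ + s) (b₀ + s) u := by
  have h1 := slitPlane_ne_zero (line_slit hv u)
  have h2 := slitPlane_ne_zero (line_slit' hv u)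
  have d : ∀ c : ℂ, Differentiable ℂ fun s : ℂ => -(c + s) := fun c => by fun_prop
  exact ((d a₀).const_cpow (Or.inl h1)).mul ((d b₀).const_cpow (Or.inl h2))

lemma exists_local_bound_lineFun (hv : 0 < v) (a₀ b₀ : ℂ) {s : ℂ}
    (hs : 1 < a₀.re + b₀.re + 2 * s.re) :
    ∃ bound : ℝ → ℝ, Integrable bound ∧
      ∀ᶠ t in 𝓝 s, ∀ u, ‖lineFun v (a₀ + t) (b₀ + t) u‖ ≤ bound u := by
  obtain ⟨c, hc, hc1, hcu⟩ := norm_lineFun_le' hv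
  obtain ⟨x0, h1, h2⟩ := exists_between hs
  obtain ⟨x1, h3⟩ := exists_gt (a₀.re + b₀.re + 2 * s.re)
  obtain ⟨y, hy⟩ := exists_gt (Real.pi * (|(a₀ + s).im| + |(b₀ + s).im|))
  refine ⟨fun u => Real.exp y * (c ^ (-x1) * (1 + ‖u‖) ^ (-x0)),
    ((integrable_one_add_norm (by simpa using h1)).const_mul _).const_mul _, ?_⟩
  have c1 : Continuous fun t : ℂ => a₀.re + b₀.re + 2 * t.re := by fun_prop
  have c2 : Continuous fun t : ℂ => Real.pi * (|(a₀ + t).im| + |(b₀ + t).im|) := by fun_prop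
  filter_upwards [c1.continuousAt.eventually_const_lt h2, c1.continuousAt.eventually_lt_const h3,
    c2.continuousAt.eventually_lt_const hy] with t h4 h5 h6 u
  refine (hcu _ _ x0 x1 (by linarith) (by simp; linarith) (by simp; linarith) u).trans ?_
  gcongr

lemma differentiableOn_lineFT (hv : 0 < v) (a₀ b₀ : ℂ) (h : ℤ) :
    DifferentiableOn ℂ (fun s => lineFT v (a₀ + s) (b₀ + s) h)
      {s | 1 < a₀.re + b₀.re + 2 * s.re} := by
  simp_rw [lineFT_eq]
  refine differentiableOn_integral_of_locally_dominated
    (isOpen_lt continuous_const (by fun_prop)) ?_ ?_ ?_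
  · intro s _
    exact (Continuous.mul (by fun_prop) (continuous_lineFun hv _ _)).aestronglyMeasurable
  · intro u
    exact ((differentiable_lineFun_param hv a₀ b₀ u).const_mul _).differentiableOn
  · intro s hs
    obtain ⟨bound, h1, h2⟩ := exists_local_bound_lineFun hv a₀ b₀ hs
    refine ⟨bound, h1, ?_⟩
    filter_upwards [h2] with t ht u
    have : (-(2 * Real.pi * I * h * u) : ℂ) = ((-(2 * Real.pi * h * u) : ℝ) : ℂ) * I := by
      push_cast; ring
    rw [norm_mul, this, norm_exp_ofReal_mul_I, one_mul]
    exact ht u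

lemma exists_local_bound_lineFT (hv : 0 < v) (a₀ b₀ : ℂ) {s : ℂ}
    (hs : 1 < a₀.re + b₀.re + 2 * s.re) :
    ∃ B : ℝ, 0 ≤ B ∧ ∀ᶠ t in 𝓝 s, ∀ h : ℤ, ‖lineFT v (a₀ + t) (b₀ + t) h‖ ≤ B := by
  obtain ⟨bound, h1, h2⟩ := exists_local_bound_lineFun hv a₀ b₀ hs
  refine ⟨∫ u, bound u, integral_nonneg fun u => (norm_nonneg _).trans (h2.self_of_nhds u), ?_⟩
  filter_upwards [h2, continuous_re.continuousAt.eventually_const_lt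
    (show (1 - a₀.re - b₀.re) / 2 < s.re by linarith)] with t ht ht2 h
  refine (norm_lineFT_le _ _ h).trans (integral_mono ?_ h1 ht)
  exact (integrable_lineFun hv (by simp; linarith)).norm

/-- Analytic continuation of the Fourier transforms at nonzero frequencies, with decay. -/
lemma exists_continuation_lineFT (hv : 0 < v) (M : ℕ) (a₀ b₀ : ℂ) :
    ∃ E : ℤ → ℂ → ℂ,
      (∀ h ≠ 0, DifferentiableOn ℂ (E h) {s | 1 < a₀.re + b₀.re + 2 * s.re + M}) ∧
      (∀ h ≠ 0, ∀ s : ℂ, 1 < a₀.re + b₀.re + 2 * s.re → E h s = lineFT v (a₀ + s) (b₀ + s) h) ∧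
      (∀ s : ℂ, 1 < a₀.re + b₀.re + 2 * s.re + M → ∃ B : ℝ, 0 ≤ B ∧
        ∀ᶠ t in 𝓝 s, ∀ h ≠ 0, ‖E h t‖ ≤ B / |(h : ℝ)| ^ M) := by
  induction M generalizing a₀ b₀ with
  | zero =>
    refine ⟨fun h s => lineFT v (a₀ + s) (b₀ + s) h, fun h _ => ?_, fun _ _ _ _ => rfl,
      fun s hs => ?_⟩
    · simpa using differentiableOn_lineFT hv a₀ b₀ h
    · obtain ⟨B, hB0, hB⟩ := exists_local_bound_lineFT hv a₀ b₀ (s := s) (by simpa using hs)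
      refine ⟨B, hB0, hB.mono fun t ht h _ => by simpa using ht h⟩
  | succ M ih =>
    obtain ⟨E₁, d₁, e₁, b₁⟩ := ih (a₀ + 1) b₀
    obtain ⟨E₂, d₂, e₂, b₂⟩ := ih a₀ (b₀ + 1)
    have hset : ∀ s : ℂ, 1 < a₀.re + b₀.re + 2 * s.re + (M + 1 : ℕ) →
        (1 < (a₀ + 1).re + b₀.re + 2 * s.re + M ∧ 1 < a₀.re + (b₀ + 1).re + 2 * s.re + M) := by
      intro s hs
      push_cast at hs
      simp only [add_re, one_re]
      constructor <;> linarith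
    -- Integration by parts solved for the transform: one more unit of half-plane and one more
    -- factor 1/|h|.
    refine ⟨fun h s => (2 * Real.pi * I * h)⁻¹ * (-(a₀ + s) * E₁ h s - (b₀ + s) * E₂ h s),
      fun h hh => ?_, fun h hh s hs => ?_, fun s hs => ?_⟩
    · refine DifferentiableOn.const_mul (DifferentiableOn.sub ?_ ?_) _
      · exact (Differentiable.differentiableOn (by fun_prop)).mul
          ((d₁ h hh).mono fun s hs => (hset s hs).1)
      · exact (Differentiable.differentiableOn (by fun_prop)).mul
          ((d₂ h hh).mono fun s hs => (hset s hs).2)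
    · have h1 : (2 * Real.pi * I * h : ℂ) ≠ 0 := by
        have : (h : ℂ) ≠ 0 := by exact_mod_cast hh
        exact mul_ne_zero two_pi_I_ne_zero this
      have h2 := lineFT_by_parts hv (a := a₀ + s) (b := b₀ + s) (by simp; linarith) h
      beta_reduce
      rw [e₁ h hh s (by simp; linarith), e₂ h hh s (by simp; linarith), inv_mul_eq_iff_eq_mul₀ h1,
        h2]
      congr 3 <;> ring_nf
    · obtain ⟨B₁, hB₁, hb₁⟩ := b₁ s (hset s hs).1
      obtain ⟨B₂, hB₂, hb₂⟩ := b₂ s (hset s hs).2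
      obtain ⟨A₁, hA₁⟩ := exists_gt ‖a₀ + s‖
      obtain ⟨A₂, hA₂⟩ := exists_gt ‖b₀ + s‖
      have c1 : Continuous fun t : ℂ => ‖a₀ + t‖ := by fun_prop
      have c2 : Continuous fun t : ℂ => ‖b₀ + t‖ := by fun_prop
      have hA₁0 : 0 ≤ A₁ := (norm_nonneg _).trans hA₁.le
      have hA₂0 : 0 ≤ A₂ := (norm_nonneg _).trans hA₂.le
      refine ⟨A₁ * B₁ + A₂ * B₂, by positivity, ?_⟩
      filter_upwards [hb₁, hb₂, c1.continuousAt.eventually_lt_const hA₁,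
        c2.continuousAt.eventually_lt_const hA₂] with t h1 h2 h3 h4 h hh
      have hh' : 0 < |(h : ℝ)| := by positivity
      have hn : ‖(2 * Real.pi * I * h : ℂ)⁻¹‖ ≤ 1 / |(h : ℝ)| := by
        rw [norm_inv, norm_mul, norm_mul, norm_mul, norm_I, mul_one, Complex.norm_intCast,
          Complex.norm_two, Complex.norm_real, Real.norm_of_nonneg Real.pi_pos.le, ← one_div]
        apply one_div_le_one_div_of_le hh'
        nlinarith [Real.pi_gt_three]
      rw [norm_mul, pow_succ]
      calc _ ≤ 1 / |(h : ℝ)| * (A₁ * (B₁ / |(h : ℝ)| ^ M) + A₂ * (B₂ / |(h : ℝ)| ^ M)) := by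
            refine mul_le_mul hn ((norm_sub_le _ _).trans (add_le_add ?_ ?_)) (norm_nonneg _)
              (by positivity)
            · rw [norm_mul, norm_neg]
              exact mul_le_mul h3.le (h1 h hh) (norm_nonneg _) hA₁0
            · rw [norm_mul]
              exact mul_le_mul h4.le (h2 h hh) (norm_nonneg _) hA₂0
        _ = _ := by field_simp

/-- Analytic continuation of the integral, after division by a Gamma factor. -/
lemma exists_continuation_lineFT_zero (hv : 0 < v) (M : ℕ) (a₀ b₀ : ℂ) :
    ∃ E : ℂ → ℂ, DifferentiableOn ℂ E {s | 1 < a₀.re + b₀.re + 2 * s.re + M} ∧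
      ∀ s : ℂ, 1 < a₀.re + b₀.re + 2 * s.re →
        E s = (Gamma (a₀ + b₀ + 2 * s - 1))⁻¹ * lineFT v (a₀ + s) (b₀ + s) 0 := by
  induction M generalizing b₀ with
  | zero =>
    refine ⟨fun s => (Gamma (a₀ + b₀ + 2 * s - 1))⁻¹ * lineFT v (a₀ + s) (b₀ + s) 0, ?_,
      fun _ _ => rfl⟩
    refine DifferentiableOn.mul ?_ (by simpa using differentiableOn_lineFT hv a₀ b₀ 0)
    exact (differentiable_one_div_Gamma.comp
      (f := fun s : ℂ => a₀ + b₀ + 2 * s - 1) (by fun_prop)).differentiableOn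
  | succ M ih =>
    obtain ⟨E, d, e⟩ := ih (b₀ + 1)
    -- The divisor a₀ + b₀ + 2s - 1 of the recursion is absorbed by Γ(x + 1) = xΓ(x).
    refine ⟨fun s => -2 * v * I * (b₀ + s) * E s, ?_, fun s hs => ?_⟩
    · refine (Differentiable.differentiableOn (by fun_prop)).mul (d.mono fun s hs => ?_)
      simp only [Set.mem_ofPred_eq, Nat.cast_add, Nat.cast_one, add_re, one_re] at *
      linarith
    · have h1 := lineFT_zero_rec hv (a := a₀ + s) (b := b₀ + s) (by simp; linarith)
      have hne : a₀ + b₀ + 2 * s - 1 ≠ 0 := by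
        intro h; have := congrArg re h; simp at this; linarith
      beta_reduce
      rw [e s (by simp; linarith), show a₀ + (b₀ + 1) + 2 * s - 1 = a₀ + b₀ + 2 * s - 1 + 1 by ring,
        Gamma_add_one _ hne, show b₀ + 1 + s = b₀ + s + 1 by ring, mul_inv]
      have h2 : lineFT v (a₀ + s) (b₀ + s) 0 = (a₀ + b₀ + 2 * s - 1)⁻¹ *
          (-2 * v * I * (b₀ + s) * lineFT v (a₀ + s) (b₀ + s + 1) 0) := by
        rw [← h1, eq_inv_mul_iff_mul_eq₀ hne]; ring
      rw [h2]; ring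

lemma summable_lineFT (hv : 0 < v) {a b : ℂ} (hab : 1 < a.re + b.re) :
    Summable (lineFT v a b) := by
  -- Two integrations by parts, read at parameter 0, give decay h^(-2).
  obtain ⟨E, -, e, hb⟩ := exists_continuation_lineFT hv 2 a b
  obtain ⟨B, hB, hb⟩ := hb 0 (by simp; linarith)
  have h1 := hb.self_of_nhds
  refine Summable.of_norm_bounded_eventually (g := fun h : ℤ => B * |(h : ℝ)| ^ (-2 : ℝ))
    ((Real.summable_abs_int_rpow one_lt_two).mul_left B) ?_
  have : ∀ᶠ h : ℤ in cofinite, h ≠ 0 := (Set.finite_singleton (0 : ℤ)).eventually_cofinite_notMem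
  filter_upwards [this] with h hh
  have h2 := h1 h hh
  rw [e h hh 0 (by simpa using hab), add_zero, add_zero] at h2
  rw [Real.rpow_neg (abs_nonneg _), ← div_eq_mul_inv]
  exact_mod_cast h2

lemma tsum_lineFun (hv : 0 < v) {a b : ℂ} (hab : 1 < a.re + b.re) (x : ℝ) :
    ∑' n : ℤ, lineFun v a b (x + n) = ∑' h : ℤ, lineFT v a b h * exp (2 * Real.pi * I * h * x) := by
  have h1 : lineFun v a b =O[cocompact ℝ] fun x : ℝ => |x| ^ (-(a.re + b.re)) := by
    obtain ⟨c, hc, hc1, hcu⟩ := norm_lineFun_le' hv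
    refine Asymptotics.IsBigO.of_bound
      (Real.exp (Real.pi * (|a.im| + |b.im|)) * c ^ (-(a.re + b.re))) ?_
    have : ∀ᶠ u : ℝ in cocompact ℝ, u ≠ 0 := by
      filter_upwards [(isCompact_singleton (x := (0 : ℝ))).compl_mem_cocompact] with u hu using hu
    filter_upwards [this] with u hu
    refine (hcu a b _ _ (by linarith) le_rfl le_rfl u).trans ?_
    have hu' : 0 < |u| := abs_pos.2 hu
    rw [← mul_assoc, Real.norm_of_nonneg (Real.rpow_nonneg hu'.le _)]
    refine mul_le_mul_of_nonneg_left ?_ (by positivity)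
    rw [Real.norm_eq_abs u]
    exact Real.rpow_le_rpow_of_nonpos hu' (by linarith) (by linarith)
  rw [Real.tsum_eq_tsum_fourier_of_rpow_decay_of_summable (continuous_lineFun hv a b) hab h1
    (summable_lineFT hv hab)]
  refine tsum_congr fun h => ?_
  rw [lineFT, fourier_coe_apply]; congr 2; simp

end

section
open Complex Filter Topology

/-! ### The Gauss sums `γ_c(n)` and `Υ_m(h)` -/

lemma I_zpow_eq (k : ℤ) : I ^ (2 * k + 1) = if Even k then I else -I := by
  have h4 : (I : ℂ) ^ (4 : ℤ) = 1 := by exact_mod_cast I_pow_four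
  split_ifs with h
  · obtain ⟨j, rfl⟩ := h
    rw [zpow_add₀ I_ne_zero, show 2 * (j + j) = 4 * j by ring, zpow_mul, h4]; simp
  · obtain ⟨j, rfl⟩ := Int.not_even_iff_odd.1 h
    rw [show 2 * (2 * j + 1) + 1 = 4 * j + 3 by ring, zpow_add₀ I_ne_zero, zpow_mul, h4,
      one_zpow, one_mul]
    have : (I : ℂ) ^ (3 : ℤ) = I ^ 3 := by norm_cast
    rw [this, I_pow_three]

lemma I_zpow_neg_eq (k : ℤ) : I ^ (-2 * k - 1) = -I ^ (2 * k + 1) := by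
  rw [show -2 * k - 1 = -(2 * k + 1) by ring, zpow_neg, I_zpow_eq]
  split_ifs <;> simp

lemma one_add_I_zpow_ne_zero (k : ℤ) : (1 + I ^ (2 * k + 1) : ℂ) ≠ 0 := by
  rw [I_zpow_eq]
  intro h
  have := congrArg re h
  split_ifs at this <;> simp at this

lemma negOnePow_cases (k : ℤ) :
    (Even k ∧ ((k.negOnePow : ℤˣ) : ℤ) = 1) ∨ (¬ Even k ∧ ((k.negOnePow : ℤˣ) : ℤ) = -1) := by
  by_cases h : Even k
  · left; exact ⟨h, by rw [Int.negOnePow_even k h]; rfl⟩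
  · right; exact ⟨h, by rw [Int.negOnePow_odd k (Int.not_even_iff_odd.1 h)]; rfl⟩

/-- The values of the character-like factor in the expansion at the cusp `0`. -/
def psi (k : ℤ) (a : ℤ) : ℂ := if a % 4 = 1 then 1 else I ^ (2 * k + 1)

lemma norm_psi (k a : ℤ) : ‖psi k a‖ = 1 := by
  rw [psi, I_zpow_eq]; split_ifs <;> simp

/-- The coefficients `(n/|a|) ψ(a)` for odd `a`. -/
def bcoef (k : ℤ) (n : ℕ) (a : ℤ) : ℂ := if Odd a then jac n a.natAbs * psi k a else 0

lemma norm_bcoef_le (k : ℤ) (n : ℕ) (a : ℤ) : ‖bcoef k n a‖ ≤ 1 := by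
  rw [bcoef]; split_ifs
  · rw [norm_mul, norm_psi, mul_one]; exact norm_jac_le _ _
  · simp

/-- Multiplicativity in n reduces to primes. For 2 the character χ₈ is even. For odd p, reciprocity
gives (p/a) = (χ₄(a)a / p); passing from a to b, with a + b divisible by 4p, changes the sign of
both χ₄(a) and a modulo p. -/
lemma jacobiSym_eq_of_dvd_add {n : ℕ} (hn : n ≠ 0) {a b : ℕ} (ha : Odd a) (hb : Odd b)
    (h : 4 * n ∣ a + b) : jacobiSym n a = jacobiSym n b := by
  induction n using Nat.recOnMul with
  | zero => exact absurd rfl hn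
  | one => simp
  | prime p hp =>
    rcases eq_or_ne p 2 with rfl | hp2
    · simp only [Nat.cast_ofNat]
      rw [jacobiSym.at_two ha, jacobiSym.at_two hb, ZMod.χ₈_nat_eq_if_mod_eight,
        ZMod.χ₈_nat_eq_if_mod_eight]
      obtain ⟨i, rfl⟩ := ha
      obtain ⟨j, rfl⟩ := hb
      split_ifs <;> first | rfl | (exfalso; omega)
    · have hpo := hp.odd_of_ne_two hp2
      rw [jacobiSym.quadratic_reciprocity' hpo ha, jacobiSym.quadratic_reciprocity' hpo hb,
        qrSign, qrSign, ← jacobiSym.mul_left, ← jacobiSym.mul_left]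
      apply jacobiSym.mod_left'
      have h1 : (p : ℤ) ∣ (a : ℤ) + b := by exact_mod_cast (Dvd.intro_left _ rfl).trans h
      have h2 : a % 4 + b % 4 = 4 := by
        have : 4 ∣ a + b := (Dvd.intro _ rfl).trans h
        obtain ⟨i, rfl⟩ := ha
        obtain ⟨j, rfl⟩ := hb
        omega
      have h3 : ZMod.χ₄ b = - ZMod.χ₄ a := by
        rw [ZMod.χ₄_nat_mod_four a, ZMod.χ₄_nat_mod_four b]
        have : a % 4 = 1 ∧ b % 4 = 3 ∨ a % 4 = 3 ∧ b % 4 = 1 := by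
          obtain ⟨i, rfl⟩ := ha
          omega
        rcases this with ⟨h4, h5⟩ | ⟨h4, h5⟩ <;> rw [h4, h5] <;> decide
      rw [h3]
      refine Int.ModEq.symm (Int.modEq_iff_dvd.2 ?_)
      have : ZMod.χ₄ a * (a : ℤ) - -ZMod.χ₄ a * b = ZMod.χ₄ a * ((a : ℤ) + b) := by ring
      rw [this]
      exact h1.mul_left _
  | mul x y ihx ihy =>
    have hx := left_ne_zero_of_mul hn
    have hy := right_ne_zero_of_mul hn
    push_cast
    rw [jacobiSym.mul_left, jacobiSym.mul_left,
      ihx hx ((mul_dvd_mul_left 4 (Dvd.intro _ rfl)).trans h),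
      ihy hy ((mul_dvd_mul_left 4 (Dvd.intro_left _ rfl)).trans h)]

lemma jacobiSym_eq_of_dvd_sub {n : ℕ} {a b : ℕ} (ha : Odd a) (hb : Odd b)
    (h : ((4 * n : ℕ) : ℤ) ∣ (a : ℤ) - b) : jacobiSym n a = jacobiSym n b := by
  rw [jacobiSym.mod_right' n ha, jacobiSym.mod_right' n hb]
  congr 1
  exact (Nat.modEq_iff_dvd.2 h).symm

lemma bcoef_periodic (k : ℤ) {n : ℕ} (hn : n ≠ 0) :
    Function.Periodic (bcoef k n) ((4 * n : ℕ) : ℤ) := by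
  intro a
  have h1 : Odd (a + ((4 * n : ℕ) : ℤ)) ↔ Odd a := by
    have : Even ((4 * n : ℕ) : ℤ) := ⟨2 * n, by push_cast; ring⟩
    rw [Int.odd_add, iff_true_right this]
  have h2 : psi k (a + ((4 * n : ℕ) : ℤ)) = psi k a := by
    have : (a + ((4 * n : ℕ) : ℤ)) % 4 = a % 4 := by push_cast; omega
    rw [psi, psi, this]
  rw [bcoef, bcoef]
  simp only [h1, h2]
  split_ifs with ho
  swap; · rfl
  have ho' := h1.2 ho
  congr 1
  simp only [jac]
  congr 1
  have o1 : Odd a.natAbs := Int.natAbs_odd.2 ho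
  have o2 : Odd (a + ((4 * n : ℕ) : ℤ)).natAbs := Int.natAbs_odd.2 ho'
  rcases le_total 0 a with ha | ha
  · refine jacobiSym_eq_of_dvd_sub o2 o1 ?_
    rw [Int.natAbs_of_nonneg ha, Int.natAbs_of_nonneg (by positivity)]
    exact ⟨1, by ring⟩
  · rcases le_total 0 (a + ((4 * n : ℕ) : ℤ)) with hb | hb
    -- The shift crosses 0, and the two absolute values add up to 4n.
    · refine jacobiSym_eq_of_dvd_add hn o2 o1 ?_
      rw [← Int.natCast_dvd_natCast, Int.natCast_add, Int.natAbs_of_nonneg hb,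
        Int.ofNat_natAbs_of_nonpos ha]
      exact ⟨1, by ring⟩
    · refine jacobiSym_eq_of_dvd_sub o2 o1 ?_
      rw [Int.ofNat_natAbs_of_nonpos ha, Int.ofNat_natAbs_of_nonpos hb]
      exact ⟨-1, by ring⟩

/-- The Gauss sum `n ^ (-1/2) ∑_{a mod 4n} (n/|a|) ψ(a) e ^ (2 π i a h / 4n)`. -/
def bGauss (k : ℤ) (n : ℕ) (h : ℤ) : ℂ :=
  1 / ((Real.sqrt n : ℝ) : ℂ) * ∑ a ∈ Finset.range (4 * n), bcoef k n a * ech (4 * n) (a * h)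

lemma I_cpow_half_nat (a : ℕ) : I ^ ((a : ℂ) / 2) = exp (Real.pi / 4 * I) ^ a := by
  rw [cpow_def_of_ne_zero I_ne_zero, log_I, ← exp_nat_mul]; congr 1; ring

lemma exp_pi_div_four_mul_sqrt : exp (Real.pi / 4 * I) * (Real.sqrt 2 : ℝ) = 1 + I := by
  have h2 : ((Real.sqrt 2 : ℝ) : ℂ) ^ 2 = 2 := by
    rw [← ofReal_pow, Real.sq_sqrt (by norm_num)]; simp
  rw [exp_mul_I]
  have h1 : (Real.pi / 4 : ℂ) = ((Real.pi / 4 : ℝ) : ℂ) := by push_cast; rfl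
  rw [h1, ← ofReal_cos, ← ofReal_sin, Real.cos_pi_div_four, Real.sin_pi_div_four]
  push_cast
  linear_combination (1 + I) / 2 * h2

lemma exp_pi_div_four_sq : exp (Real.pi / 4 * I) ^ 2 = I := by
  rw [← exp_nat_mul]
  convert exp_pi_div_two_mul_I using 2
  push_cast; ring

/-- With ω = e^(πi/4) one has λ(a, 2n) = ω^a (2/a)(n/a) for odd a. Multiplication by 1 ± i turns ω^a
(2/a) into √2 times a value depending on a modulo 4 only, namely ψ at -(-1)^k a. -/
lemma lam_even (k : ℤ) (n a : ℕ) :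
    (1 + I ^ (2 * k + 1)) * lam a (2 * n) =
      (Real.sqrt 2 : ℝ) * bcoef k n (-(((k.negOnePow : ℤˣ) : ℤ) * a)) := by
  have hodd : Odd (-(((k.negOnePow : ℤˣ) : ℤ) * a)) ↔ Odd a := by
    rw [odd_neg, Int.odd_mul, Int.odd_coe_nat]
    rcases negOnePow_cases k with ⟨-, h⟩ | ⟨-, h⟩ <;> simp [h]
  have habs : (-(((k.negOnePow : ℤˣ) : ℤ) * a)).natAbs = a := by
    rcases negOnePow_cases k with ⟨-, h⟩ | ⟨-, h⟩ <;> simp [h]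
  rw [lam, if_neg (by simp), bcoef]
  by_cases ho : Odd a
  swap; · rw [if_neg (by tauto), if_neg (by rwa [hodd])]; simp
  rw [if_pos ⟨ho, by simp⟩, if_pos (hodd.2 ho), habs, I_cpow_half_nat]
  have h1 : ((jacobiSym ((2 * n : ℕ) : ℤ) a : ℤ) : ℂ) = ((ZMod.χ₈ a : ℤ) : ℂ) * jac n a := by
    push_cast; rw [jacobiSym.mul_left, jacobiSym.at_two ho, jac]; push_cast; rfl
  rw [h1, ZMod.χ₈_nat_eq_if_mod_eight]
  set ω := exp (Real.pi / 4 * I) with hω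
  have hω2 : ω ^ 2 = I := exp_pi_div_four_sq
  have hω1 : ω * (Real.sqrt 2 : ℝ) = 1 + I := exp_pi_div_four_mul_sqrt
  have h2 : ((Real.sqrt 2 : ℝ) : ℂ) ^ 2 = 2 := by
    rw [← ofReal_pow, Real.sq_sqrt (by norm_num)]; simp
  have hω1' : (1 + I) * ω = (Real.sqrt 2 : ℝ) * I := by
    rw [← hω1, ← hω2]; ring
  have hω1'' : (1 - I) * ω = (Real.sqrt 2 : ℝ) := by
    have h3 : ω * I = ω - (1 - I) * ω := by ring
    have hs0 : ((Real.sqrt 2 : ℝ) : ℂ) ≠ 0 := by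
      intro h; rw [h] at h2; norm_num at h2
    apply mul_right_cancel₀ hs0
    linear_combination (1 - I) * hω1 - h2 - I_sq
  have hω8 : ω ^ 8 = 1 := by
    rw [show 8 = 2 * 4 by norm_num, pow_mul, hω2, I_pow_four]
  have hI2 := I_sq
  -- Apart from the common factor (n/a), only a modulo 8 matters.
  obtain ⟨q, r, hr, rfl⟩ : ∃ q r, r < 8 ∧ a = 8 * q + r := ⟨a / 8, a % 8, Nat.mod_lt _ (by norm_num), by omega⟩
  have hpow : ω ^ (8 * q + r) = ω ^ r := by rw [pow_add, pow_mul, hω8, one_pow, one_mul]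
  rw [hpow]
  have hmod : (8 * q + r) % 8 = r := by omega
  have hmod2 : (8 * q + r) % 2 = r % 2 := by omega
  rw [hmod, hmod2]
  have hw3 : ω ^ 3 = I * ω := by rw [pow_succ, hω2]
  have hw5 : ω ^ 5 = -ω := by rw [show 5 = 2 * 2 + 1 by norm_num, pow_succ, pow_mul, hω2, hI2]; ring
  have hw7 : ω ^ 7 = -I * ω := by
    rw [show 7 = 2 * 3 + 1 by norm_num, pow_succ, pow_mul, hω2, I_pow_three]
  have hr4 : r = 1 ∨ r = 3 ∨ r = 5 ∨ r = 7 := by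
    obtain ⟨t, ht⟩ := ho; omega
  rw [I_zpow_eq]
  rcases negOnePow_cases k with ⟨hk, hk'⟩ | ⟨hk, hk'⟩
  · have e1 : ∀ x : ℤ, x % 4 = 1 → psi k x = 1 := fun x hx => if_pos hx
    have e2 : ∀ x : ℤ, x % 4 = 3 → psi k x = I := fun x hx => by
      rw [psi, if_neg (by omega), I_zpow_eq, if_pos hk]
    rw [hk', if_pos hk]
    rcases hr4 with rfl | rfl | rfl | rfl
    · rw [e2 _ (by push_cast; omega)]
      simp; linear_combination (jac n (8 * q + 1)) * hω1'
    · rw [e1 _ (by push_cast; omega), hw3]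
      simp
      linear_combination (-I * jac n (8 * q + 3)) * hω1' - (Real.sqrt 2 : ℝ) * jac n (8 * q + 3) * hI2
    · rw [e2 _ (by push_cast; omega), hw5]
      simp; linear_combination (jac n (8 * q + 5)) * hω1'
    · rw [e1 _ (by push_cast; omega), hw7]
      simp
      linear_combination (-I * jac n (8 * q + 7)) * hω1' - (Real.sqrt 2 : ℝ) * jac n (8 * q + 7) * hI2
  · have e1 : ∀ x : ℤ, x % 4 = 1 → psi k x = 1 := fun x hx => if_pos hx
    have e2 : ∀ x : ℤ, x % 4 = 3 → psi k x = -I := fun x hx => by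
      rw [psi, if_neg (by omega), I_zpow_eq, if_neg hk]
    rw [hk', if_neg hk]
    rcases hr4 with rfl | rfl | rfl | rfl
    · rw [e1 _ (by push_cast; omega)]
      simp; linear_combination (jac n (8 * q + 1)) * hω1''
    · rw [e2 _ (by push_cast; omega), hw3]
      simp
      linear_combination (I * jac n (8 * q + 3)) * hω1''
    · rw [e1 _ (by push_cast; omega), hw5]
      simp; linear_combination (jac n (8 * q + 5)) * hω1''
    · rw [e2 _ (by push_cast; omega), hw7]
      simp
      linear_combination (I * jac n (8 * q + 7)) * hω1''

lemma isCoprime_neg_negOnePow (k : ℤ) (m : ℤ) : IsCoprime m (-((k.negOnePow : ℤˣ) : ℤ)) := by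
  rcases negOnePow_cases k with ⟨-, h⟩ | ⟨-, h⟩ <;> rw [h]
  · exact isCoprime_one_right.neg_right
  · simpa using isCoprime_one_right

lemma sum_Icc_negOnePow (k : ℤ) {m : ℕ} (hm : m ≠ 0) {c : ℤ → ℂ} (hc : Function.Periodic c (m : ℤ)) :
    ∑ a ∈ Finset.Icc 1 m, c (-(((k.negOnePow : ℤˣ) : ℤ) * a)) = ∑ n ∈ Finset.range m, c n := by
  refine sum_eq_sum_range_of_inj (Finset.Icc 1 m) hm
    (fun a => -(((k.negOnePow : ℤˣ) : ℤ) * a)) (by simp) ?_ hc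
  intro i hi j hj h
  simp only [Finset.mem_Icc] at hi hj
  have h1 : (m : ℤ) ∣ -((k.negOnePow : ℤˣ) : ℤ) * ((i : ℤ) - j) := by convert h using 1; ring
  have h5 := Int.eq_zero_of_abs_lt_dvd ((isCoprime_neg_negOnePow k m).dvd_of_dvd_mul_left h1)
    (by rw [abs_lt]; constructor <;> omega)
  omega

/-- The substitution a ↦ -(-1)^k a matches the two characters, and √(2n) = √2 √n absorbs the √2 of
`lam_even`. -/
lemma gaussGamma_even (k : ℤ) {n : ℕ} (hn : n ≠ 0) (h : ℤ) :
    (1 + I ^ (2 * k + 1)) * gaussGamma (2 * n) (signed k h) = bGauss k n h := by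
  have hnC : (n : ℂ) ≠ 0 := by exact_mod_cast hn
  rw [gaussGamma, bGauss]
  have hper : Function.Periodic (fun a : ℤ => bcoef k n a * ech (4 * n) (a * h)) ((4 * n : ℕ) : ℤ) :=
    (bcoef_periodic k hn).mul (ech_periodic (by positivity) h)
  rw [← sum_Icc_negOnePow k (by positivity) hper, show 2 * (2 * n) = 4 * n by ring]
  have hs : Real.sqrt ((2 * n : ℕ) : ℝ) = Real.sqrt 2 * Real.sqrt n := by
    push_cast; exact Real.sqrt_mul (by norm_num) _
  have hs2 : ((Real.sqrt 2 : ℝ) : ℂ) ≠ 0 := by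
    exact_mod_cast (Real.sqrt_pos.2 (by norm_num : (0 : ℝ) < 2)).ne'
  have hsn : ((Real.sqrt n : ℝ) : ℂ) ≠ 0 := by
    exact_mod_cast (Real.sqrt_pos.2 (by positivity : (0 : ℝ) < n)).ne'
  rw [hs, mul_left_comm, Finset.mul_sum, Finset.mul_sum, Finset.mul_sum]
  refine Finset.sum_congr rfl fun a _ => ?_
  rw [← mul_assoc (1 + _), lam_even]
  have he : exp (-(Real.pi * I * (signed k h : ℤ) * a / (2 * n : ℕ))) =
      ech (4 * n) (-(((k.negOnePow : ℤˣ) : ℤ) * a) * h) := by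
    rw [ech]; congr 1; rw [signed]; push_cast; field_simp; ring
  rw [he]; push_cast; field_simp

/-- This is what gives λ(2b, m) = ε_m (b/m) for odd m. -/
lemma I_cpow_mul_jac_two {m : ℕ} (hm : Odd m) : I ^ ((1 - (m : ℂ)) / 2) * jac 2 m = eps m := by
  obtain ⟨q, r, hr, rfl⟩ : ∃ q r, r < 4 ∧ m = 8 * q + (2 * r + 1) := by
    obtain ⟨t, rfl⟩ := hm
    exact ⟨t / 4, t % 4, Nat.mod_lt _ (by norm_num), by omega⟩
  have h1 : ((1 - ((8 * q + (2 * r + 1) : ℕ) : ℂ)) / 2) = ((4 * (-q : ℤ) - r : ℤ) : ℂ) := by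
    push_cast; ring
  have h4 : (I : ℂ) ^ (4 : ℤ) = 1 := by exact_mod_cast I_pow_four
  rw [h1, cpow_intCast, zpow_sub₀ I_ne_zero, zpow_mul, h4, one_zpow, jac, jacobiSym.at_two hm,
    ZMod.χ₈_nat_eq_if_mod_eight, zpow_natCast, eps]
  have e1 : (8 * q + (2 * r + 1)) % 8 = 2 * r + 1 := by omega
  have e2 : (8 * q + (2 * r + 1)) % 2 = 1 := by omega
  have e3 : (8 * q + (2 * r + 1)) % 4 = (2 * r + 1) % 4 := by omega
  rw [e1, e2, e3]
  interval_cases r <;> simp [I_pow_three]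

/-- Since ε_m² = (-1/m), an odd power of ε_m is ε_m times a power of that symbol, whose exponent
matters modulo 2. -/
lemma eps_zpow {m : ℕ} (hm : Odd m) (k : ℤ) :
    eps m ^ (-2 * k - 1) = eps m * jac (-((k.negOnePow : ℤˣ) : ℤ)) m := by
  have hm4 : m % 4 = 1 ∨ m % 4 = 3 := by obtain ⟨t, ht⟩ := hm; omega
  have hneg : jac (-1) m = if m % 4 = 1 then 1 else -1 := by
    rw [jac, jacobiSym.at_neg_one hm, ZMod.χ₄_nat_mod_four]
    rcases hm4 with h | h <;> rw [h] <;> simp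
  rcases negOnePow_cases k with ⟨hk, h⟩ | ⟨hk, h⟩ <;> rw [h]
  · rw [hneg]
    rcases hm4 with h4 | h4
    · simp [eps, h4]
    · simp only [eps, h4]; norm_num
      have := I_zpow_neg_eq k
      rw [I_zpow_eq, if_pos hk] at this
      simpa using this
  · rw [neg_neg, jac_one_left]
    rcases hm4 with h4 | h4
    · simp [eps, h4]
    · simp only [eps, h4]; norm_num
      have := I_zpow_neg_eq k
      rw [I_zpow_eq, if_neg hk] at this
      simpa using this

lemma upsilon_odd {m : ℕ} (hm : Odd m) (k h : ℤ) :
    upsilon k h m = eps m ^ (-2 * k - 1) * (1 / ((Real.sqrt m : ℝ) : ℂ)) * jacGauss m h := by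
  rw [upsilon, if_pos hm, jacGauss]
  congr 1
  refine Finset.sum_congr rfl fun n _ => ?_
  rw [jac, ech]; congr 2; push_cast; ring

/-- For odd m, λ(a, m) vanishes at odd a, so a = 2b and λ(2b, m) = ε_m (b/m). Replacing b by -(-1)^k
b matches the exponentials and produces the symbol that turns ε_m into ε_m^(-2k-1). -/
lemma upsilon_eq_gaussGamma (k h : ℤ) (m : ℕ) : upsilon k h m = gaussGamma m (signed k h) := by
  by_cases hm : Odd m
  swap; · rw [upsilon, if_neg hm]
  have hm0 : m ≠ 0 := by rintro rfl; simp at hm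
  have hmC : (m : ℂ) ≠ 0 := by exact_mod_cast hm0
  rw [upsilon_odd hm, gaussGamma]
  have h1 : ∑ a ∈ Finset.Icc 1 (2 * m), lam a m * exp (-(Real.pi * I * (signed k h : ℤ) * a / m)) =
      ∑ b ∈ Finset.Icc 1 m, lam (2 * b) m * exp (-(Real.pi * I * (signed k h : ℤ) * (2 * b : ℕ) / m)) := by
    symm
    refine Finset.sum_of_injOn (fun b => 2 * b) (fun a _ b _ hab => by simpa using hab) ?_ ?_ ?_
    · intro b hb; simp only [Finset.coe_Icc, Set.mem_Icc] at *; omega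
    · intro a ha hna
      have : ¬ Even a := by
        rintro ⟨b, rfl⟩
        apply hna
        simp only [Finset.mem_Icc] at ha
        exact ⟨b, by simp only [Finset.coe_Icc, Set.mem_Icc]; omega, by simp; ring⟩
      rw [lam, if_neg (by tauto), if_neg (by rw [← Nat.not_odd_iff_even]; tauto), zero_mul]
    · intro b _; rfl
  rw [h1]
  have hper := jac_mul_ech_periodic hm0 h
  rw [jacGauss, ← sum_Icc_negOnePow k hm0 hper, eps_zpow hm]
  have h2 : ∀ b : ℕ, lam (2 * b) m * exp (-(Real.pi * I * (signed k h : ℤ) * (2 * b : ℕ) / m)) =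
      eps m * jac (-((k.negOnePow : ℤˣ) : ℤ)) m * (jac (-(((k.negOnePow : ℤˣ) : ℤ) * b)) m *
        ech m (-(((k.negOnePow : ℤˣ) : ℤ) * b) * h)) := by
    intro b
    rw [lam, if_pos ⟨hm, by simp⟩, ← I_cpow_mul_jac_two hm]
    have e1 : ((jacobiSym ((2 * b : ℕ) : ℤ) m : ℤ) : ℂ) = jac 2 m * jac b m := by
      rw [← jac_mul_left, jac]; push_cast; rfl
    have e2 : jac (-(((k.negOnePow : ℤˣ) : ℤ) * b)) m =
        jac (-((k.negOnePow : ℤˣ) : ℤ)) m * jac b m := by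
      rw [← jac_mul_left]; congr 1; ring
    have e3 : exp (-(Real.pi * I * (signed k h : ℤ) * (2 * b : ℕ) / m)) =
        ech m (-(((k.negOnePow : ℤˣ) : ℤ) * b) * h) := by
      rw [ech]; congr 1; rw [signed]; push_cast; field_simp
    have e4 : jac (-((k.negOnePow : ℤˣ) : ℤ)) m * jac (-((k.negOnePow : ℤˣ) : ℤ)) m = 1 :=
      jac_sq (Int.isCoprime_iff_gcd_eq_one.1 (isCoprime_neg_negOnePow k m).symm)
    rw [e1, e2, e3]
    linear_combination (-(I ^ ((1 - (m : ℂ)) / 2) * jac 2 m * jac b m *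
      ech m (-(((k.negOnePow : ℤˣ) : ℤ) * b) * h))) * e4
  simp_rw [h2, ← Finset.mul_sum]
  ring

end

section
open Complex Filter Topology

/-! ### The automorphy factor -/

lemma half_int_ne_zero (k : ℤ) : ((k : ℂ) + 1 / 2) ≠ 0 := by
  intro h
  have h1 : (2 * k + 1 : ℂ) = 0 := by linear_combination 2 * h
  have : (2 * k + 1 : ℤ) = 0 := by exact_mod_cast h1
  omega

lemma autFactor_zero (k : ℤ) (s : ℂ) : autFactor k s 0 = 0 := by
  simp only [autFactor]
  rw [zero_cpow (half_int_ne_zero k), zero_mul]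

lemma norm_autFactor (k : ℤ) (s : ℂ) {w : ℂ} (hw : w ≠ 0) :
    ‖autFactor k s w‖ = ‖w‖ ^ ((k : ℝ) + 1 / 2 + 2 * s.re) := by
  have hpos : 0 < ‖w‖ := norm_pos_iff.2 hw
  have him : ((k : ℂ) + 1 / 2).im = 0 := by simp
  have hre : ((k : ℂ) + 1 / 2).re = k + 1 / 2 := by simp
  rw [autFactor, norm_mul, norm_cpow_of_ne_zero hw, norm_cpow_eq_rpow_re_of_pos hpos, him, hre,
    Real.rpow_add hpos (k + 1 / 2)]
  simp

lemma autFactor_ne_zero (k : ℤ) (s : ℂ) {w : ℂ} (hw : w ≠ 0) : autFactor k s w ≠ 0 := by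
  rw [← norm_ne_zero_iff, norm_autFactor k s hw]
  exact (Real.rpow_pos_of_pos (norm_pos_iff.2 hw) _).ne'

lemma autFactor_ofReal_mul (k : ℤ) (s : ℂ) {r : ℝ} (hr : 0 < r) {x : ℂ} (hx : x ≠ 0) :
    autFactor k s (r * x) = (r : ℂ) ^ ((k : ℂ) + 1 / 2 + 2 * s) * autFactor k s x := by
  have hr' : (r : ℂ) ≠ 0 := by exact_mod_cast hr.ne'
  have hx' : ((‖x‖ : ℝ) : ℂ) ≠ 0 := by exact_mod_cast (norm_pos_iff.2 hx).ne'
  rw [autFactor, autFactor, ofReal_mul_cpow hr hx, norm_mul, norm_real, Real.norm_of_nonneg hr.le,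
    ofReal_mul, ofReal_mul_cpow hr hx', cpow_add ((k : ℂ) + 1 / 2) (2 * s) hr']
  ring

/-- Off the negative axis log z plus the logarithm of the conjugate is 2 log |z|, so |z|^(-2s)
splits as z^(-s) times the same power of the conjugate. The exponents become a = k + 1/2 + s and b =
s. -/
lemma autFactor_inv_eq_lineFun (k : ℤ) (s : ℂ) {v : ℝ} (hv : 0 < v) (u : ℝ) :
    (autFactor k s ((u : ℂ) + v * I))⁻¹ = lineFun v ((k : ℂ) + 1 / 2 + s) (0 + s) u := by
  have h1 := slitPlane_ne_zero (line_slit hv u)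
  have h2 := slitPlane_ne_zero (line_slit' hv u)
  have hpos : 0 < ‖(u : ℂ) + v * I‖ := norm_pos_iff.2 h1
  have hn : ((‖(u : ℂ) + v * I‖ : ℝ) : ℂ) ≠ 0 := by exact_mod_cast hpos.ne'
  have hconj : (u : ℂ) - v * I = (starRingEnd ℂ) (u + v * I) := by simp [sub_eq_add_neg]
  have harg : ((u : ℂ) + v * I).arg ≠ Real.pi := by
    intro h; rw [arg_eq_pi_iff] at h; simp [hv.ne'] at h
  have hlog : log ((u : ℂ) + v * I) + log ((u : ℂ) - v * I) =
      2 * log ((‖(u : ℂ) + v * I‖ : ℝ) : ℂ) := by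
    rw [hconj, log_conj _ harg, add_conj, log_re, ← ofReal_log hpos.le]; push_cast; ring
  rw [autFactor, lineFun, cpow_def_of_ne_zero h1, cpow_def_of_ne_zero h1, cpow_def_of_ne_zero h2,
    cpow_def_of_ne_zero hn, ← exp_add, ← exp_add, ← exp_neg]
  congr 1
  linear_combination s * hlog

/-- Comparison with the Eisenstein series over ℤ²: the modulus of the factor is |mz + n| to the
power k + 1/2 + 2 Re s, which exceeds 2. -/
lemma summable_autFactor {k : ℤ} {s : ℂ} (hs : 2 < (k : ℝ) + 1 / 2 + 2 * s.re) {z : ℂ}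
    (hz : 0 < z.im) :
    Summable fun p : ℕ × ℤ => (autFactor k s ((p.1 : ℂ) * z + p.2))⁻¹ := by
  set x := (k : ℝ) + 1 / 2 + 2 * s.re with hx
  let zz : UpperHalfPlane := ⟨z, hz⟩
  have h1 := (EisensteinSeries.summable_one_div_norm_rpow hs).mul_left (EisensteinSeries.r zz ^ (-x))
  have hinj : Function.Injective fun p : ℕ × ℤ => (![(p.1 : ℤ), p.2] : Fin 2 → ℤ) := by
    rintro ⟨a, b⟩ ⟨c, d⟩ h
    have e0 := congrFun h 0
    have e1 := congrFun h 1
    simp at e0 e1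
    simp [e0, e1]
  refine Summable.of_norm_bounded (h1.comp_injective hinj) fun p => ?_
  have h2 := EisensteinSeries.summand_bound zz (k := x) (by linarith) ![(p.1 : ℤ), p.2]
  simp only [Function.comp]
  refine le_trans ?_ h2
  simp only [Matrix.cons_val_zero, Matrix.cons_val_one, Int.cast_natCast]
  change _ ≤ ‖(p.1 : ℂ) * z + p.2‖ ^ (-x)
  -- This is the pair (0, 0): the power of 0 is 0, since k + 1/2 ≠ 0, and its inverse is 0 by
  -- convention.
  by_cases hw : (p.1 : ℂ) * z + p.2 = 0
  · rw [hw, autFactor_zero, inv_zero, norm_zero]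
    positivity
  · rw [norm_inv, norm_autFactor k s hw, Real.rpow_neg (norm_nonneg ((p.1 : ℂ) * z + p.2))]

/-- The Fourier transform entering the expansion, times the corresponding exponential. -/
def lineChar (k : ℤ) (s : ℂ) (τ : UpperHalfPlane) (h : ℤ) : ℂ :=
  lineFT τ.im ((k : ℂ) + 1 / 2 + s) (0 + s) h * exp (2 * Real.pi * I * h * τ.re)

lemma rhoIntegrand_eq (k h : ℤ) (s : ℂ) {v : ℝ} (hv : 0 < v) (u : ℝ) :
    rhoIntegrand k h s v u = exp (2 * Real.pi * h * v) *
      (exp (-(2 * Real.pi * I * h * u)) * lineFun v ((k : ℂ) + 1 / 2 + s) (0 + s) u) := by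
  rw [rhoIntegrand, autFactor_inv_eq_lineFun k s hv, ← mul_assoc, ← exp_add, mul_comm]
  congr 2
  linear_combination (-2 * Real.pi * h * v : ℂ) * I_sq

lemma rho_mul_exp (k h : ℤ) (s : ℂ) (τ : UpperHalfPlane) :
    rho k h s τ.im * exp (2 * Real.pi * I * h * (τ : ℂ)) = lineChar k s τ h := by
  rw [rho]
  simp_rw [rhoIntegrand_eq k h s τ.im_pos]
  rw [MeasureTheory.integral_const_mul, ← lineFT_eq, lineChar, mul_comm (exp _) (lineFT _ _ _ _),
    mul_assoc, ← exp_add]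
  congr 2
  have : (τ : ℂ) = τ.re + τ.im * I := (re_add_im (τ : ℂ)).symm
  rw [this]
  linear_combination (2 * Real.pi * h * τ.im : ℂ) * I_sq

lemma re_cond {k : ℤ} {s : ℂ} (hs : 2 < (k : ℝ) + 1 / 2 + 2 * s.re) :
    1 < ((k : ℂ) + 1 / 2 + s).re + (0 + s).re := by simp; linarith

lemma integrable_rhoIntegrand {k : ℤ} {s : ℂ} (hs : 2 < (k : ℝ) + 1 / 2 + 2 * s.re) (h : ℤ)
    {v : ℝ} (hv : 0 < v) : MeasureTheory.Integrable (rhoIntegrand k h s v) := by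
  have := (integrable_char_mul (integrable_lineFun hv (re_cond hs)) h).const_mul
    (exp (2 * Real.pi * h * v))
  exact this.congr (Eventually.of_forall fun u => (rhoIntegrand_eq k h s hv u).symm)

lemma summable_lineChar {k : ℤ} {s : ℂ} (hs : 2 < (k : ℝ) + 1 / 2 + 2 * s.re)
    (τ : UpperHalfPlane) : Summable fun h => ‖lineChar k s τ h‖ := by
  refine (summable_lineFT τ.im_pos (re_cond hs)).norm.congr fun h => ?_
  have : (2 * Real.pi * I * h * τ.re : ℂ) = ((2 * Real.pi * h * τ.re : ℝ) : ℂ) * I := by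
    push_cast; ring
  rw [lineChar, norm_mul, this, norm_exp_ofReal_mul_I, mul_one]

/-- Poisson summation for the automorphy factor with periodic coefficients. -/
lemma tsum_periodic_autFactor {k : ℤ} {s : ℂ} (hs : 2 < (k : ℝ) + 1 / 2 + 2 * s.re)
    (τ : UpperHalfPlane) {m : ℕ} (hm : m ≠ 0) {c : ℤ → ℂ} (hc : Function.Periodic c (m : ℤ))
    (hcb : ∀ n, ‖c n‖ ≤ 1) :
    ∑' n : ℤ, c n * (autFactor k s ((m : ℂ) * τ + n))⁻¹ =
      ∑' h : ℤ, lineChar k s τ h * ((m : ℂ) ^ (-((k : ℂ) + 1 / 2 + 2 * s)) *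
        ∑ r ∈ Finset.range m, c r * ech m (r * h)) := by
  have hmC : (m : ℂ) ≠ 0 := by exact_mod_cast hm
  have hmR : (0 : ℝ) < m := by positivity
  have hsum0 : Summable fun n : ℤ => (autFactor k s ((m : ℂ) * τ + n))⁻¹ :=
    (summable_autFactor hs τ.im_pos).comp_injective (i := fun n : ℤ => (m, n))
      (fun a b h => (Prod.mk.inj h).2)
  have hsum : Summable fun n : ℤ => c n * (autFactor k s ((m : ℂ) * τ + n))⁻¹ := by
    refine Summable.of_norm_bounded hsum0.norm fun n => ?_
    rw [norm_mul]
    exact mul_le_of_le_one_left (norm_nonneg _) (hcb n)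
  rw [tsum_int_residue hsum hm]
  have hτ : (τ : ℂ) = τ.re + τ.im * I := (re_add_im (τ : ℂ)).symm
  -- Pulling m out of the automorphy factor makes the class r + mℤ a translate of ℤ by r/m; Poisson
  -- summation turns the shift into the phase `ech m (r * h)`.
  have h1 : ∀ r : ℕ, ∑' l : ℤ, c (r + m * l) * (autFactor k s ((m : ℂ) * τ + (r + m * l : ℤ)))⁻¹ =
      ∑' h : ℤ, c r * ((m : ℂ) ^ (-((k : ℂ) + 1 / 2 + 2 * s)) *
        (lineChar k s τ h * ech m (r * h))) := by
    intro r
    rw [tsum_mul_left, tsum_mul_left]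
    have h2 : ∀ l : ℤ, c (r + m * l) * (autFactor k s ((m : ℂ) * τ + (r + m * l : ℤ)))⁻¹ =
        c r * ((m : ℂ) ^ (-((k : ℂ) + 1 / 2 + 2 * s)) *
          lineFun τ.im ((k : ℂ) + 1 / 2 + s) (0 + s) ((τ.re + r / m) + l)) := by
      intro l
      rw [periodic_int_eq hc (a := r + m * l) (b := r) ⟨l, by ring⟩]
      congr 1
      rw [← autFactor_inv_eq_lineFun k s τ.im_pos]
      have h3 : (m : ℂ) * τ + (r + m * l : ℤ) =
          ((m : ℝ) : ℂ) * (((τ.re + r / m + l : ℝ) : ℂ) + τ.im * I) := by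
        rw [hτ]; push_cast; field_simp; ring
      rw [h3, autFactor_ofReal_mul k s hmR (slitPlane_ne_zero (line_slit τ.im_pos _)), mul_inv,
        cpow_neg]
      simp
    simp_rw [h2]
    rw [tsum_mul_left, tsum_mul_left, tsum_lineFun τ.im_pos (re_cond hs)]
    congr 2
    refine tsum_congr fun h => ?_
    rw [lineChar, ech, mul_assoc (lineFT _ _ _ _), ← exp_add]
    congr 2; push_cast; field_simp
  simp_rw [h1]
  rw [← Summable.tsum_finsetSum]
  · refine tsum_congr fun h => ?_
    rw [Finset.mul_sum, Finset.mul_sum]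
    exact Finset.sum_congr rfl fun r _ => by ring
  · intro r _
    refine Summable.mul_left _ (Summable.mul_left _ ?_)
    refine Summable.of_norm_bounded (summable_lineChar hs τ) fun h => ?_
    rw [norm_mul, norm_ech, mul_one]

lemma eisTerm_eq (k : ℤ) (s z : ℂ) (m : ℕ) (n : ℤ) : eisTerm k s z (m, n) =
    (if Odd m then jac n m * eps m ^ (-2 * k - 1) else 0) *
      (autFactor k s ((m : ℂ) * z + n))⁻¹ := by
  rw [eisTerm]
  by_cases hm : Odd m
  · have hm0 : m ≠ 0 := by rintro rfl; simp at hm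
    by_cases hg : Int.gcd n m = 1
    · rw [if_pos ⟨hm, hg⟩, if_pos hm, div_eq_mul_inv, jac]
    · rw [if_neg (by tauto), if_pos hm, jac_eq_zero hm0 hg]; simp
  · rw [if_neg (by tauto), if_neg hm, zero_mul]

lemma norm_eps_zpow (m : ℕ) (k : ℤ) : ‖eps m ^ k‖ = 1 := by
  rw [norm_zpow, eps]; split_ifs <;> simp

lemma summable_eisTerm {k : ℤ} {s : ℂ} (hs : 2 < (k : ℝ) + 1 / 2 + 2 * s.re) {z : ℂ}
    (hz : 0 < z.im) : Summable (eisTerm k s z) := by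
  refine Summable.of_norm_bounded (summable_autFactor hs hz).norm fun p => ?_
  rw [← Prod.mk.eta (p := p), eisTerm_eq, norm_mul]
  refine mul_le_of_le_one_left (norm_nonneg _) ?_
  split_ifs
  · rw [norm_mul, norm_eps_zpow, mul_one]; exact norm_jac_le _ _
  · simp

/-! ### Convergence of the Dirichlet series -/

lemma norm_upsilon_le (k h : ℤ) {m : ℕ} (hm : Odd m) : ‖upsilon k h m‖ ≤ Real.sqrt m := by
  rw [upsilon_odd hm, norm_mul, norm_mul, norm_eps_zpow, one_mul, norm_div, norm_one, norm_real,
    Real.norm_of_nonneg (Real.sqrt_nonneg _)]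
  calc _ ≤ 1 / Real.sqrt m * m := mul_le_mul_of_nonneg_left (norm_jacGauss_le m h) (by positivity)
    _ = _ := by rw [one_div, inv_mul_eq_div, Real.div_sqrt]

lemma norm_bGauss_le (k : ℤ) (n : ℕ) (h : ℤ) : ‖bGauss k n h‖ ≤ 4 * Real.sqrt n := by
  rw [bGauss, norm_mul, norm_div, norm_one, norm_real, Real.norm_of_nonneg (Real.sqrt_nonneg _)]
  have : ‖∑ a ∈ Finset.range (4 * n), bcoef k n a * ech (4 * n) (a * h)‖ ≤ 4 * n := by
    refine (norm_sum_le _ _).trans ?_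
    calc _ ≤ ∑ a ∈ Finset.range (4 * n), (1 : ℝ) := Finset.sum_le_sum fun a _ => by
          rw [norm_mul, norm_ech, mul_one]; exact norm_bcoef_le _ _ _
      _ = _ := by simp
  calc _ ≤ 1 / Real.sqrt n * (4 * n) := mul_le_mul_of_nonneg_left this (by positivity)
    _ = 4 * (n / Real.sqrt n) := by ring
    _ = _ := by rw [Real.div_sqrt]

/-- The `n`-th term of the even Dirichlet series, up to a constant factor. -/
def bTerm (k h : ℤ) (w : ℂ) (n : ℕ) : ℂ := if n = 0 then 0 else bGauss k n h / (n : ℂ) ^ w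

lemma norm_oddTerm_le (k h : ℤ) (w : ℂ) (m : ℕ) :
    ‖oddTerm (upsilon k h) w m‖ ≤ (m : ℝ) ^ (1 / 2 - w.re) := by
  rw [oddTerm]
  split_ifs with hm
  · have hm0 : 0 < m := hm.pos
    have hmR : (0 : ℝ) < m := by positivity
    rw [norm_div, norm_natCast_cpow_of_pos hm0, Real.rpow_sub hmR, ← Real.sqrt_eq_rpow]
    exact div_le_div_of_nonneg_right (norm_upsilon_le k h hm) (by positivity)
  · simp; positivity

lemma norm_bTerm_le (k h : ℤ) (w : ℂ) (n : ℕ) :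
    ‖bTerm k h w n‖ ≤ 4 * (n : ℝ) ^ (1 / 2 - w.re) := by
  rw [bTerm]
  split_ifs with hn
  · simp; positivity
  · have hn0 : 0 < n := Nat.pos_of_ne_zero hn
    have hnR : (0 : ℝ) < n := by positivity
    rw [norm_div, norm_natCast_cpow_of_pos hn0, Real.rpow_sub hnR, ← Real.sqrt_eq_rpow, ← mul_div_assoc]
    exact div_le_div_of_nonneg_right (norm_bGauss_le k n h) (by positivity)

lemma summable_majorant {x : ℝ} (hx : 3 / 2 < x) : Summable fun m : ℕ => (m : ℝ) ^ (1 / 2 - x) :=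
  Real.summable_nat_rpow.2 (by linarith)

lemma summable_oddTerm (k h : ℤ) {w : ℂ} (hw : 3 / 2 < w.re) :
    Summable (oddTerm (upsilon k h) w) :=
  Summable.of_norm_bounded (summable_majorant hw) (norm_oddTerm_le k h w)

lemma summable_bTerm (k h : ℤ) {w : ℂ} (hw : 3 / 2 < w.re) : Summable (bTerm k h w) :=
  Summable.of_norm_bounded ((summable_majorant hw).mul_left 4) (norm_bTerm_le k h w)

lemma evenTerm_two_mul (k h : ℤ) (w : ℂ) (n : ℕ) :
    (1 + I ^ (2 * k + 1)) * evenTerm (upsilon k h) w (2 * n) = bTerm k h w n := by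
  rw [evenTerm, bTerm]
  rcases eq_or_ne n 0 with rfl | hn
  · simp
  · rw [if_pos ⟨by simp, by omega⟩, if_neg hn, upsilon_eq_gaussGamma, ← gaussGamma_even k hn,
      mul_div_assoc]
    congr 3; push_cast; ring

lemma hasSum_evenTerm (k h : ℤ) {w : ℂ} (hw : 3 / 2 < w.re) :
    HasSum (evenTerm (upsilon k h) w) ((1 + I ^ (2 * k + 1))⁻¹ * ∑' n, bTerm k h w n) := by
  have hinj : Function.Injective fun n : ℕ => 2 * n := fun a b h => by simpa using h
  rw [← hinj.hasSum_iff]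
  · have h1 := (summable_bTerm k h hw).hasSum.mul_left (1 + I ^ (2 * k + 1))⁻¹
    have h2 : (evenTerm (upsilon k h) w ∘ fun n : ℕ => 2 * n) =
        fun n => (1 + I ^ (2 * k + 1))⁻¹ * bTerm k h w n := by
      funext n
      rw [← evenTerm_two_mul]
      exact (inv_mul_cancel_left₀ (one_add_I_zpow_ne_zero k) _).symm
    rw [h2]
    exact h1
  · intro c hc
    rw [evenTerm, if_neg]
    rintro ⟨⟨n, rfl⟩, -⟩
    exact hc ⟨n, by simp; ring⟩

end

section
open Complex Filter Topology

/-! ### The Fourier expansion -/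

lemma norm_dirichlet_coeff_le {k : ℤ} {s : ℂ} (q m : ℕ) (hq : q ≠ 0) (hm : m ≠ 0) {c : ℤ → ℂ}
    (hcb : ∀ n, ‖c n‖ ≤ 1) (h : ℤ) :
    ‖((q * m : ℕ) : ℂ) ^ (-((k : ℂ) + 1 / 2 + 2 * s)) *
      ∑ r ∈ Finset.range (q * m), c r * ech (q * m) (r * h)‖ ≤
    ((q * m : ℕ) : ℝ) ^ (1 - ((k : ℝ) + 1 / 2 + 2 * s.re)) := by
  have hpos : 0 < q * m := by positivity
  have hR : (0 : ℝ) < ((q * m : ℕ) : ℝ) := by exact_mod_cast hpos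
  have hre : (-((k : ℂ) + 1 / 2 + 2 * s)).re = -((k : ℝ) + 1 / 2 + 2 * s.re) := by simp
  rw [norm_mul, norm_natCast_cpow_of_pos hpos, hre, sub_eq_neg_add, Real.rpow_add hR, Real.rpow_one]
  refine mul_le_mul_of_nonneg_left ((norm_sum_le _ _).trans ?_) (by positivity)
  calc _ ≤ ∑ a ∈ Finset.range (q * m), (1 : ℝ) := Finset.sum_le_sum fun a _ => by
        rw [norm_mul, norm_ech, mul_one]; exact hcb _
    _ = _ := by simp

/-- The Fourier expansion of a lattice sum with periodic coefficients. -/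
lemma tsum_lattice_expansion {k : ℤ} {s : ℂ} (hs : 2 < (k : ℝ) + 1 / 2 + 2 * s.re)
    (τ : UpperHalfPlane) {q : ℕ} (hq : q ≠ 0) {c : ℕ → ℤ → ℂ}
    (hc : ∀ m ≠ 0, Function.Periodic (c m) ((q * m : ℕ) : ℤ)) (hcb : ∀ m n, ‖c m n‖ ≤ 1)
    (hc0 : ∀ n, c 0 n = 0) :
    ∑' p : ℕ × ℤ, c p.1 p.2 * (autFactor k s (((q * p.1 : ℕ) : ℂ) * τ + p.2))⁻¹ =
      ∑' h : ℤ, lineChar k s τ h * ∑' m : ℕ, if m = 0 then 0 else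
        ((q * m : ℕ) : ℂ) ^ (-((k : ℂ) + 1 / 2 + 2 * s)) *
          ∑ r ∈ Finset.range (q * m), c m r * ech (q * m) (r * h) := by
  have hinj : Function.Injective fun p : ℕ × ℤ => (q * p.1, p.2) := by
    rintro ⟨a, b⟩ ⟨a', b'⟩ h
    simp only [Prod.mk.injEq] at h
    rw [Nat.eq_of_mul_eq_mul_left (Nat.pos_of_ne_zero hq) h.1, h.2]
  have hsum : Summable fun p : ℕ × ℤ =>
      c p.1 p.2 * (autFactor k s (((q * p.1 : ℕ) : ℂ) * τ + p.2))⁻¹ := by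
    refine Summable.of_norm_bounded ((summable_autFactor hs τ.im_pos).norm.comp_injective hinj)
      fun p => ?_
    rw [norm_mul]
    exact mul_le_of_le_one_left (norm_nonneg _) (hcb _ _)
  let D : ℤ → ℕ → ℂ := fun h m => if m = 0 then 0 else
        ((q * m : ℕ) : ℂ) ^ (-((k : ℂ) + 1 / 2 + 2 * s)) *
          ∑ r ∈ Finset.range (q * m), c m r * ech (q * m) (r * h)
  have hmaj : Summable fun m : ℕ => ((q * m : ℕ) : ℝ) ^ (1 - ((k : ℝ) + 1 / 2 + 2 * s.re)) := by
    have h1 : Summable fun m : ℕ => (m : ℝ) ^ (1 - ((k : ℝ) + 1 / 2 + 2 * s.re)) :=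
      Real.summable_nat_rpow.2 (by linarith)
    exact h1.comp_injective (i := fun m => q * m) fun a b h =>
      Nat.eq_of_mul_eq_mul_left (Nat.pos_of_ne_zero hq) h
  have hD : ∀ h m, ‖D h m‖ ≤ ((q * m : ℕ) : ℝ) ^ (1 - ((k : ℝ) + 1 / 2 + 2 * s.re)) := by
    intro h m
    by_cases hm : m = 0
    · simp only [D, hm, if_true, norm_zero]; positivity
    · simp only [D, hm, if_false]
      exact norm_dirichlet_coeff_le q m hq hm (hcb m) h
  -- The coefficients are bounded by a summable sequence independent of h, so the double series
  -- converges absolutely and the order of summation may be exchanged.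
  have hprod : Summable fun x : ℤ × ℕ => lineChar k s τ x.1 * D x.1 x.2 := by
    refine Summable.of_norm_bounded
      ((summable_lineChar hs τ).mul_of_nonneg hmaj (fun _ => norm_nonneg _)
        (fun m => by positivity)) fun x => ?_
    rw [norm_mul]
    exact mul_le_mul_of_nonneg_left (hD _ _) (norm_nonneg _)
  rw [hsum.tsum_prod]
  have h1 : ∀ m : ℕ, ∑' n : ℤ, c m n * (autFactor k s (((q * m : ℕ) : ℂ) * τ + n))⁻¹ =
      ∑' h : ℤ, lineChar k s τ h * D h m := by
    intro m
    by_cases hm : m = 0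
    · subst hm; simp [hc0, D]
    · simp only [D, hm, if_false]
      exact tsum_periodic_autFactor hs τ (mul_ne_zero hq hm) (hc m hm) (hcb m)
  simp_rw [h1]
  rw [Summable.tsum_comm (f := fun h m => lineChar k s τ h * D h m) hprod]
  exact tsum_congr fun h => tsum_mul_left

/-- The factor m^(-1/2) normalises the Gauss sum; the rest is the Dirichlet weight at k + 2s. -/
lemma natCast_cpow_weight (k : ℤ) (s : ℂ) {m : ℕ} (hm : m ≠ 0) :
    (m : ℂ) ^ (-((k : ℂ) + 1 / 2 + 2 * s)) =
      1 / ((Real.sqrt m : ℝ) : ℂ) / (m : ℂ) ^ ((k : ℂ) + 2 * s) := by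
  have hmC : (m : ℂ) ≠ 0 := by exact_mod_cast hm
  have h1 : ((Real.sqrt m : ℝ) : ℂ) = (m : ℂ) ^ (1 / 2 : ℂ) := by
    rw [Real.sqrt_eq_rpow, ofReal_cpow (by positivity)]; push_cast; rfl
  rw [h1, cpow_neg, show (k : ℂ) + 1 / 2 + 2 * s = 1 / 2 + (k + 2 * s) by ring, cpow_add _ _ hmC,
    div_div, ← one_div ((m : ℂ) ^ (1 / 2 : ℂ) * _)]

lemma eisE_expansion {k : ℤ} {s : ℂ} (hs : 2 < (k : ℝ) + 1 / 2 + 2 * s.re) (τ : UpperHalfPlane) :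
    eisE k s τ =
      ∑' h : ℤ, lineChar k s τ h * ∑' m : ℕ, oddTerm (upsilon k h) ((k : ℂ) + 2 * s) m := by
  let c : ℕ → ℤ → ℂ := fun m n => if Odd m then jac n m * eps m ^ (-2 * k - 1) else 0
  have h := tsum_lattice_expansion hs τ one_ne_zero (c := c) ?_ ?_ ?_
  · rw [eisE]
    simp only [one_mul] at h
    rw [tsum_congr fun p : ℕ × ℤ => eisTerm_eq k s τ p.1 p.2, h]
    refine tsum_congr fun h => ?_
    congr 1
    refine tsum_congr fun m => ?_
    rw [oddTerm]
    by_cases hm : Odd m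
    · have hm0 : m ≠ 0 := by rintro rfl; simp at hm
      simp only [hm0, if_false, c, if_pos hm, upsilon_odd hm, jacGauss, natCast_cpow_weight k s hm0]
      rw [Finset.mul_sum, Finset.mul_sum, Finset.sum_div]
      exact Finset.sum_congr rfl fun r _ => by ring
    · simp [c, hm]
  · intro m _
    rw [one_mul]
    by_cases hm : Odd m
    · intro n; simp only [c, if_pos hm]; congr 1; exact jac_periodic m n
    · intro n; simp [c, hm]
  · intro m n
    by_cases hm : Odd m
    · simp only [c, if_pos hm, norm_mul, norm_eps_zpow, mul_one]; exact norm_jac_le _ _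
    · simp [c, hm]
  · intro n; simp [c]

/-! ### Inversion: branches of the half-integral power and the expansion of F. -/

lemma exp_pi_half_int (k : ℤ) : exp (Real.pi * I * ((k : ℂ) + 1 / 2)) = I ^ (2 * k + 1) := by
  have h := exp_int_mul (Real.pi / 2 * I) (2 * k + 1)
  rw [exp_pi_div_two_mul_I] at h
  rw [← h]; congr 1; push_cast; ring

lemma log_neg_of_im_pos {y : ℂ} (hy : 0 < y.im) : log (-y) = log y - Real.pi * I := by
  rw [log, log, norm_neg, arg_neg_eq_arg_sub_pi_of_im_pos hy]; push_cast; ring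

lemma autFactor_neg (k : ℤ) (s : ℂ) {y : ℂ} (hy : 0 < y.im) :
    I ^ (2 * k + 1) * autFactor k s (-y) = autFactor k s y := by
  have h0 : y ≠ 0 := by rintro rfl; simp at hy
  rw [autFactor, autFactor, norm_neg, ← mul_assoc, cpow_def_of_ne_zero h0,
    cpow_def_of_ne_zero (neg_ne_zero.2 h0), log_neg_of_im_pos hy, ← exp_pi_half_int, ← exp_add]
  congr 2; ring

/-- Both arguments lie in (0, π], so arg x + arg y - π is a principal argument: for -(xy) logarithms
add without a jump. The missing πi yields e^(πi(k + 1/2)) = i^(2k+1). -/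
lemma autFactor_mul (k : ℤ) (s : ℂ) {x y : ℂ} (hx : 0 < x.im) (hy : 0 < y.im) :
    autFactor k s x * autFactor k s y = I ^ (2 * k + 1) * autFactor k s (-(x * y)) := by
  have hx0 : x ≠ 0 := by rintro rfl; simp at hx
  have hy0 : y ≠ 0 := by rintro rfl; simp at hy
  have hlog : log (-(x * y)) = log x + (log y - Real.pi * I) := by
    rw [← log_neg_of_im_pos hy, ← mul_neg, log_mul hx0 (neg_ne_zero.2 hy0)]
    rw [arg_neg_eq_arg_sub_pi_of_im_pos hy]
    have h1 := arg_le_pi x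
    have h2 := arg_le_pi y
    have h3 : 0 < arg x := by
      rcases (arg_nonneg_iff.2 hx.le).lt_or_eq with h | h
      · exact h
      · have := arg_eq_zero_iff.1 h.symm; rw [this.2] at hx; simp at hx
    have h4 : 0 < arg y := by
      rcases (arg_nonneg_iff.2 hy.le).lt_or_eq with h | h
      · exact h
      · have := arg_eq_zero_iff.1 h.symm; rw [this.2] at hy; simp at hy
    constructor <;> linarith
  have hn : ((‖x‖ : ℝ) : ℂ) ^ (2 * s) * ((‖y‖ : ℝ) : ℂ) ^ (2 * s) =
      ((‖-(x * y)‖ : ℝ) : ℂ) ^ (2 * s) := by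
    rw [norm_neg, norm_mul, ofReal_mul, mul_cpow_ofReal_nonneg (norm_nonneg _) (norm_nonneg _)]
  rw [autFactor, autFactor, autFactor, ← hn, cpow_def_of_ne_zero hx0, cpow_def_of_ne_zero hy0,
    cpow_def_of_ne_zero (neg_ne_zero.2 (mul_ne_zero hx0 hy0)), hlog, ← exp_pi_half_int]
  have : exp (log x * ((k : ℂ) + 1 / 2)) * exp (log y * ((k : ℂ) + 1 / 2)) =
      exp (Real.pi * I * ((k : ℂ) + 1 / 2)) *
        exp ((log x + (log y - Real.pi * I)) * ((k : ℂ) + 1 / 2)) := by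
    rw [← exp_add, ← exp_add]; congr 1; ring
  linear_combination ((‖x‖ : ℝ) : ℂ) ^ (2 * s) * ((‖y‖ : ℝ) : ℂ) ^ (2 * s) * this

lemma im_neg_inv_pos (τ : UpperHalfPlane) : 0 < (-1 / (4 * (τ : ℂ))).im := by
  have h1 : (-1 / (4 * (τ : ℂ))) = ((1 / 4 : ℝ) : ℂ) * (-(τ : ℂ)⁻¹) := by push_cast; field_simp
  rw [h1, im_ofReal_mul, neg_im, inv_im]
  have : 0 < τ.im / normSq τ := div_pos τ.im_pos (normSq_pos.2 τ.ne_zero)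
  have e : -(-(τ : ℂ).im / normSq τ) = τ.im / normSq τ := by rw [neg_div, neg_neg]; rfl
  rw [e]; positivity

lemma jac_neg_one_mul_eps {m : ℕ} (hm : Odd m) (k : ℤ) :
    jac (-1) m * eps m ^ (-2 * k - 1) = psi k m := by
  rw [jac, jacobiSym.at_neg_one hm, eps, psi]
  have : m % 4 = 1 ∨ m % 4 = 3 := by obtain ⟨j, rfl⟩ := hm; omega
  rcases this with h | h
  · rw [ZMod.χ₄_nat_mod_four, h, if_pos rfl, if_pos (by omega)]
    simp
  · rw [ZMod.χ₄_nat_mod_four, h, if_neg (by omega), if_neg (by omega), I_zpow_neg_eq]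
    have : ZMod.χ₄ ((3 : ℕ) : ZMod 4) = -1 := by decide
    rw [this]; simp

lemma I_zpow_mul_eps {m : ℕ} (hm : Odd m) (k : ℤ) :
    I ^ (2 * k + 1) * eps m ^ (-2 * k - 1) = psi k (-m) := by
  rw [eps, psi]
  have : m % 4 = 1 ∨ m % 4 = 3 := by obtain ⟨j, rfl⟩ := hm; omega
  rcases this with h | h
  · rw [if_pos h, if_neg (by omega)]; simp
  · rw [if_neg (by omega), if_pos (by omega), ← zpow_add₀ I_ne_zero]; ring_nf; simp

lemma four_cpow_mul (k : ℤ) (s : ℂ) {x : ℂ} (hx : x ≠ 0) :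
    autFactor k s (4 * x) = (4 : ℂ) ^ ((k : ℂ) + 1 / 2 + 2 * s) * autFactor k s x := by
  have := autFactor_ofReal_mul k s (r := 4) (by norm_num) hx
  exact_mod_cast this

lemma four_cpow_ne_zero (x : ℂ) : (4 : ℂ) ^ x ≠ 0 := by simp [cpow_eq_zero_iff]

/-- With W = -m/(4τ) - n one has -4τW = 4nτ + m, so `autFactor_mul` applies directly. -/
lemma eisTerm_inverted_pos (k : ℤ) (s : ℂ) (τ : UpperHalfPlane) {m n : ℕ} (hm : Odd m) :
    I ^ (2 * k + 1) * (autFactor k s τ)⁻¹ * eisTerm k s (-1 / (4 * (τ : ℂ))) (m, -(n : ℤ)) =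
      (4 : ℂ) ^ ((k : ℂ) + 1 / 2 + 2 * s) *
        (bcoef k n m * (autFactor k s (((4 * n : ℕ) : ℂ) * τ + (m : ℤ)))⁻¹) := by
  have hm0 : (0 : ℝ) < m := by exact_mod_cast hm.pos
  have hτ0 := τ.ne_zero
  rw [eisTerm_eq, if_pos hm, bcoef, if_pos (by exact_mod_cast hm), Int.natAbs_natCast,
    ← jac_neg_one_mul_eps hm, show -(n : ℤ) = -1 * n by ring, jac_mul_left]
  set W := (m : ℂ) * (-1 / (4 * (τ : ℂ))) + ((-1 * n : ℤ) : ℂ) with hW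
  have hWim : 0 < W.im := by
    have : W.im = m * (-1 / (4 * (τ : ℂ))).im := by
      rw [hW, add_im, intCast_im, add_zero, ← ofReal_natCast, im_ofReal_mul]
    rw [this]; exact mul_pos hm0 (im_neg_inv_pos τ)
  have hW0 : W ≠ 0 := by intro h; rw [h] at hWim; simp at hWim
  have hy : ((4 * n : ℕ) : ℂ) * τ + ((m : ℤ) : ℂ) = 4 * (-((τ : ℂ) * W)) := by
    rw [hW]; push_cast; field_simp; ring
  have h1 := autFactor_mul k s τ.im_pos hWim
  rw [hy, four_cpow_mul k s (neg_ne_zero.2 (mul_ne_zero hτ0 hW0))]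
  have a1 := autFactor_ne_zero k s hτ0
  have a2 := autFactor_ne_zero k s hW0
  have a3 := autFactor_ne_zero k s (neg_ne_zero.2 (mul_ne_zero hτ0 hW0))
  have a4 := four_cpow_ne_zero ((k : ℂ) + 1 / 2 + 2 * s)
  have h1 : autFactor k s (τ : ℂ) * autFactor k s W =
    I ^ (2 * k + 1) * autFactor k s (-((τ : ℂ) * W)) := h1
  field_simp
  linear_combination -jac (-1) m * jac n m * eps m ^ (-2 * k - 1) * h1

/-- Here 4τW = 4nτ - m has the opposite sign, and `autFactor_neg` contributes a further i^(2k+1).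
This is why ψ takes different values at m and at -m; n ≠ 0 is needed to stay off the real axis. -/
lemma eisTerm_inverted_neg (k : ℤ) (s : ℂ) (τ : UpperHalfPlane) {m n : ℕ} (hm : Odd m)
    (hn : n ≠ 0) :
    I ^ (2 * k + 1) * (autFactor k s τ)⁻¹ * eisTerm k s (-1 / (4 * (τ : ℂ))) (m, (n : ℤ)) =
      (4 : ℂ) ^ ((k : ℂ) + 1 / 2 + 2 * s) *
        (bcoef k n (-m) * (autFactor k s (((4 * n : ℕ) : ℂ) * τ + ((-m : ℤ) : ℂ)))⁻¹) := by
  have hm0 : (0 : ℝ) < m := by exact_mod_cast hm.pos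
  have hτ0 := τ.ne_zero
  rw [eisTerm_eq, if_pos hm, bcoef, if_pos (Odd.neg (by exact_mod_cast hm)),
    Int.natAbs_neg, Int.natAbs_natCast, ← I_zpow_mul_eps hm]
  set W := (m : ℂ) * (-1 / (4 * (τ : ℂ))) + ((n : ℤ) : ℂ) with hW
  have hWim : 0 < W.im := by
    have : W.im = m * (-1 / (4 * (τ : ℂ))).im := by
      rw [hW, add_im, intCast_im, add_zero, ← ofReal_natCast, im_ofReal_mul]
    rw [this]; exact mul_pos hm0 (im_neg_inv_pos τ)
  have hW0 : W ≠ 0 := by intro h; rw [h] at hWim; simp at hWim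
  set y := ((4 * n : ℕ) : ℂ) * τ + ((-m : ℤ) : ℂ) with hy
  have hy1 : y = - (4 * (-((τ : ℂ) * W))) := by
    rw [hy, hW]; push_cast; field_simp; ring
  have hyim : 0 < y.im := by
    have : y.im = (4 * n : ℕ) * τ.im := by
      rw [hy, add_im, intCast_im, add_zero, ← ofReal_natCast, im_ofReal_mul]; rfl
    rw [this]; exact mul_pos (by positivity) τ.im_pos
  have h2 := autFactor_neg k s hyim
  rw [← h2]
  rw [hy1, neg_neg, four_cpow_mul k s (neg_ne_zero.2 (mul_ne_zero hτ0 hW0))]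
  have a1 := autFactor_ne_zero k s hτ0
  have a2 := autFactor_ne_zero k s hW0
  have a3 := autFactor_ne_zero k s (neg_ne_zero.2 (mul_ne_zero hτ0 hW0))
  have a4 := four_cpow_ne_zero ((k : ℂ) + 1 / 2 + 2 * s)
  have a5 : I ^ (2 * k + 1) ≠ 0 := zpow_ne_zero _ I_ne_zero
  have h1 : autFactor k s (τ : ℂ) * autFactor k s W =
    I ^ (2 * k + 1) * autFactor k s (-((τ : ℂ) * W)) := autFactor_mul k s τ.im_pos hWim
  field_simp
  linear_combination - jac n m * eps m ^ (-2 * k - 1) * h1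

lemma eisTerm_inverted_zero (k : ℤ) (s : ℂ) (τ : UpperHalfPlane) :
    I ^ (2 * k + 1) * (autFactor k s τ)⁻¹ * eisTerm k s (-1 / (4 * (τ : ℂ))) (1, 0) =
      (4 : ℂ) ^ ((k : ℂ) + 1 / 2 + 2 * s) := by
  have h := eisTerm_inverted_pos k s τ (m := 1) (n := 0) odd_one
  have h1 : bcoef k 0 ((1 : ℕ) : ℤ) = 1 := by
    rw [bcoef, if_pos (by simp), psi, if_pos (by simp)]; simp [jac]
  have h2 : autFactor k s 1 = 1 := by simp [autFactor]
  rw [h1] at h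
  simpa [h2] using h

lemma eisF_eq_lattice {k : ℤ} {s : ℂ} (hs : 2 < (k : ℝ) + 1 / 2 + 2 * s.re) (τ : UpperHalfPlane) :
    I ^ (2 * k + 1) * eisF k s τ = (4 : ℂ) ^ ((k : ℂ) + 1 / 2 + 2 * s) *
      (1 + ∑' p : ℕ × ℤ, (if p.1 = 0 then 0 else bcoef k p.1 p.2) *
        (autFactor k s (((4 * p.1 : ℕ) : ℂ) * τ + p.2))⁻¹) := by
  rw [eisF, eisE, ← mul_assoc, ← tsum_mul_left]
  have hsum := (summable_eisTerm hs (im_neg_inv_pos τ)).mul_left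
    (I ^ (2 * k + 1) * (autFactor k s τ)⁻¹)
  -- The condition gcd(0, m) = 1 leaves only m = 1 among the pairs with n = 0.
  rw [hsum.tsum_eq_add_tsum_ite (1, 0), eisTerm_inverted_zero, mul_add, mul_one]
  congr 1
  rw [← tsum_mul_left]
  -- A pair (n, a) with n ≥ 1 and a odd comes from (|a|, -sign(a) n). Pairs of the new lattice sum
  -- that are not coprime carry the value 0 of the Jacobi symbol.
  refine tsum_eq_tsum_of_ne_zero_bij
    (fun p => (p.1.2.natAbs, -(p.1.2.sign) * (p.1.1 : ℤ))) ?_ ?_ ?_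
  · rintro ⟨⟨n, a⟩, hp⟩ ⟨⟨n', a'⟩, hp'⟩ h
    simp only [Prod.mk.injEq] at h
    obtain ⟨h1, h2⟩ := h
    have key : ∀ {n : ℕ} {a : ℤ}, (n, a) ∈ Function.support (fun p : ℕ × ℤ =>
        (4 : ℂ) ^ ((k : ℂ) + 1 / 2 + 2 * s) * ((if p.1 = 0 then 0 else bcoef k p.1 p.2) *
        (autFactor k s (((4 * p.1 : ℕ) : ℂ) * τ + p.2))⁻¹)) → n ≠ 0 ∧ a ≠ 0 := by
      intro n a hna
      constructor
      · rintro rfl; simp at hna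
      · rintro rfl; simp [bcoef] at hna
    obtain ⟨hn, ha⟩ := key hp
    obtain ⟨hn', ha'⟩ := key hp'
    have hn1 : (0 : ℤ) < n := by positivity
    have hn1' : (0 : ℤ) < n' := by positivity
    rcases lt_or_gt_of_ne ha with h3 | h3 <;> rcases lt_or_gt_of_ne ha' with h4 | h4 <;>
      simp only [Int.sign_eq_neg_one_of_neg, Int.sign_eq_one_of_pos, h3, h4] at h2 <;>
      simp only [Subtype.mk.injEq, Prod.mk.injEq] <;> constructor <;> omega
  · rintro ⟨m, n⟩ hp
    have hp0 : (m, n) ≠ (1, 0) := by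
      intro h; simp [h] at hp
    have hp1 : eisTerm k s (-1 / (4 * (τ : ℂ))) (m, n) ≠ 0 := by
      intro h; simp [h] at hp
    have hcond : Odd m ∧ Int.gcd n m = 1 := by
      by_contra h; rw [eisTerm, if_neg h] at hp1; exact hp1 rfl
    have hn : n ≠ 0 := by
      rintro rfl
      have h1 : m = 1 := by simpa using hcond.2
      exact hp0 (by rw [h1])
    have hm : m ≠ 0 := by rintro rfl; simp at hcond
    have hp2 : I ^ (2 * k + 1) * (autFactor k s τ)⁻¹ *
        eisTerm k s (-1 / (4 * (τ : ℂ))) (m, n) ≠ 0 :=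
      mul_ne_zero (mul_ne_zero (zpow_ne_zero _ I_ne_zero)
        (inv_ne_zero (autFactor_ne_zero k s τ.ne_zero))) hp1
    rcases lt_or_gt_of_ne hn with h | h
    · obtain ⟨l, rfl⟩ : ∃ l : ℕ, n = -(l : ℤ) := ⟨n.natAbs, by omega⟩
      refine ⟨⟨(l, (m : ℤ)), ?_⟩, ?_⟩
      · rw [eisTerm_inverted_pos k s τ hcond.1] at hp2
        have hl : l ≠ 0 := by omega
        simpa only [Function.mem_support, hl, if_false] using hp2
      · have : ((m : ℤ)).sign = 1 := Int.sign_eq_one_of_pos (by positivity)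
        simp [this]
    · obtain ⟨l, rfl⟩ : ∃ l : ℕ, n = (l : ℤ) := ⟨n.natAbs, by omega⟩
      have hl : l ≠ 0 := by omega
      refine ⟨⟨(l, -(m : ℤ)), ?_⟩, ?_⟩
      · rw [eisTerm_inverted_neg k s τ hcond.1 hl] at hp2
        simpa only [Function.mem_support, hl, if_false] using hp2
      · have : (-(m : ℤ)).sign = -1 := Int.sign_eq_neg_one_of_neg (by omega)
        simp [this]
  · rintro ⟨⟨n, a⟩, hp⟩
    have hn : n ≠ 0 := by rintro rfl; simp at hp
    have ha : Odd a := by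
      by_contra h; simp [bcoef, h] at hp
    have ha0 : a ≠ 0 := by rintro rfl; simp at ha
    simp only [hn, if_false]
    rcases lt_or_gt_of_ne ha0 with h | h
    · obtain ⟨m, rfl⟩ : ∃ m : ℕ, a = -(m : ℤ) := ⟨a.natAbs, by omega⟩
      have hm : Odd m := by simpa using ha
      rw [Int.sign_eq_neg_one_of_neg h, Int.natAbs_neg, Int.natAbs_natCast, neg_neg, one_mul,
        if_neg (by simp [hn]), eisTerm_inverted_neg k s τ hm hn]
    · obtain ⟨m, rfl⟩ : ∃ m : ℕ, a = (m : ℤ) := ⟨a.natAbs, by omega⟩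
      have hm : Odd m := by exact_mod_cast ha
      rw [Int.sign_eq_one_of_pos h, Int.natAbs_natCast, neg_mul, one_mul,
        if_neg (by simp [hn]), eisTerm_inverted_pos k s τ hm]

lemma eisF_expansion {k : ℤ} {s : ℂ} (hs : 2 < (k : ℝ) + 1 / 2 + 2 * s.re) (τ : UpperHalfPlane) :
    I ^ (2 * k + 1) * eisF k s τ = (4 : ℂ) ^ ((k : ℂ) + 1 / 2 + 2 * s) +
      ∑' h : ℤ, lineChar k s τ h * ∑' n : ℕ, bTerm k h ((k : ℂ) + 2 * s) n := by
  rw [eisF_eq_lattice hs, tsum_lattice_expansion (c := fun n a => if n = 0 then 0 else bcoef k n a)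
    hs τ four_ne_zero, mul_add, mul_one, ← tsum_mul_left]
  · congr 1
    refine tsum_congr fun h => ?_
    rw [mul_left_comm, ← tsum_mul_left]
    congr 1
    refine tsum_congr fun n => ?_
    rw [bTerm]
    split_ifs with hn
    · simp
    -- The factor 4^(k+1/2+2s) from the inversion cancels the 4 in the modulus 4n.
    · have h4 : (4 : ℂ) ^ ((k : ℂ) + 1 / 2 + 2 * s) *
          ((4 * n : ℕ) : ℂ) ^ (-((k : ℂ) + 1 / 2 + 2 * s)) =
          (n : ℂ) ^ (-((k : ℂ) + 1 / 2 + 2 * s)) := by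
        have := ofReal_mul_cpow (r := 4) (by norm_num) (x := (n : ℂ)) (by exact_mod_cast hn)
          (-((k : ℂ) + 1 / 2 + 2 * s))
        push_cast at this ⊢
        rw [this, ← mul_assoc, ← cpow_add _ _ (by norm_num)]
        simp
      rw [← mul_assoc, h4, natCast_cpow_weight k s hn, bGauss]
      ring
  · intro m hm
    simp only [hm, if_false]
    exact bcoef_periodic k hm
  · intro m n
    split_ifs
    · simp
    · exact norm_bcoef_le _ _ _
  · intro n; simp

/-! ### Assembling the Fourier series of H. -/

lemma norm_tsum_oddTerm_le (k h : ℤ) {w : ℂ} (hw : 3 / 2 < w.re) :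
    ‖∑' m, oddTerm (upsilon k h) w m‖ ≤ ∑' m : ℕ, (m : ℝ) ^ (1 / 2 - w.re) :=
  tsum_of_norm_bounded (summable_majorant hw).hasSum (norm_oddTerm_le k h w)

lemma norm_tsum_bTerm_le (k h : ℤ) {w : ℂ} (hw : 3 / 2 < w.re) :
    ‖∑' m, bTerm k h w m‖ ≤ ∑' m : ℕ, 4 * (m : ℝ) ^ (1 / 2 - w.re) :=
  tsum_of_norm_bounded ((summable_majorant hw).mul_left 4).hasSum (norm_bTerm_le k h w)

lemma summable_lineChar_mul {k : ℤ} {s : ℂ} (hs : 2 < (k : ℝ) + 1 / 2 + 2 * s.re)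
    (τ : UpperHalfPlane) {f : ℤ → ℂ} {C : ℝ} (hf : ∀ h, ‖f h‖ ≤ C) :
    Summable fun h => lineChar k s τ h * f h := by
  refine Summable.of_norm_bounded ((summable_lineChar hs τ).mul_right C) fun h => ?_
  rw [norm_mul]
  exact mul_le_mul_of_nonneg_left (hf h) (norm_nonneg _)

lemma weight_re {k : ℤ} {s : ℂ} (hs : 2 < (k : ℝ) + 1 / 2 + 2 * s.re) :
    3 / 2 < ((k : ℂ) + 2 * s).re := by simp; linarith

/-- The terms `bTerm` already contain 1 + i^(2k+1), so this is exactly the combination of E and F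
that occurs in H. -/
lemma two_mul_twistedE (k h : ℤ) {w : ℂ} (hw : 3 / 2 < w.re) :
    2 * (1 + I ^ (2 * k + 1)) * twistedE k h w =
      (1 + I ^ (2 * k + 1)) * ∑' m, oddTerm (upsilon k h) w m + ∑' n, bTerm k h w n := by
  rw [twistedE, dirichletE, (hasSum_evenTerm k h hw).tsum_eq]
  field_simp [one_add_I_zpow_ne_zero k]

lemma fourierTerm_eq (k : ℤ) (s : ℂ) (τ : UpperHalfPlane) (h : ℤ) :
    fourierTerm k s τ h = lineChar k s τ h * twistedE k h ((k : ℂ) + 2 * s) := by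
  rw [fourierTerm, mul_assoc, rho_mul_exp, mul_comm]

lemma summable_fourierTerm {k : ℤ} {s : ℂ} (hs : 2 < (k : ℝ) + 1 / 2 + 2 * s.re)
    (τ : UpperHalfPlane) : Summable (fourierTerm k s τ) := by
  have hw := weight_re hs
  have h1 := (summable_lineChar_mul hs τ fun h => norm_tsum_oddTerm_le k h hw).mul_left
    (1 + I ^ (2 * k + 1))
  have h2 := summable_lineChar_mul hs τ fun h => norm_tsum_bTerm_le k h hw
  refine ((h1.add h2).mul_left (2 * (1 + I ^ (2 * k + 1)))⁻¹).congr fun h => ?_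
  rw [fourierTerm_eq, inv_mul_eq_iff_eq_mul₀ (mul_ne_zero two_ne_zero (one_add_I_zpow_ne_zero k))]
  linear_combination - lineChar k s τ h * two_mul_twistedE k h hw

lemma eisH_eq {k : ℤ} {s : ℂ} (hs : 2 < (k : ℝ) + 1 / 2 + 2 * s.re) (τ : UpperHalfPlane) :
    eisH k s τ = riemannZeta (1 - 2 * (k : ℂ)) / (2 : ℂ) ^ (2 * k + 1) *
      ((4 : ℂ) ^ ((k : ℂ) + 1 / 2 + 2 * s) + ∑' h : ℤ, lineChar k s τ h *
        ((1 + I ^ (2 * k + 1)) * ∑' m, oddTerm (upsilon k h) ((k : ℂ) + 2 * s) m +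
          ∑' n, bTerm k h ((k : ℂ) + 2 * s) n)) := by
  have hw := weight_re hs
  have h1 := (summable_lineChar_mul hs τ fun h => norm_tsum_oddTerm_le k h hw).mul_left
    (1 + I ^ (2 * k + 1))
  have h2 := summable_lineChar_mul hs τ fun h => norm_tsum_bTerm_le k h hw
  rw [eisH, eisE_expansion hs, eisF_expansion hs, ← tsum_mul_left, add_left_comm, ← h1.tsum_add h2]
  congr 3
  funext h
  ring

lemma eisH_fourier {k : ℤ} {s : ℂ} (hs : 2 < (k : ℝ) + 1 / 2 + 2 * s.re) (τ : UpperHalfPlane) :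
    eisH k s τ = riemannZeta (1 - 2 * (k : ℂ)) * (2 : ℂ) ^ (4 * s) +
      (1 + I ^ (2 * k + 1)) * riemannZeta (1 - 2 * (k : ℂ)) / (2 : ℂ) ^ (2 * k) *
        ∑' h : ℤ, fourierTerm k s τ h := by
  have h1 : ∑' h : ℤ, lineChar k s τ h *
        ((1 + I ^ (2 * k + 1)) * ∑' m, oddTerm (upsilon k h) ((k : ℂ) + 2 * s) m +
          ∑' n, bTerm k h ((k : ℂ) + 2 * s) n) =
      2 * (1 + I ^ (2 * k + 1)) * ∑' h : ℤ, fourierTerm k s τ h := by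
    rw [← tsum_mul_left]
    refine tsum_congr fun h => ?_
    rw [fourierTerm_eq, ← two_mul_twistedE k h (weight_re hs)]; ring
  -- The power 2^(2k+1) cancels the denominator in the definition of H and leaves the constant term
  -- 2^(4s).
  have h4 : (4 : ℂ) ^ ((k : ℂ) + 1 / 2 + 2 * s) = (2 : ℂ) ^ (2 * k + 1) * (2 : ℂ) ^ (4 * s) := by
    rw [← cpow_intCast, ← cpow_add _ _ two_ne_zero, show (4 : ℂ) = (2 : ℂ) ^ 2 by norm_num,
      ← cpow_nat_mul' (by simp; linarith [Real.pi_pos]) (by simp; linarith [Real.pi_pos])]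
    congr 1; push_cast; ring
  have h5 : (2 : ℂ) ^ (2 * k + 1) = 2 ^ (2 * k) * 2 := zpow_add_one₀ two_ne_zero _
  have h6 : (2 : ℂ) ^ (2 * k) ≠ 0 := zpow_ne_zero _ two_ne_zero
  rw [eisH_eq hs, h1, h4, h5]
  field_simp

lemma twistedE_eq_zagierE (k h : ℤ) (w : ℂ) : twistedE k h w = zagierE (signed k h) w := by
  rw [twistedE, zagierE]
  congr 1
  funext m
  exact upsilon_eq_gaussGamma k h m

end

section
open Complex Filter Topology

/-! ### The sums of `Υ` over square divisors -/

lemma eps_sq_mul {p m : ℕ} (hp : Odd p) : eps (p * (p * m)) = eps m := by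
  have : p * (p * m) % 4 = m % 4 := by
    obtain ⟨j, rfl⟩ := hp
    have : (2 * j + 1) * ((2 * j + 1) * m) = 4 * (j * (j + 1) * m) + m := by ring
    omega
  rw [eps, eps, this]

lemma upsilon_prime_sq (k h : ℤ) {p m : ℕ} (hp : p.Prime) (hpo : Odd p) (hm : Odd m) :
    upsilon k h (p * (p * m)) = if (p : ℤ) ∣ h then
      (if ((p ^ 2 : ℕ) : ℤ) ∣ h then (p : ℂ) * upsilon k (h / (p ^ 2 : ℕ)) m else 0) -
        (if p ∣ m then 0 else upsilon k h m) else 0 := by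
  have hpC : (p : ℂ) ≠ 0 := by exact_mod_cast hp.ne_zero
  have hs : Real.sqrt ((p * (p * m) : ℕ) : ℝ) = p * Real.sqrt m := by
    push_cast
    rw [← mul_assoc, Real.sqrt_mul (by positivity), Real.sqrt_mul_self (by positivity)]
  rw [upsilon_odd (hpo.mul (hpo.mul hm)), eps_sq_mul hpo, hs, jacGauss_prime_sq hp hm.pos.ne',
    upsilon_odd hm, upsilon_odd hm]
  split_ifs <;> push_cast <;> field_simp <;> ring

lemma upsilon_prime_mul (k h : ℤ) {p m : ℕ} (hp : p.Prime) (hpo : Odd p) (hm : Odd m)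
    (hpm : ¬ p ∣ m) (hh : (p : ℤ) ∣ h) : upsilon k h (p * m) = 0 := by
  rw [upsilon_odd (hpo.mul hm), jacGauss_prime_mul hp (by rintro rfl; exact absurd hpo (by decide)) hm.pos.ne' hpm hh,
    mul_zero]

/-- The point where the exact value of the Gauss sum enters: ε_m √m combines with ε_m^(-2k-1)
m^(-1/2) to a pure symbol, by ε_m² = (-1/m). -/
lemma upsilon_squarefree (k h : ℤ) {m : ℕ} (hm : Odd m) (hsq : Squarefree m)
    (hh : h.gcd m = 1) : upsilon k h m = jac (signed k h) m := by
  have hm0 : (0 : ℝ) < m := by exact_mod_cast hm.pos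
  have hs : ((Real.sqrt m : ℝ) : ℂ) ≠ 0 := by exact_mod_cast (Real.sqrt_pos.2 hm0).ne'
  have he : eps m * eps m = jac (-1) m := by
    rw [jac, jacobiSym.at_neg_one hm, eps, ZMod.χ₄_nat_mod_four]
    have : m % 4 = 1 ∨ m % 4 = 3 := by obtain ⟨j, rfl⟩ := hm; omega
    rcases this with h | h
    · rw [h]; simp
    · rw [h, if_neg (by norm_num)]
      have : ZMod.χ₄ ((3 : ℕ) : ZMod 4) = -1 := by decide
      rw [this]; simp
  have h1 : jac (-1) m * jac (-1) m = 1 := by rw [← jac_mul_left]; simp [jac_one_left]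
  rw [upsilon_odd hm, jacGauss_coprime hm.pos.ne' hh, jacGauss_squarefree_one hm hsq, eps_zpow hm,
    signed, jac_mul_left, neg_eq_neg_one_mul, jac_mul_left]
  have h2 : 1 / ((Real.sqrt m : ℝ) : ℂ) * ((Real.sqrt m : ℝ) : ℂ) = 1 := by field_simp
  linear_combination (jac h m * jac ((k.negOnePow : ℤˣ) : ℤ) m) *
    (eps m * eps m * jac (-1) m * h2 + jac (-1) m * he + h1)

/-- The positive integers whose square divides `M`. -/
def sqDivisors (M : ℕ) : Finset ℕ := M.divisors.filter fun l => l ^ 2 ∣ M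

lemma mem_sqDivisors {M l : ℕ} (hM : M ≠ 0) : l ∈ sqDivisors M ↔ l ^ 2 ∣ M := by
  simp only [sqDivisors, Finset.mem_filter, Nat.mem_divisors]
  exact ⟨fun h => h.2, fun h => ⟨⟨(dvd_pow_self l two_ne_zero).trans h, hM⟩, h⟩⟩

lemma sqDivisors_squarefree {M : ℕ} (hM : Squarefree M) : sqDivisors M = {1} := by
  ext l
  rw [mem_sqDivisors hM.ne_zero, Finset.mem_singleton]
  constructor
  · intro h; exact Nat.isUnit_iff.1 (hM l (by rwa [← sq]))
  · rintro rfl; simp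

/-- Separate l by divisibility by p: multiples pl correspond to l² ∣ M, while for l prime to p the
factor p² is irrelevant to divisibility by l². -/
lemma sum_sqDivisors_prime_sq {p M : ℕ} (hp : p.Prime) (hM : M ≠ 0) (F : ℕ → ℂ) :
    ∑ l ∈ sqDivisors (p * (p * M)), F l =
      ∑ l ∈ sqDivisors M, F (p * l) + ∑ l ∈ sqDivisors M with ¬ p ∣ l, F l := by
  have hp0 := hp.ne_zero
  have hpM : p * (p * M) ≠ 0 := by positivity
  rw [← Finset.sum_filter_add_sum_filter_not _ (fun l => p ∣ l)]
  congr 1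
  · rw [← Finset.sum_image (f := F) (g := fun l => p * l) (s := sqDivisors M)
      (fun a _ b _ h => Nat.eq_of_mul_eq_mul_left hp.pos h)]
    congr 1
    ext l
    simp only [Finset.mem_filter, Finset.mem_image, mem_sqDivisors hpM, mem_sqDivisors hM]
    have key : ∀ t, (p * t) ^ 2 ∣ p * (p * M) ↔ t ^ 2 ∣ M := by
      intro t
      rw [show (p * t) ^ 2 = p * (p * t ^ 2) by ring,
        Nat.mul_dvd_mul_iff_left hp.pos, Nat.mul_dvd_mul_iff_left hp.pos]
    constructor
    · rintro ⟨h1, ⟨t, rfl⟩⟩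
      exact ⟨t, (key t).1 h1, rfl⟩
    · rintro ⟨t, h1, rfl⟩
      exact ⟨(key t).2 h1, Dvd.intro _ rfl⟩
  · congr 1
    ext l
    simp only [Finset.mem_filter, mem_sqDivisors hpM, mem_sqDivisors hM]
    refine and_congr_left fun hl => ⟨fun h => ?_, fun h => h.trans ⟨p * p, by ring⟩⟩
    have hc : Nat.Coprime (l ^ 2) p := ((hp.coprime_iff_not_dvd.2 hl).symm).pow_left 2
    exact hc.dvd_of_dvd_mul_left (hc.dvd_of_dvd_mul_left h)

/-- `∑_{l² ∣ M} Υ_{M/l²}(h)`. -/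
def sqUpsilon (k h : ℤ) (M : ℕ) : ℂ := ∑ l ∈ sqDivisors M, upsilon k h (M / l ^ 2)

/-- `∑_{f² ∣ (M, h)} f ((-1)^k h f^{-2} / M f^{-2})`. -/
def sqJac (k h : ℤ) (M : ℕ) : ℂ := ∑ f ∈ sqDivisors M,
  if ((f ^ 2 : ℕ) : ℤ) ∣ h then (f : ℂ) * jac (signed k (h / (f ^ 2 : ℕ))) (M / f ^ 2) else 0

lemma sq_mul_div {p l M : ℕ} (hp : p ≠ 0) : p * (p * M) / (p * l) ^ 2 = M / l ^ 2 := by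
  rw [show (p * l) ^ 2 = p * (p * l ^ 2) by ring, Nat.mul_div_mul_left _ _ (Nat.pos_of_ne_zero hp),
    Nat.mul_div_mul_left _ _ (Nat.pos_of_ne_zero hp)]

lemma sq_mul_div' {p l M : ℕ} (hl : l ^ 2 ∣ M) : p * (p * M) / l ^ 2 = p * (p * (M / l ^ 2)) := by
  rw [Nat.mul_div_assoc _ (hl.mul_left p), Nat.mul_div_assoc _ hl]

lemma odd_div_sq {M l : ℕ} (hM : Odd M) (hl : l ^ 2 ∣ M) : Odd (M / l ^ 2) :=
  hM.of_dvd_nat (Nat.div_dvd_of_dvd hl)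

lemma sqUpsilon_prime_sq (k h : ℤ) {p M : ℕ} (hp : p.Prime) (hM : M ≠ 0) :
    sqUpsilon k h (p * (p * M)) = sqUpsilon k h M +
      ∑ l ∈ sqDivisors M with ¬ p ∣ l, upsilon k h (p * (p * (M / l ^ 2))) := by
  rw [sqUpsilon, sum_sqDivisors_prime_sq hp hM, sqUpsilon]
  congr 1
  · exact Finset.sum_congr rfl fun l _ => by rw [sq_mul_div hp.ne_zero]
  · refine Finset.sum_congr rfl fun l hl => ?_
    rw [Finset.mem_filter, mem_sqDivisors hM] at hl
    rw [sq_mul_div' hl.1]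

lemma prime_dvd_div_sq {p f : ℕ} (hp : p.Prime) (hf : ¬ p ∣ f) {h : ℤ}
    (hh : (p : ℤ) ∣ h) (hfh : ((f ^ 2 : ℕ) : ℤ) ∣ h) : (p : ℤ) ∣ h / (f ^ 2 : ℕ) := by
  obtain ⟨t, rfl⟩ := hfh
  have hf0 : ((f ^ 2 : ℕ) : ℤ) ≠ 0 := by
    intro h0
    have : f = 0 := by simpa using h0
    exact hf (this ▸ dvd_zero p)
  rw [Int.mul_ediv_cancel_left _ hf0]
  rcases (Nat.prime_iff_prime_int.1 hp).dvd_or_dvd hh with h1 | h1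
  · exact absurd (hp.dvd_of_dvd_pow (Int.natCast_dvd_natCast.1 h1)) hf
  · exact h1

lemma dvd_signed {p k h : ℤ} (hh : p ∣ h) : p ∣ signed k h := hh.mul_left _

lemma dvd_signed_iff {p k h : ℤ} : p ∣ signed k h ↔ p ∣ h := by
  rcases negOnePow_cases k with ⟨-, h1⟩ | ⟨-, h1⟩ <;> rw [signed, h1] <;> simp

lemma prime_dvd_div_sq_nat {p f M : ℕ} (hp : p.Prime) (hf : ¬ p ∣ f) (hfM : f ^ 2 ∣ M)
    (hM : p ∣ M) : p ∣ M / f ^ 2 := by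
  have := prime_dvd_div_sq hp hf (Int.natCast_dvd_natCast.2 hM) (Int.natCast_dvd_natCast.2 hfM)
  exact_mod_cast this

lemma sqJac_term_eq_zero (k : ℤ) {h : ℤ} {p f M : ℕ} (hp : p.Prime) (hM : M ≠ 0)
    (hfM : f ^ 2 ∣ M) (hf : ¬ p ∣ f) (hpM : p ∣ M) (hh : (p : ℤ) ∣ h) :
    (if ((f ^ 2 : ℕ) : ℤ) ∣ h then (f : ℂ) * jac (signed k (h / (f ^ 2 : ℕ))) (M / f ^ 2) else 0) =
      0 := by
  split_ifs with h1
  · have hd : M / f ^ 2 ≠ 0 := (Nat.div_pos (Nat.le_of_dvd (Nat.pos_of_ne_zero hM) hfM)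
      (Nat.pos_of_dvd_of_pos hfM (Nat.pos_of_ne_zero hM))).ne'
    rw [jac_eq_zero_of_dvd hp hd (prime_dvd_div_sq_nat hp hf hfM hpM)
      (dvd_signed (prime_dvd_div_sq hp hf hh h1)), mul_zero]
  · rfl

/-- No admissible f is divisible by p, so p still divides M/f² and h/f², and every symbol vanishes.
-/
lemma sqJac_eq_zero (k : ℤ) {h : ℤ} {p M : ℕ} (hp : p.Prime) (hM : M ≠ 0) (hpM : p ∣ M)
    (hpM2 : ¬ p ^ 2 ∣ M) (hh : (p : ℤ) ∣ h) : sqJac k h M = 0 := by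
  refine Finset.sum_eq_zero fun f hf => ?_
  rw [mem_sqDivisors hM] at hf
  exact sqJac_term_eq_zero k hp hM hf
    (fun h => hpM2 ((pow_dvd_pow_of_dvd h 2).trans hf)) hpM hh

lemma sqJac_prime_sq (k h : ℤ) {p M : ℕ} (hp : p.Prime) (hM : M ≠ 0) :
    sqJac k h (p * (p * M)) = if (p : ℤ) ∣ h then
      (if ((p ^ 2 : ℕ) : ℤ) ∣ h then (p : ℂ) * sqJac k (h / (p ^ 2 : ℕ)) M else 0)
      else sqJac k h M := by
  have hp0 := hp.ne_zero
  have hpz : ((p ^ 2 : ℕ) : ℤ) ≠ 0 := by positivity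
  rw [sqJac, sum_sqDivisors_prime_sq hp hM]
  split_ifs with h1 h2
  · rw [sqJac, Finset.mul_sum]
    rw [Finset.sum_eq_zero (s := (sqDivisors M).filter fun l => ¬ p ∣ l), add_zero]
    · refine Finset.sum_congr rfl fun f hf => ?_
      rw [mem_sqDivisors hM] at hf
      obtain ⟨t, rfl⟩ := h2
      rw [sq_mul_div hp0, Int.mul_ediv_cancel_left _ hpz]
      have e1 : (((p * f) ^ 2 : ℕ) : ℤ) = ((p ^ 2 : ℕ) : ℤ) * ((f ^ 2 : ℕ) : ℤ) := by
        push_cast; ring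
      have e2 : (((p * f) ^ 2 : ℕ) : ℤ) ∣ ((p ^ 2 : ℕ) : ℤ) * t ↔ ((f ^ 2 : ℕ) : ℤ) ∣ t := by
        rw [e1]; exact mul_dvd_mul_iff_left hpz
      rw [e1] at *
      rw [Int.mul_ediv_mul_of_pos _ _ (by positivity)]
      simp only [e2]
      split_ifs
      · push_cast; ring
      · simp
    · intro f hf
      rw [Finset.mem_filter, mem_sqDivisors hM] at hf
      exact sqJac_term_eq_zero k hp (by positivity) (hf.1.trans ⟨p * p, by ring⟩) hf.2
        (Dvd.intro _ rfl) h1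
  · rw [Finset.sum_eq_zero, Finset.sum_eq_zero, add_zero]
    · intro f hf
      rw [Finset.mem_filter, mem_sqDivisors hM] at hf
      exact sqJac_term_eq_zero k hp (by positivity) (hf.1.trans ⟨p * p, by ring⟩) hf.2
        (Dvd.intro _ rfl) h1
    · intro f _
      refine if_neg fun h3 => h2 (dvd_trans ?_ h3)
      exact Int.natCast_dvd_natCast.2 (pow_dvd_pow_of_dvd (Dvd.intro _ rfl) 2)
  · rw [Finset.sum_eq_zero (s := sqDivisors M), zero_add, sqJac]
    · rw [← Finset.sum_filter_add_sum_filter_not (sqDivisors M) (fun l => p ∣ l),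
        Finset.sum_eq_zero (s := (sqDivisors M).filter fun l => p ∣ l), zero_add]
      · refine Finset.sum_congr rfl fun f hf => ?_
        rw [Finset.mem_filter, mem_sqDivisors hM] at hf
        have hd : M / f ^ 2 ≠ 0 := (Nat.div_pos (Nat.le_of_dvd (Nat.pos_of_ne_zero hM) hf.1)
          (Nat.pos_of_dvd_of_pos hf.1 (Nat.pos_of_ne_zero hM))).ne'
        rw [sq_mul_div' hf.1, jac_sq_mul hp hd]
        split_ifs with h3 h4
        · exfalso
          rw [dvd_signed_iff] at h4
          exact h1 (h4.trans (Int.ediv_dvd_of_dvd h3))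
        · rfl
        · rfl
      · intro f hf
        rw [Finset.mem_filter] at hf
        refine if_neg fun h3 => h1 (dvd_trans ?_ h3)
        exact Int.natCast_dvd_natCast.2 (dvd_pow hf.2 two_ne_zero)
    · intro f _
      refine if_neg fun h3 => h1 (dvd_trans ?_ h3)
      exact Int.natCast_dvd_natCast.2 (dvd_pow (Dvd.intro _ rfl) two_ne_zero)

/-- Induction on M by removing a square p²; the squarefree case is the evaluation of the Gauss sum.
If p ∤ h, the new terms on both sides vanish. If p ∣ h, the recursion for Υ produces p times the sum
at h/p² and a negative term, and what remains is to see that the latter cancels the sum for M/p². -/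
theorem sqUpsilon_eq_sqJac (k : ℤ) {M : ℕ} (hM : Odd M) (h : ℤ) :
    sqUpsilon k h M = sqJac k h M := by
  induction M using Nat.strong_induction_on generalizing h with
  | _ M ih =>
  have hM0 : M ≠ 0 := hM.pos.ne'
  by_cases hsq : Squarefree M
  · rw [sqUpsilon, sqJac, sqDivisors_squarefree hsq, Finset.sum_singleton, Finset.sum_singleton]
    simp only [one_pow, Nat.div_one, Nat.cast_one, Int.ediv_one, isUnit_one, IsUnit.dvd, if_true,
      one_mul]
    by_cases hg : h.gcd M = 1
    · exact upsilon_squarefree k h hM hsq hg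
    · obtain ⟨p, hp, hpd⟩ := Nat.exists_prime_and_dvd hg
      have hpM : p ∣ M := hpd.trans (by simpa using Int.gcd_dvd_natAbs_right h (M : ℤ))
      have hph : (p : ℤ) ∣ h := (Int.natCast_dvd_natCast.2 hpd).trans (Int.gcd_dvd_left _ _)
      rw [jac_eq_zero_of_dvd hp hM0 hpM (dvd_signed hph)]
      obtain ⟨m, rfl⟩ := hpM
      refine upsilon_prime_mul k h hp (Nat.odd_mul.1 hM).1 (Nat.odd_mul.1 hM).2 ?_ hph
      rintro ⟨t, rfl⟩
      exact hp.one_lt.ne' (Nat.isUnit_iff.1 (hsq p ⟨t, by ring⟩))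
  · obtain ⟨p, hp, hpM⟩ : ∃ p, p.Prime ∧ p * p ∣ M := by
      by_contra hcon; push Not at hcon
      exact hsq (Nat.squarefree_iff_prime_squarefree.2 hcon)
    obtain ⟨m, rfl⟩ := hpM
    rw [mul_assoc] at hM hM0 ih ⊢
    have hpo : Odd p := (Nat.odd_mul.1 hM).1
    have hm : Odd m := (Nat.odd_mul.1 (Nat.odd_mul.1 hM).2).2
    have hm0 : m ≠ 0 := hm.pos.ne'
    have hlt : m < p * (p * m) := by
      have := hp.two_le
      nlinarith [hm.pos, Nat.mul_pos hp.pos hm.pos]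
    have hU : ∀ l ∈ (sqDivisors m).filter fun l => ¬ p ∣ l, upsilon k h (p * (p * (m / l ^ 2))) =
        if (p : ℤ) ∣ h then
          (if ((p ^ 2 : ℕ) : ℤ) ∣ h then (p : ℂ) * upsilon k (h / (p ^ 2 : ℕ)) (m / l ^ 2) else 0) -
            (if p ∣ m then 0 else upsilon k h (m / l ^ 2)) else 0 := by
      intro l hl
      rw [Finset.mem_filter, mem_sqDivisors hm0] at hl
      rw [upsilon_prime_sq k h hp hpo (odd_div_sq hm hl.1)]
      have : p ∣ m / l ^ 2 ↔ p ∣ m :=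
        ⟨fun h => h.trans (Nat.div_dvd_of_dvd hl.1), prime_dvd_div_sq_nat hp hl.2 hl.1⟩
      simp only [this]
    rw [sqUpsilon_prime_sq k h hp hm0, Finset.sum_congr rfl hU, sqJac_prime_sq k h hp hm0]
    by_cases hph : (p : ℤ) ∣ h
    swap
    · simp only [if_neg hph, Finset.sum_const_zero, add_zero]
      exact ih m hlt hm h
    simp only [if_pos hph]
    rw [Finset.sum_sub_distrib, ih m hlt hm h]
    by_cases hpm2 : p ^ 2 ∣ m
    -- For m = p²r the restriction p ∤ l loses the multiples of p. The missing part is the sum at r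
    -- and h/p², which the recursion for `sqJac k h m` supplies.
    · obtain ⟨r, rfl⟩ := hpm2
      rw [show p ^ 2 * r = p * (p * r) by ring] at *
      have hr : Odd r := (Nat.odd_mul.1 (Nat.odd_mul.1 hm).2).2
      have hr0 : r ≠ 0 := hr.pos.ne'
      have hlt' : r < p * (p * (p * (p * r))) := by
        refine lt_trans ?_ hlt
        have := hp.two_le
        nlinarith [hr.pos, Nat.mul_pos hp.pos hr.pos]
      rw [sqJac_prime_sq k h hp hr0, if_pos hph, ← ih _ hlt hm]
      simp only [Dvd.intro _ rfl, if_true, Finset.sum_const_zero, sub_zero]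
      split_ifs with h2
      · rw [← ih r hlt' hr, ← Finset.mul_sum, ← mul_add, sqUpsilon, sqUpsilon,
          sum_sqDivisors_prime_sq hp hr0]
        have e1 : ∑ l ∈ sqDivisors r, upsilon k (h / (p ^ 2 : ℕ)) (p * (p * r) / (p * l) ^ 2) =
            ∑ l ∈ sqDivisors r, upsilon k (h / (p ^ 2 : ℕ)) (r / l ^ 2) :=
          Finset.sum_congr rfl fun l _ => by rw [sq_mul_div hp.ne_zero]
        have e2 : (sqDivisors (p * (p * r))).filter (fun l => ¬ p ∣ l) =
            (sqDivisors r).filter fun l => ¬ p ∣ l := by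
          ext l
          simp only [Finset.mem_filter, mem_sqDivisors hm0, mem_sqDivisors hr0]
          refine and_congr_left fun hl => ⟨fun h => ?_, fun h => h.trans ⟨p * p, by ring⟩⟩
          have hc : Nat.Coprime (l ^ 2) p := ((hp.coprime_iff_not_dvd.2 hl).symm).pow_left 2
          exact hc.dvd_of_dvd_mul_left (hc.dvd_of_dvd_mul_left h)
        rw [e1, e2]
      · simp
    · have hfil : (sqDivisors m).filter (fun l => ¬ p ∣ l) = sqDivisors m := by
        refine Finset.filter_true_of_mem fun l hl hpl => hpm2 ?_
        rw [mem_sqDivisors hm0] at hl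
        exact (pow_dvd_pow_of_dvd hpl 2).trans hl
      rw [hfil]
      -- If p divides m exactly once both terms vanish; if p ∤ m they are equal by the induction
      -- hypothesis.
      have h0 : sqJac k h m - ∑ l ∈ sqDivisors m, (if p ∣ m then 0 else upsilon k h (m / l ^ 2)) =
          0 := by
        by_cases hpm : p ∣ m
        · simp only [if_pos hpm, Finset.sum_const_zero, sub_zero]
          exact sqJac_eq_zero k hp hm0 hpm hpm2 hph
        · simp only [if_neg hpm]
          rw [← ih m hlt hm h, sqUpsilon, sub_self]
      have h1 : ∑ l ∈ sqDivisors m, (if ((p ^ 2 : ℕ) : ℤ) ∣ h then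
          (p : ℂ) * upsilon k (h / (p ^ 2 : ℕ)) (m / l ^ 2) else 0) =
          if ((p ^ 2 : ℕ) : ℤ) ∣ h then (p : ℂ) * sqJac k (h / (p ^ 2 : ℕ)) m else 0 := by
        split_ifs
        · rw [← Finset.mul_sum, ← ih m hlt hm, sqUpsilon]
        · simp
      linear_combination h0 + h1

end

section
open Complex Filter Topology

/-! ### Dirichlet series with periodic coefficients -/

lemma differentiableOn_tsum_of_locally_dominated {ι : Type*} {U : Set ℂ} (hU : IsOpen U)
    {F : ι → ℂ → ℂ} (hF : ∀ i, DifferentiableOn ℂ (F i) U)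
    (hb : ∀ s ∈ U, ∃ b : ι → ℝ, Summable b ∧ ∀ᶠ t in 𝓝 s, ∀ i, ‖F i t‖ ≤ b i) :
    DifferentiableOn ℂ (fun s => ∑' i, F i s) U := by
  intro s hs
  obtain ⟨b, hb1, hb2⟩ := hb s hs
  obtain ⟨V, hV, hVo, hsV⟩ := eventually_nhds_iff.1 hb2
  have h := Complex.differentiableOn_tsum_of_summable_norm hb1
    (fun i => (hF i).mono (Set.inter_subset_left (t := V))) (hU.inter hVo)
    (fun i t ht => hV t ht.2 i)
  exact ((h s ⟨hs, hsV⟩).differentiableAt ((hU.inter hVo).mem_nhds ⟨hs, hsV⟩)).differentiableWithinAt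

/-- The iterated differences `f(x) - f(x + 1)` of `f(x) = x ^ (-w)`. -/
def iterDiff : ℕ → ℂ → ℝ → ℂ
  | 0, w, x => (x : ℂ) ^ (-w)
  | N + 1, w, x => iterDiff N w x - iterDiff N w (x + 1)

lemma hasDerivAt_iterDiff (N : ℕ) (w : ℂ) {x : ℝ} (hx : 0 < x) :
    HasDerivAt (iterDiff N w) (-w * iterDiff N (w + 1) x) x := by
  induction N generalizing x with
  | zero =>
    have h : (x : ℂ) ∈ slitPlane := Or.inl (by simpa using hx)
    have h1 := (hasStrictDerivAt_cpow_const (c := -w) h).hasDerivAt.comp_ofReal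
    have e : -w - 1 = -(w + 1) := by ring
    rw [e] at h1
    exact h1
  | succ N ih =>
    have h1 := (ih hx).sub ((ih (x := x + 1) (by linarith)).comp_add_const x 1)
    rw [← mul_sub] at h1
    exact h1

lemma differentiable_iterDiff (N : ℕ) {x : ℝ} (hx : 0 < x) :
    Differentiable ℂ fun w => iterDiff N w x := by
  induction N generalizing x with
  | zero =>
    intro w
    have hx' : (x : ℂ) ≠ 0 := by exact_mod_cast hx.ne'
    exact (differentiableAt_id.neg).const_cpow (Or.inl hx')
  | succ N ih => exact (ih hx).sub (ih (by linarith))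

/-- A difference over an interval of length 1 is controlled by the derivative, which is -w times the
same difference at w + 1; hence each step gains a power of 1/x. -/
lemma norm_iterDiff_le (N : ℕ) (w : ℂ) {x : ℝ} (hx : 0 < x) (hw : 0 ≤ w.re + N) :
    ‖iterDiff N w x‖ ≤ (‖w‖ + N) ^ N * x ^ (-(w.re + N)) := by
  induction N generalizing w x with
  | zero => simp [iterDiff, norm_cpow_eq_rpow_re_of_pos hx]
  | succ N ih =>
    have hre : (w + 1).re = w.re + 1 := by simp
    have h := Convex.norm_image_sub_le_of_norm_hasDerivWithin_le (f := iterDiff N w)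
      (f' := fun y => -w * iterDiff N (w + 1) y) (s := Set.Icc x (x + 1)) (x := x + 1) (y := x)
      (C := (‖w‖ + (N + 1 : ℕ)) ^ (N + 1) * x ^ (-(w.re + (N + 1 : ℕ))))
      (fun y hy => (hasDerivAt_iterDiff N w (hx.trans_le hy.1)).hasDerivWithinAt) ?_
      (convex_Icc _ _) ⟨by linarith, le_rfl⟩ ⟨le_rfl, by linarith⟩
    · simpa [iterDiff] using h
    · intro y hy
      have hy0 : 0 < y := hx.trans_le hy.1
      have hw' : 0 ≤ (w + 1).re + N := by rw [hre]; push_cast at hw; linarith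
      have h1 := ih (w + 1) hy0 hw'
      have h2 : y ^ (-((w + 1).re + N)) ≤ x ^ (-(w.re + (N + 1 : ℕ))) := by
        rw [hre, show w.re + 1 + (N : ℝ) = w.re + (N + 1 : ℕ) by push_cast; ring]
        exact Real.rpow_le_rpow_of_nonpos hx hy.1 (by linarith)
      have h3 : ‖w + 1‖ + N ≤ ‖w‖ + (N + 1 : ℕ) := by
        have := norm_add_le w 1
        rw [norm_one] at this; push_cast; linarith
      rw [norm_mul, norm_neg, pow_succ', mul_assoc]
      refine mul_le_mul (by simp; positivity) (h1.trans ?_) (norm_nonneg _) (by positivity)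
      gcongr

/-- Summation by parts for a periodic sequence of mean value zero. -/
lemma exists_abel_step {Q : ℕ} (hQ : Q ≠ 0) {Φ : ℕ → ℂ} (hper : Function.Periodic Φ Q)
    (hmean : ∑ m ∈ Finset.range Q, Φ m = 0) {B : ℝ} (hB : ∀ m, ‖Φ m‖ ≤ B) :
    ∃ (c : ℂ) (Ψ : ℕ → ℂ), Function.Periodic Ψ Q ∧ ∑ m ∈ Finset.range Q, Ψ m = 0 ∧
      (∀ m, ‖Ψ m‖ ≤ 2 * Q * B) ∧ ‖c‖ ≤ 2 * Q * B ∧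
      ∀ f : ℕ → ℂ, Tendsto f atTop (𝓝 0) → Summable (fun m => Φ m * f m) →
        Summable (fun m => Ψ m * (f m - f (m + 1))) →
        ∑' m, Φ m * f m = c * f 0 + ∑' m, Ψ m * (f m - f (m + 1)) := by
  have hB0 : 0 ≤ B := (norm_nonneg _).trans (hB 0)
  have hQR : (0 : ℝ) < Q := by positivity
  have hQC : (Q : ℂ) ≠ 0 := by exact_mod_cast hQ
  set T : ℕ → ℂ := fun m => ∑ i ∈ Finset.range m, Φ i with hT
  have hTper : Function.Periodic T Q := by
    intro m
    induction m with
    | zero => simp [hT, hmean]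
    | succ m ih =>
      have : m + 1 + Q = m + Q + 1 := by ring
      simp only [hT] at ih ⊢
      rw [this, Finset.sum_range_succ, ih, Finset.sum_range_succ, hper m]
  have hTb : ∀ m, ‖T m‖ ≤ Q * B := by
    intro m
    rw [← hTper.map_mod_nat m]
    refine (norm_sum_le _ _).trans ((Finset.sum_le_sum fun i _ => hB i).trans ?_)
    rw [Finset.sum_const, Finset.card_range, nsmul_eq_mul]
    have : ((m % Q : ℕ) : ℝ) ≤ Q := by exact_mod_cast (Nat.mod_lt _ (Nat.pos_of_ne_zero hQ)).le
    gcongr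
  -- The mean of the partial sums. Subtracting it gives the new sequence mean 0, so that the step
  -- can be repeated.
  set c : ℂ := (∑ m ∈ Finset.range Q, T (m + 1)) / Q with hc
  have hcb : ‖c‖ ≤ Q * B := by
    rw [hc, norm_div, norm_natCast, div_le_iff₀ hQR]
    refine (norm_sum_le _ _).trans ((Finset.sum_le_sum fun i _ => hTb (i + 1)).trans ?_)
    rw [Finset.sum_const, Finset.card_range, nsmul_eq_mul, mul_comm]
  refine ⟨c, fun m => T (m + 1) - c, ?_, ?_, ?_, ?_, ?_⟩
  · intro m
    have : m + Q + 1 = m + 1 + Q := by ring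
    simp only [this, hTper (m + 1)]
  · rw [Finset.sum_sub_distrib, Finset.sum_const, Finset.card_range, nsmul_eq_mul, hc]
    field_simp; ring
  · intro m
    calc _ ≤ ‖T (m + 1)‖ + ‖c‖ := norm_sub_le _ _
      _ ≤ Q * B + Q * B := add_le_add (hTb _) hcb
      _ = _ := by ring
  · have : 0 ≤ Q * B := by positivity
    linarith
  · intro f hf h1 h2
    have key : ∀ n, ∑ m ∈ Finset.range n, Φ m * f m = T n * f n + c * (f 0 - f n) +
        ∑ m ∈ Finset.range n, (T (m + 1) - c) * (f m - f (m + 1)) := by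
      intro n
      induction n with
      | zero => simp [hT]
      | succ n ih =>
        rw [Finset.sum_range_succ, ih, Finset.sum_range_succ]
        have : T (n + 1) = T n + Φ n := Finset.sum_range_succ _ _
        rw [this]; ring
    have l1 := h1.hasSum.tendsto_sum_nat
    have l2 := h2.hasSum.tendsto_sum_nat
    have l3 : Tendsto (fun n => T n * f n) atTop (𝓝 0) := by
      have hn : Tendsto (fun n => (Q * B) * ‖f n‖) atTop (𝓝 0) := by
        simpa using hf.norm.const_mul (Q * B)
      refine squeeze_zero_norm (fun n => ?_) hn
      rw [norm_mul]
      exact mul_le_mul_of_nonneg_right (hTb n) (norm_nonneg _)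
    have l4 : Tendsto (fun n => c * (f 0 - f n)) atTop (𝓝 (c * (f 0 - 0))) :=
      (tendsto_const_nhds.sub hf).const_mul c
    have l5 := (l3.add l4).add l2
    simp_rw [← key] at l5
    rw [tendsto_nhds_unique l1 l5, zero_add, sub_zero]

lemma summable_shift_rpow {x : ℝ} (hx : 1 < x) : Summable fun m : ℕ => ((m : ℝ) + 1) ^ (-x) := by
  have := (summable_nat_add_iff 1).2 (Real.summable_nat_rpow.2 (neg_lt_neg hx))
  exact_mod_cast this

lemma summable_mul_iterDiff {Ψ : ℕ → ℂ} {B : ℝ} (hB : ∀ m, ‖Ψ m‖ ≤ B) (N : ℕ) {w : ℂ}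
    (hw : 1 < w.re + N) : Summable fun m : ℕ => Ψ m * iterDiff N w (m + 1) := by
  refine Summable.of_norm_bounded
    ((summable_shift_rpow hw).mul_left (B * (‖w‖ + N) ^ N)) fun m => ?_
  rw [norm_mul, mul_assoc]
  exact mul_le_mul (hB m) (norm_iterDiff_le N w (by positivity) (by linarith)) (norm_nonneg _)
    ((norm_nonneg _).trans (hB m))

lemma tendsto_iterDiff (N : ℕ) {w : ℂ} (hw : 1 < w.re) :
    Tendsto (fun m : ℕ => iterDiff N w (m + 1)) atTop (𝓝 0) := by
  have hN : (0 : ℝ) ≤ N := by positivity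
  have := (summable_mul_iterDiff (Ψ := fun _ => 1) (B := 1) (by simp) N (w := w)
    (by linarith)).tendsto_atTop_zero
  simpa using this

/-- After N summations by parts the remaining series converges for Re w > 1 - N, and the boundary
terms are entire. The constant (2Q)^N is kept because Q will be proportional to |h|. -/
lemma exists_abel_iterate {Q : ℕ} (hQ : Q ≠ 0) {Φ : ℕ → ℂ} (hper : Function.Periodic Φ Q)
    (hmean : ∑ m ∈ Finset.range Q, Φ m = 0) {B : ℝ} (hB : ∀ m, ‖Φ m‖ ≤ B) (N : ℕ) :
    ∃ (c : ℕ → ℂ) (Ψ : ℕ → ℂ), Function.Periodic Ψ Q ∧ ∑ m ∈ Finset.range Q, Ψ m = 0 ∧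
      (∀ m, ‖Ψ m‖ ≤ (2 * Q) ^ N * B) ∧ (∀ i < N, ‖c i‖ ≤ (2 * Q) ^ N * B) ∧
      ∀ w : ℂ, 1 < w.re → ∑' m : ℕ, Φ m * iterDiff 0 w (m + 1) =
        ∑ i ∈ Finset.range N, c i * iterDiff i w 1 + ∑' m : ℕ, Ψ m * iterDiff N w (m + 1) := by
  have hB0 : 0 ≤ B := (norm_nonneg _).trans (hB 0)
  have hQ1 : (1 : ℝ) ≤ Q := by exact_mod_cast Nat.one_le_iff_ne_zero.2 hQ
  induction N with
  | zero => exact ⟨0, Φ, hper, hmean, by simpa using hB, by simp, by simp⟩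
  | succ N ih =>
    obtain ⟨c, Ψ, h1, h2, h3, h4, h5⟩ := ih
    obtain ⟨d, Θ, g1, g2, g3, g4, g5⟩ := exists_abel_step hQ h1 h2 h3
    have e : (2 * Q : ℝ) ^ (N + 1) * B = 2 * Q * ((2 * Q) ^ N * B) := by ring
    have hle : (2 * Q : ℝ) ^ N * B ≤ (2 * Q) ^ (N + 1) * B :=
      mul_le_mul_of_nonneg_right (pow_le_pow_right₀ (by linarith) (Nat.le_succ N)) hB0
    refine ⟨Function.update c N d, Θ, g1, g2, by rwa [e], ?_, ?_⟩
    · intro i hi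
      rcases eq_or_ne i N with rfl | hne
      · rw [Function.update_self, e]; exact g4
      · rw [Function.update_of_ne hne]
        exact (h4 i (by omega)).trans hle
    · intro w hw
      have hN : (0 : ℝ) ≤ N := by positivity
      have hsN := summable_mul_iterDiff h3 N (w := w) (by linarith)
      have hsN1 := summable_mul_iterDiff g3 (N + 1) (w := w) (by push_cast; linarith)
      have hst : ∀ m : ℕ, iterDiff (N + 1) w (m + 1) =
          iterDiff N w (m + 1) - iterDiff N w ((m + 1 : ℕ) + 1) := by
        intro m; rw [iterDiff]; push_cast; rfl
      simp_rw [hst] at hsN1 ⊢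
      rw [h5 w hw, g5 (fun m : ℕ => iterDiff N w (m + 1)) (tendsto_iterDiff N hw) hsN hsN1,
        Finset.sum_range_succ, Function.update_self, ← add_assoc]
      congr 2
      · refine Finset.sum_congr rfl fun i hi => ?_
        rw [Function.update_of_ne (Finset.mem_range.1 hi).ne]
      · simp

/-- The entire function `(w - 1) ζ(w)`. -/
def zetaReg : ℂ → ℂ := DirichletCharacter.LFunctionTrivChar₁ 1

lemma differentiable_zetaReg : Differentiable ℂ zetaReg :=
  DirichletCharacter.differentiable_LFunctionTrivChar₁ 1

lemma zetaReg_eq {w : ℂ} (hw : w ≠ 1) : zetaReg w = (w - 1) * riemannZeta w := by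
  rw [zetaReg, DirichletCharacter.LFunctionTrivChar₁, Function.update_of_ne hw]
  congr 1
  exact congrFun DirichletCharacter.LFunction_modOne_eq w

/-- The constant in the bound for continued periodic Dirichlet series. -/
def periodicBound (N : ℕ) (w : ℂ) : ℝ :=
  ‖zetaReg w‖ + ‖w - 1‖ * (2 ^ N * 2 * (∑ i ∈ Finset.range N, ‖iterDiff i w 1‖ +
    (‖w‖ + N) ^ N * ∑' m : ℕ, ((m : ℝ) + 1) ^ (-(w.re + N))))

lemma exists_local_bound_periodicBound (N : ℕ) {w₀ : ℂ} (hw₀ : 1 < w₀.re + N) :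
    ∃ C : ℝ, ∀ᶠ w in 𝓝 w₀, periodicBound N w ≤ C := by
  set x := (1 + (w₀.re + N)) / 2 with hx
  have hx1 : 1 < x := by rw [hx]; linarith
  have hx2 : x < w₀.re + N := by rw [hx]; linarith
  set T := ∑' m : ℕ, ((m : ℝ) + 1) ^ (-x) with hT
  let K : ℂ → ℝ := fun w => ‖zetaReg w‖ + ‖w - 1‖ * (2 ^ N * 2 *
    (∑ i ∈ Finset.range N, ‖iterDiff i w 1‖ + (‖w‖ + N) ^ N * T))
  have hK : Continuous K := by
    have h1 := differentiable_zetaReg.continuous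
    have h2 : ∀ i, Continuous fun w => iterDiff i w 1 :=
      fun i => (differentiable_iterDiff i one_pos).continuous
    fun_prop
  have e1 : ∀ᶠ w : ℂ in 𝓝 w₀, x < w.re + N :=
    (continuous_re.add continuous_const).continuousAt.eventually (lt_mem_nhds hx2)
  have e2 : ∀ᶠ w in 𝓝 w₀, K w < K w₀ + 1 :=
    hK.continuousAt.eventually (gt_mem_nhds (by linarith))
  refine ⟨K w₀ + 1, ?_⟩
  filter_upwards [e1, e2] with w h1 h2
  refine le_trans ?_ h2.le
  have h3 : ∑' m : ℕ, ((m : ℝ) + 1) ^ (-(w.re + N)) ≤ T := by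
    refine Summable.tsum_le_tsum (fun m => ?_) (summable_shift_rpow (hx1.trans h1))
      (summable_shift_rpow hx1)
    exact Real.rpow_le_rpow_of_exponent_le (by linarith [(Nat.cast_nonneg m : (0 : ℝ) ≤ m)])
      (by linarith)
  simp only [periodicBound, K]
  gcongr

/-- A Dirichlet series with periodic coefficients continues, after multiplication by `w - 1`, to
every half-plane `1 - N < Re w`, and is bounded there by a power of the period. -/
lemma exists_continuation_periodic (N : ℕ) {Q : ℕ} (hQ : Q ≠ 0) {Φ : ℕ → ℂ}
    (hper : Function.Periodic Φ Q) (hB : ∀ m, ‖Φ m‖ ≤ 1) :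
    ∃ E : ℂ → ℂ, DifferentiableOn ℂ E {w | 1 < w.re + N} ∧
      (∀ w : ℂ, 1 < w.re → E w = (w - 1) * ∑' m : ℕ, Φ m / ((m : ℂ) + 1) ^ w) ∧
      ∀ w : ℂ, 1 < w.re + N → ‖E w‖ ≤ periodicBound N w * Q ^ N := by
  have hQR : (0 : ℝ) < Q := by positivity
  have hQ1 : (1 : ℝ) ≤ Q := by exact_mod_cast Nat.one_le_iff_ne_zero.2 hQ
  have hQC : (Q : ℂ) ≠ 0 := by exact_mod_cast hQ
  -- Splitting off the mean isolates the only pole, that of μ ζ(w); the rest has mean 0.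
  set μ : ℂ := (∑ m ∈ Finset.range Q, Φ m) / Q with hμ
  have hμb : ‖μ‖ ≤ 1 := by
    rw [hμ, norm_div, norm_natCast, div_le_one hQR]
    refine (norm_sum_le _ _).trans ((Finset.sum_le_sum fun i _ => hB i).trans ?_)
    simp
  have hB' : ∀ m, ‖Φ m - μ‖ ≤ 2 := fun m =>
    (norm_sub_le _ _).trans (by linarith [hB m])
  obtain ⟨c, Ψ, h1, h2, h3, h4, h5⟩ := exists_abel_iterate hQ (Φ := fun m => Φ m - μ)
    (fun m => by simp only [hper m]) (by
      rw [Finset.sum_sub_distrib, Finset.sum_const, Finset.card_range, nsmul_eq_mul, hμ]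
      field_simp; ring) hB' N
  refine ⟨fun w => μ * zetaReg w + (w - 1) * (∑ i ∈ Finset.range N, c i * iterDiff i w 1 +
    ∑' m : ℕ, Ψ m * iterDiff N w (m + 1)), ?_, ?_, ?_⟩
  · have hopen : IsOpen {w : ℂ | 1 < w.re + N} :=
      isOpen_lt continuous_const (continuous_re.add continuous_const)
    have d1 : DifferentiableOn ℂ (fun w => ∑' m : ℕ, Ψ m * iterDiff N w (m + 1))
        {w : ℂ | 1 < w.re + N} := by
      refine differentiableOn_tsum_of_locally_dominated hopen (fun m =>
        ((differentiable_iterDiff N (by positivity)).const_mul _).differentiableOn) fun w₀ hw₀ => ?_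
      set x := (1 + (w₀.re + N)) / 2 with hx
      have hw₀' : 1 < w₀.re + N := hw₀
      have hx1 : 1 < x := by rw [hx]; linarith
      have hx2 : x < w₀.re + N := by rw [hx]; linarith
      refine ⟨fun m => (2 * Q) ^ N * 2 * ((‖w₀‖ + 1 + N) ^ N * ((m : ℝ) + 1) ^ (-x)),
        ((summable_shift_rpow hx1).mul_left _).mul_left _, ?_⟩
      have e1 : ∀ᶠ w : ℂ in 𝓝 w₀, x < w.re + N :=
        (continuous_re.add continuous_const).continuousAt.eventually (lt_mem_nhds hx2)
      have e2 : ∀ᶠ w : ℂ in 𝓝 w₀, ‖w‖ < ‖w₀‖ + 1 :=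
        continuous_norm.continuousAt.eventually (gt_mem_nhds (by linarith))
      filter_upwards [e1, e2] with w hw1 hw2 m
      rw [norm_mul]
      refine mul_le_mul (h3 m) ((norm_iterDiff_le N w (by positivity) (by linarith)).trans ?_)
        (norm_nonneg _) (by positivity)
      have : (1 : ℝ) ≤ m + 1 := by linarith [(Nat.cast_nonneg m : (0 : ℝ) ≤ m)]
      gcongr
    have d2 : Differentiable ℂ fun w => ∑ i ∈ Finset.range N, c i * iterDiff i w 1 :=
      Differentiable.fun_sum fun i _ => (differentiable_iterDiff i one_pos).const_mul _
    have d3 := differentiable_zetaReg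
    exact ((d3.const_mul μ).differentiableOn).add
      ((differentiable_id.sub_const 1).differentiableOn.mul (d2.differentiableOn.add d1))
  · intro w hw
    have hw1 : w ≠ 1 := by rintro rfl; simp at hw
    have e0 : ∀ m : ℕ, iterDiff 0 w (m + 1) = 1 / ((m : ℂ) + 1) ^ w := by
      intro m; rw [iterDiff, cpow_neg, one_div]; push_cast; rfl
    have s1 := summable_mul_iterDiff (Ψ := fun _ => μ) (fun _ => hμb) 0 (w := w) (by simpa using hw)
    have s2 := summable_mul_iterDiff hB' 0 (w := w) (by simpa using hw)
    have s3 : ∑' m : ℕ, Φ m / ((m : ℂ) + 1) ^ w = μ * riemannZeta w +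
        ∑' m : ℕ, (Φ m - μ) * iterDiff 0 w (m + 1) := by
      rw [zeta_eq_tsum_one_div_nat_add_one_cpow hw, ← tsum_mul_left]
      simp_rw [e0] at s1 s2 ⊢
      rw [← s1.tsum_add s2]
      exact tsum_congr fun m => by ring
    simp only
    rw [s3, h5 w hw, zetaReg_eq hw1]
    ring
  · intro w hw
    have hQN : (1 : ℝ) ≤ Q ^ N := one_le_pow₀ hQ1
    have b1 : ‖∑ i ∈ Finset.range N, c i * iterDiff i w 1‖ ≤
        (2 * Q) ^ N * 2 * ∑ i ∈ Finset.range N, ‖iterDiff i w 1‖ := by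
      rw [Finset.mul_sum]
      refine (norm_sum_le _ _).trans (Finset.sum_le_sum fun i hi => ?_)
      rw [norm_mul]
      exact mul_le_mul_of_nonneg_right (h4 i (Finset.mem_range.1 hi)) (norm_nonneg _)
    have b2 : ‖∑' m : ℕ, Ψ m * iterDiff N w (m + 1)‖ ≤
        (2 * Q) ^ N * 2 * ((‖w‖ + N) ^ N * ∑' m : ℕ, ((m : ℝ) + 1) ^ (-(w.re + N))) := by
      rw [← tsum_mul_left, ← tsum_mul_left]
      refine tsum_of_norm_bounded
        (((summable_shift_rpow hw).mul_left _).mul_left _).hasSum fun m => ?_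
      rw [norm_mul]
      exact mul_le_mul (h3 m) (norm_iterDiff_le N w (by positivity) (by linarith)) (norm_nonneg _)
        (by positivity)
    calc _ ≤ ‖μ‖ * ‖zetaReg w‖ + ‖w - 1‖ * (‖∑ i ∈ Finset.range N, c i * iterDiff i w 1‖ +
          ‖∑' m : ℕ, Ψ m * iterDiff N w (m + 1)‖) := by
          refine (norm_add_le _ _).trans ?_
          rw [norm_mul, norm_mul]
          gcongr
          exact norm_add_le _ _
      _ ≤ Q ^ N * ‖zetaReg w‖ + ‖w - 1‖ *
          ((2 * Q) ^ N * 2 * ∑ i ∈ Finset.range N, ‖iterDiff i w 1‖ +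
          (2 * Q) ^ N * 2 * ((‖w‖ + N) ^ N * ∑' m : ℕ, ((m : ℝ) + 1) ^ (-(w.re + N)))) := by
          gcongr
          exact hμb.trans hQN
      _ = _ := by rw [periodicBound, mul_pow]; ring

end

section
open Complex Filter Topology

/-! ### The Dirichlet series `∑ Υ_m(h) m ^ (-w)` over odd `m` -/

/-- The Riemann zeta function without its Euler factor at `2`. -/
def oddZeta (x : ℂ) : ℂ := ∑' m : ℕ, oddTerm (fun _ => 1) x m

/-- `∑ (D/m) m ^ (-w)` over odd `m`. -/
def oddL (D : ℤ) (w : ℂ) : ℂ := ∑' m : ℕ, oddTerm (jac D) w m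

lemma summable_oddTerm_of_bounded {g : ℕ → ℂ} (hg : ∀ m, ‖g m‖ ≤ 1) {w : ℂ} (hw : 1 < w.re) :
    Summable (oddTerm g w) := by
  refine Summable.of_norm_bounded (Real.summable_nat_rpow.2 (neg_lt_neg hw)) fun m => ?_
  rw [oddTerm]
  split_ifs with hm
  · rw [norm_div, norm_natCast_cpow_of_pos hm.pos, Real.rpow_neg (by positivity), div_eq_mul_inv]
    exact mul_le_of_le_one_left (by positivity) (hg m)
  · simp; positivity

lemma odd_sq_iff {l : ℕ} : Odd (l ^ 2) ↔ Odd l := by rw [sq, Nat.odd_mul, and_self]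

lemma natCast_sq_cpow (l : ℕ) (w : ℂ) : (((l ^ 2 : ℕ) : ℂ)) ^ w = (l : ℂ) ^ (2 * w) := by
  have := natCast_cpow_natCast_mul l 2 w
  push_cast at this ⊢
  exact this.symm

lemma sq_injective : Function.Injective fun l : ℕ => l ^ 2 := Nat.pow_left_injective (by norm_num)

lemma hasSum_oddTerm_square {w : ℂ} (hw : 1 / 2 < w.re) :
    HasSum (oddTerm (fun n => if IsSquare n then 1 else 0) w) (oddZeta (2 * w)) := by
  rw [← sq_injective.hasSum_iff]
  · have h := (summable_oddTerm_of_bounded (g := fun _ => 1) (by simp) (w := 2 * w)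
      (by simp; linarith)).hasSum
    have e : (oddTerm (fun n => if IsSquare n then 1 else 0) w ∘ fun l : ℕ => l ^ 2) =
        oddTerm (fun _ => 1) (2 * w) := by
      funext l
      have : IsSquare (l ^ 2) := ⟨l, sq l⟩
      simp only [Function.comp, oddTerm, odd_sq_iff, natCast_sq_cpow, this, if_true]
    rw [e]
    exact h
  · intro n hn
    rw [oddTerm, if_neg (c := IsSquare n), zero_div, ite_self]
    rintro ⟨l, rfl⟩
    exact hn ⟨l, sq l⟩

lemma sum_divisorsAntidiagonal_square {n : ℕ} (hn : n ≠ 0) (g : ℕ → ℂ) :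
    ∑ p ∈ n.divisorsAntidiagonal, (if IsSquare p.1 then 1 else 0) * g p.2 =
      ∑ l ∈ sqDivisors n, g (n / l ^ 2) := by
  simp only [ite_mul, one_mul, zero_mul]
  rw [← Finset.sum_filter]
  refine Finset.sum_nbij' (fun p => Nat.sqrt p.1) (fun l => (l ^ 2, n / l ^ 2)) ?_ ?_ ?_ ?_ ?_
  · rintro ⟨a, b⟩ hp
    simp only [Finset.mem_filter, Nat.mem_divisorsAntidiagonal] at hp
    obtain ⟨⟨h1, -⟩, l, rfl⟩ := hp
    rw [mem_sqDivisors hn, Nat.sqrt_eq]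
    exact ⟨b, by rw [← h1]; ring⟩
  · intro l hl
    rw [mem_sqDivisors hn] at hl
    simp only [Finset.mem_filter, Nat.mem_divisorsAntidiagonal]
    exact ⟨⟨Nat.mul_div_cancel' hl, hn⟩, l, sq l⟩
  · rintro ⟨a, b⟩ hp
    simp only [Finset.mem_filter, Nat.mem_divisorsAntidiagonal] at hp
    obtain ⟨⟨rfl, h0⟩, l, rfl⟩ := hp
    have hl : 0 < l * l := Nat.pos_of_ne_zero (left_ne_zero_of_mul h0)
    rw [Nat.sqrt_eq, sq, Nat.mul_div_cancel_left _ hl]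
  · intro l _
    exact Nat.sqrt_eq' l
  · rintro ⟨a, b⟩ hp
    simp only [Finset.mem_filter, Nat.mem_divisorsAntidiagonal] at hp
    obtain ⟨⟨rfl, h0⟩, l, rfl⟩ := hp
    have hl : 0 < l * l := Nat.pos_of_ne_zero (left_ne_zero_of_mul h0)
    rw [Nat.sqrt_eq, sq, Nat.mul_div_cancel_left _ hl]

lemma term_ite_odd (g : ℕ → ℂ) (w : ℂ) :
    LSeries.term (fun n => if Odd n then g n else 0) w = oddTerm g w := by
  funext n
  rcases eq_or_ne n 0 with rfl | hn
  · simp [oddTerm]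
  · rw [LSeries.term_of_ne_zero hn, oddTerm]
    split_ifs <;> simp

/-- Multiplication by `ζ_odd(2w)` turns the coefficients `Υ` into elementary ones. -/
lemma hasSum_sqJac (k h : ℤ) {w : ℂ} (hw : 3 / 2 < w.re) :
    HasSum (oddTerm (sqJac k h) w) (oddZeta (2 * w) * ∑' m, oddTerm (upsilon k h) w m) := by
  have hf : LSeriesHasSum (fun n => if Odd n then (if IsSquare n then 1 else 0) else 0) w
      (oddZeta (2 * w)) := by
    rw [LSeriesHasSum, term_ite_odd]; exact hasSum_oddTerm_square (by linarith)
  have hg : LSeriesHasSum (fun n => if Odd n then upsilon k h n else 0) w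
      (∑' m, oddTerm (upsilon k h) w m) := by
    rw [LSeriesHasSum, term_ite_odd]; exact (summable_oddTerm k h hw).hasSum
  have hfg := hf.convolution hg
  rw [LSeriesHasSum] at hfg
  convert hfg using 1
  rw [← term_ite_odd]
  refine funext fun n => ?_
  rcases eq_or_ne n 0 with rfl | hn
  · simp
  rw [LSeries.term_of_ne_zero hn, LSeries.term_of_ne_zero hn, LSeries.convolution_def]
  congr 1
  split_ifs with ho
  · rw [← sqUpsilon_eq_sqJac k ho h, sqUpsilon, ← sum_divisorsAntidiagonal_square hn]
    refine Finset.sum_congr rfl fun p hp => ?_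
    have h1 := (Nat.mem_divisorsAntidiagonal.1 hp).1
    rw [← h1, Nat.odd_mul] at ho
    rw [if_pos ho.1, if_pos ho.2]
  · refine (Finset.sum_eq_zero fun p hp => ?_).symm
    have h1 := (Nat.mem_divisorsAntidiagonal.1 hp).1
    rw [← h1, Nat.odd_mul, not_and_or] at ho
    rcases ho with ho | ho <;> simp [ho]

lemma hasSum_sq_mul (D : ℤ) {f : ℕ} (hf : Odd f) {w : ℂ} (hw : 1 < w.re) :
    HasSum (oddTerm (fun M => if f ^ 2 ∣ M then (f : ℂ) * jac D (M / f ^ 2) else 0) w)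
      ((f : ℂ) ^ (1 - 2 * w) * oddL D w) := by
  have hf0 : f ≠ 0 := hf.pos.ne'
  have hfC : (f : ℂ) ≠ 0 := by exact_mod_cast hf0
  have hinj : Function.Injective fun m : ℕ => f ^ 2 * m :=
    fun a b h => Nat.eq_of_mul_eq_mul_left (by positivity) h
  rw [← hinj.hasSum_iff]
  · have h := (summable_oddTerm_of_bounded (norm_jac_le D) hw).hasSum.mul_left
      ((f : ℂ) ^ (1 - 2 * w))
    have e : (oddTerm (fun M => if f ^ 2 ∣ M then (f : ℂ) * jac D (M / f ^ 2) else 0) w ∘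
        fun m : ℕ => f ^ 2 * m) = fun m => (f : ℂ) ^ (1 - 2 * w) * oddTerm (jac D) w m := by
      funext m
      have ho : Odd (f ^ 2 * m) ↔ Odd m := by
        rw [Nat.odd_mul, odd_sq_iff]; exact and_iff_right hf
      simp only [Function.comp, oddTerm, ho, Dvd.intro m rfl, if_true]
      split_ifs with hm
      · rw [Nat.mul_div_cancel_left _ (by positivity), Nat.cast_mul, natCast_mul_natCast_cpow,
          natCast_sq_cpow, cpow_sub _ _ hfC, cpow_one]
        ring
      · simp
    rw [e]
    exact h
  · intro M hM
    rw [oddTerm, if_neg (c := f ^ 2 ∣ M), zero_div, ite_self]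
    rintro ⟨m, rfl⟩
    exact hM ⟨m, rfl⟩

/-- The odd positive integers whose square divides `h`. -/
def oddSqDivisors (h : ℤ) : Finset ℕ := (sqDivisors h.natAbs).filter fun f => Odd f

lemma mem_oddSqDivisors {h : ℤ} (hh : h ≠ 0) {f : ℕ} :
    f ∈ oddSqDivisors h ↔ ((f ^ 2 : ℕ) : ℤ) ∣ h ∧ Odd f := by
  rw [oddSqDivisors, Finset.mem_filter, mem_sqDivisors (Int.natAbs_ne_zero.2 hh),
    Int.natCast_dvd]

/-- Exchanging the sums over f and M in `hasSum_sqJac` is legitimate because a nonzero h has only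
finitely many square divisors. -/
lemma oddZeta_mul_upsilon (k : ℤ) {h : ℤ} (hh : h ≠ 0) {w : ℂ} (hw : 3 / 2 < w.re) :
    oddZeta (2 * w) * ∑' m, oddTerm (upsilon k h) w m =
      ∑ f ∈ oddSqDivisors h, (f : ℂ) ^ (1 - 2 * w) * oddL (signed k (h / (f ^ 2 : ℕ))) w := by
  refine (hasSum_sqJac k h hw).unique ?_
  have h1 := hasSum_sum (s := oddSqDivisors h) fun f hf =>
    hasSum_sq_mul (signed k (h / (f ^ 2 : ℕ))) ((mem_oddSqDivisors hh).1 hf).2 (w := w)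
      (by linarith)
  convert h1 using 1
  funext M
  simp only [oddTerm]
  split_ifs with hM
  · have hM0 : M ≠ 0 := hM.pos.ne'
    rw [← Finset.sum_div, sqJac]
    congr 1
    rw [← Finset.sum_filter, ← Finset.sum_filter]
    refine Finset.sum_congr ?_ fun _ _ => rfl
    ext f
    simp only [Finset.mem_filter, mem_sqDivisors hM0, mem_oddSqDivisors hh]
    constructor
    · rintro ⟨h1, h2⟩
      exact ⟨⟨h2, odd_sq_iff.1 (hM.of_dvd_nat h1)⟩, h1⟩
    · rintro ⟨⟨h2, -⟩, h1⟩
      exact ⟨h1, h2⟩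
  · simp

/-- The symbol (0/n) vanishes unless n = 1, so only f = l survives. -/
lemma sqJac_zero_sq (k : ℤ) {l : ℕ} (hl : l ≠ 0) : sqJac k 0 (l ^ 2) = l := by
  have hl2 : l ^ 2 ≠ 0 := by positivity
  rw [sqJac, Finset.sum_eq_single_of_mem l ((mem_sqDivisors hl2).2 dvd_rfl)]
  · simp [Nat.div_self (Nat.pos_of_ne_zero hl2), jac_one_right]
  · intro f hf hne
    rw [mem_sqDivisors hl2] at hf
    rw [if_pos (dvd_zero _), Int.zero_ediv, signed, mul_zero, jac,
      jacobiSym.zero_left, Int.cast_zero, mul_zero]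
    obtain ⟨t, rfl⟩ := (Nat.pow_dvd_pow_iff two_ne_zero).1 hf
    have hf0 : 0 < f := Nat.pos_of_ne_zero (left_ne_zero_of_mul hl)
    have ht : t ≠ 0 := right_ne_zero_of_mul hl
    rw [mul_pow, Nat.mul_div_cancel_left _ (by positivity)]
    have : t ≠ 1 := by rintro rfl; simp at hne
    nlinarith [show 2 ≤ t by omega]

lemma sqJac_zero_of_not_square (k : ℤ) {M : ℕ} (hM : M ≠ 0) (hsq : ¬ IsSquare M) :
    sqJac k 0 M = 0 := by
  refine Finset.sum_eq_zero fun f hf => ?_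
  rw [mem_sqDivisors hM] at hf
  obtain ⟨t, rfl⟩ := hf
  have ht : t ≠ 0 := right_ne_zero_of_mul hM
  have ht1 : t ≠ 1 := by rintro rfl; exact hsq ⟨f, by ring⟩
  have hf0 : f ≠ 0 := by rintro rfl; simp at hM
  rw [if_pos (dvd_zero _), Int.zero_ediv, signed, mul_zero, jac,
    Nat.mul_div_cancel_left _ (by positivity), jacobiSym.zero_left (by omega), Int.cast_zero,
    mul_zero]

/-- For h = 0 the coefficients are supported on squares l², with value l, and l · l^(-2w) =
l^(-(2w-1)). -/
lemma oddZeta_mul_upsilon_zero (k : ℤ) {w : ℂ} (hw : 3 / 2 < w.re) :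
    oddZeta (2 * w) * ∑' m, oddTerm (upsilon k 0) w m = oddZeta (2 * w - 1) := by
  refine (hasSum_sqJac k 0 hw).unique ?_
  rw [← sq_injective.hasSum_iff]
  · have h := (summable_oddTerm_of_bounded (g := fun _ => 1) (by simp) (w := 2 * w - 1)
      (by simp; linarith)).hasSum
    have e : (oddTerm (sqJac k 0) w ∘ fun l : ℕ => l ^ 2) = oddTerm (fun _ => 1) (2 * w - 1) := by
      funext l
      simp only [Function.comp, oddTerm, odd_sq_iff]
      split_ifs with hl
      · have hl0 : l ≠ 0 := hl.pos.ne'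
        have hlC : (l : ℂ) ≠ 0 := by exact_mod_cast hl0
        rw [sqJac_zero_sq k hl0, natCast_sq_cpow, cpow_sub _ _ hlC, cpow_one, one_div_div]
      · rfl
    rw [e]
    exact h
  · intro M hM
    rw [oddTerm]
    split_ifs with ho
    · rw [sqJac_zero_of_not_square k ho.pos.ne', zero_div]
      rintro ⟨l, rfl⟩
      exact hM ⟨l, sq l⟩
    · rfl

/-- The entire function `(x - 1) ζ_odd(x)`. -/
def oddZetaReg (x : ℂ) : ℂ := (1 - (2 : ℂ) ^ (-x)) * zetaReg x

lemma differentiable_oddZetaReg : Differentiable ℂ oddZetaReg := by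
  refine Differentiable.mul ?_ differentiable_zetaReg
  exact (differentiable_const _).sub fun x =>
    (differentiableAt_id.neg).const_cpow (Or.inl two_ne_zero)

lemma oddZetaReg_eq {x : ℂ} (hx : 1 < x.re) : oddZetaReg x = (x - 1) * oddZeta x := by
  have hx1 : x ≠ 1 := by rintro rfl; simp at hx
  have h1 : HasSum (fun n : ℕ => 1 / (n : ℂ) ^ x) (riemannZeta x) := by
    rw [zeta_eq_tsum_one_div_nat_cpow hx]
    exact (Complex.summable_one_div_nat_cpow.2 hx).hasSum
  have hinj : Function.Injective fun n : ℕ => 2 * n := fun a b h => by simpa using h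
  have h2 : HasSum (fun n : ℕ => if Even n then 1 / (n : ℂ) ^ x else 0)
      ((2 : ℂ) ^ (-x) * riemannZeta x) := by
    rw [← hinj.hasSum_iff]
    · have e : ((fun n : ℕ => if Even n then 1 / (n : ℂ) ^ x else 0) ∘ fun n : ℕ => 2 * n) =
          fun n : ℕ => (2 : ℂ) ^ (-x) * (1 / (n : ℂ) ^ x) := by
        funext n
        simp only [Function.comp, even_two_mul, if_true]
        rw [Nat.cast_mul, natCast_mul_natCast_cpow, cpow_neg]
        push_cast
        rw [one_div, mul_inv, one_div]
      rw [e]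
      exact h1.mul_left _
    · intro n hn
      refine if_neg ?_
      rintro ⟨m, rfl⟩
      exact hn ⟨m, by simp; ring⟩
  have h3 : oddZeta x = riemannZeta x - (2 : ℂ) ^ (-x) * riemannZeta x := by
    rw [oddZeta, ← (h1.sub h2).tsum_eq]
    refine tsum_congr fun n => ?_
    rw [oddTerm]
    by_cases hn : Even n
    · rw [if_neg (Nat.not_odd_iff_even.2 hn), if_pos hn, sub_self]
    · rw [if_pos (Nat.not_even_iff_odd.1 hn), if_neg hn, sub_zero]
  rw [oddZetaReg, zetaReg_eq hx1, h3]
  ring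

end

section
open Complex Filter Topology

/-! ### The Dirichlet series at even moduli -/

/-- Reciprocity for an odd integer A of either sign: for A < 0 the factor (-1/m) is built into the
sign condition. -/
lemma jac_flip {m : ℕ} (hm : Odd m) {A : ℤ} (hA : Odd A) :
    jac m A.natAbs = jac A m * (if m % 4 = 1 ∨ A % 4 = 1 then 1 else -1) := by
  have hm4 : m % 4 = 1 ∨ m % 4 = 3 := by obtain ⟨j, rfl⟩ := hm; omega
  have hneg : jacobiSym (-1) m = if m % 4 = 1 then 1 else -1 := by
    rw [jacobiSym.at_neg_one hm, ZMod.χ₄_nat_mod_four]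
    rcases hm4 with h | h <;> rw [h] <;> decide
  rcases Int.natAbs_eq A with h | h
  · set n := A.natAbs
    have hn : Odd n := Int.natAbs_odd.2 hA
    rw [h, jac, jac, ← jacobiSym.quadratic_reciprocity_if (Nat.odd_iff.1 hm) (Nat.odd_iff.1 hn)]
    have hn4 : n % 4 = 1 ∨ n % 4 = 3 := by obtain ⟨j, hj⟩ := hn; omega
    rcases hm4 with h1 | h1 <;> rcases hn4 with h2 | h2 <;>
      simp [h1, h2, show ((n : ℤ) % 4 = 1) ↔ (n % 4 = 1) by omega]
  · set n := A.natAbs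
    have hn : Odd n := Int.natAbs_odd.2 hA
    rw [h, jac, jac, ← jacobiSym.quadratic_reciprocity_if (Nat.odd_iff.1 hm) (Nat.odd_iff.1 hn),
      neg_eq_neg_one_mul (n : ℤ), jacobiSym.mul_left, hneg, ← neg_eq_neg_one_mul]
    have hn4 : n % 4 = 1 ∨ n % 4 = 3 := by obtain ⟨j, hj⟩ := hn; omega
    rcases hm4 with h1 | h1 <;> rcases hn4 with h2 | h2 <;>
      simp [h1, h2, show ((-n : ℤ) % 4 = 1) ↔ (n % 4 = 3) by omega]

lemma psi_flip (k : ℤ) {m : ℕ} (hm : Odd m) {A b : ℤ} (hb : Odd b) (hA : A % 4 = m * b % 4) :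
    (if m % 4 = 1 ∨ A % 4 = 1 then 1 else -1) * psi k (m * b) = eps m ^ (-2 * k - 1) * psi k b := by
  have hm4 : m % 4 = 1 ∨ m % 4 = 3 := by obtain ⟨j, rfl⟩ := hm; omega
  have hb4 : b % 4 = 1 ∨ b % 4 = 3 := by obtain ⟨j, rfl⟩ := hb; omega
  have hII : I ^ (2 * k + 1) * I ^ (2 * k + 1) = -1 := by
    rw [I_zpow_eq]; split_ifs <;> simp
  have e : (m : ℤ) * b % 4 = ((m % 4 : ℕ) : ℤ) * (b % 4) % 4 := by
    rw [Int.mul_emod]; norm_num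
  rcases hm4 with h1 | h1 <;> rcases hb4 with h2 | h2 <;> rw [h1, h2] at e <;> norm_num at e <;>
    simp only [psi, eps, h1, h2, e, hA] <;> norm_num
  · rw [show -(2 * k) - 1 = -2 * k - 1 by ring, I_zpow_neg_eq]
  · rw [show -(2 * k) - 1 = -2 * k - 1 by ring, I_zpow_neg_eq]; linear_combination hII

lemma jac_four {m : ℕ} (hm : Odd m) : jac 4 m = 1 := by
  have : (4 : ℤ) = 2 * 2 := by norm_num
  rw [this, jac_mul_left, jac_sq]
  have : Nat.Coprime 2 m := (Nat.coprime_two_left).2 hm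
  exact_mod_cast this

/-- In coordinates A = 4qa + mb, the symbol (qm/|A|) splits. The part at q depends on mb modulo 4q,
giving (q/m)(q/|b|); the part at m is flipped to (A/m) = (q/m)(a/m) since (4/m) = 1. The two (q/m)
cancel, and `psi_flip` turns the reciprocity sign into ε_m^(-2k-1). -/
lemma bcoef_mul (k : ℤ) {q m : ℕ} (hq : q ≠ 0) (hm : Odd m) (hqm : Nat.Coprime q m) (a b : ℤ) :
    bcoef k (q * m) ((4 * q : ℕ) * a + m * b) =
      eps m ^ (-2 * k - 1) * jac a m * bcoef k q b := by
  have hm0 : m ≠ 0 := hm.pos.ne'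
  set A : ℤ := (4 * q : ℕ) * a + m * b with hA
  have hAb : Odd A ↔ Odd b := by
    have : A = 2 * (2 * q * a) + m * b := by rw [hA]; push_cast; ring
    rw [this]
    have hmz : Odd (m : ℤ) := by exact_mod_cast hm
    constructor
    · intro h
      have h1 : Odd ((m : ℤ) * b) := by
        have := h.sub_even (even_two_mul (2 * q * a : ℤ))
        simpa using this
      exact (Int.odd_mul.1 h1).2
    · intro h; exact (even_two_mul _).add_odd (hmz.mul h)
  by_cases hb : Odd b
  swap
  · rw [bcoef, if_neg (hAb.not.2 hb), bcoef, if_neg hb, mul_zero]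
  have hAo := hAb.2 hb
  have hAmod : A % 4 = m * b % 4 := by
    have : A = m * b + 4 * (q * a) := by rw [hA]; push_cast; ring
    rw [this, Int.add_mul_emod_self_left]
  have h1 : bcoef k (q * m) A = bcoef k q A * jac m A.natAbs := by
    rw [bcoef, bcoef, if_pos hAo, if_pos hAo, Nat.cast_mul, jac_mul_left]; ring
  have h2 : bcoef k q A = bcoef k q (m * b) :=
    periodic_int_eq (bcoef_periodic k hq) ⟨a, by rw [hA]; ring⟩
  have hmb : Odd ((m : ℤ) * b) := (by exact_mod_cast hm : Odd (m : ℤ)).mul hb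
  have hb0 : b.natAbs ≠ 0 := (Int.natAbs_odd.2 hb).pos.ne'
  have h3 : bcoef k q (m * b) = jac q m * jac q b.natAbs * psi k (m * b) := by
    rw [bcoef, if_pos hmb, Int.natAbs_mul, Int.natAbs_natCast, jac_mul_right _ hm0 hb0]
  have h4 : jac A m = jac q m * jac a m := by
    rw [jac_congr (b := (4 * q : ℕ) * a) ⟨b, by rw [hA]; ring⟩, jac_mul_left, Nat.cast_mul,
      jac_mul_left, Nat.cast_ofNat, jac_four hm, one_mul]
  have h5 : jac q m * jac q m = 1 := jac_sq (by rwa [Int.gcd_natCast_natCast])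
  have h6 := psi_flip k hm hb hAmod
  rw [h1, h2, h3, jac_flip hm hAo, h4, bcoef, if_pos hb]
  linear_combination (jac q b.natAbs * jac a m) * h6 +
    (jac q b.natAbs * jac a m * psi k (m * b) * (if m % 4 = 1 ∨ A % 4 = 1 then 1 else -1)) * h5

/-- The Gauss sums at even moduli are multiplicative. -/
lemma bGauss_mul (k : ℤ) {q m : ℕ} (hq : q ≠ 0) (hm : Odd m) (hqm : Nat.Coprime q m) (h : ℤ) :
    bGauss k (q * m) h = upsilon k h m * bGauss k q h := by
  have hm0 : m ≠ 0 := hm.pos.ne'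
  have hc : Nat.Coprime m (4 * q) :=
    (Nat.Coprime.mul_left ((Nat.coprime_two_left.2 hm).pow_left 2) hqm).symm
  have e4 : 4 * (q * m) = m * (4 * q) := by ring
  have hper : Function.Periodic (fun a : ℤ => bcoef k (q * m) a * ech (4 * (q * m)) (a * h))
      ((4 * (q * m) : ℕ) : ℤ) :=
    (bcoef_periodic k (by positivity)).mul (ech_periodic (by positivity) h)
  have hs : Real.sqrt ((q * m : ℕ) : ℝ) = Real.sqrt q * Real.sqrt m := by
    rw [Nat.cast_mul, Real.sqrt_mul (by positivity)]
  rw [bGauss, hs, upsilon_odd hm, bGauss, jacGauss]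
  rw [e4] at hper ⊢
  rw [sum_range_mul_coprime _ hm0 (by positivity) hc hper]
  have key : ∀ a b : ℕ, bcoef k (q * m) ((4 * q : ℕ) * a + m * b) *
      ech (m * (4 * q)) (((4 * q : ℕ) * a + m * b) * h) =
      eps m ^ (-2 * k - 1) * ((jac a m * ech m (a * h)) * (bcoef k q b * ech (4 * q) (b * h))) := by
    intro a b
    rw [bcoef_mul k hq hm hqm, add_mul, ech_add, mul_assoc ((4 * q : ℕ) : ℤ), mul_assoc (m : ℤ),
      ech_mul_left _ hm0, mul_comm m (4 * q), ech_mul_left _ (by positivity)]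
    ring
  simp_rw [key, ← Finset.mul_sum]
  rw [← Finset.sum_mul]
  push_cast
  ring

/-! ### The Euler factor at 2. -/

lemma jac_two_pow (j n : ℕ) : jac ((2 ^ j : ℕ) : ℤ) n = jac 2 n ^ j := by
  induction j with
  | zero => simp [jac_one_left]
  | succ j ih => rw [pow_succ, Nat.cast_mul, jac_mul_left, ih, pow_succ]; rfl

lemma bcoef_two_pow_even (k : ℤ) (i : ℕ) : bcoef k (2 ^ (2 * i)) = bcoef k 1 := by
  funext a
  rw [bcoef, bcoef]
  split_ifs with ha
  · rw [jac_two_pow, pow_mul, sq, jac_sq, one_pow, Nat.cast_one, jac_one_left]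
    exact_mod_cast Nat.coprime_two_left.2 (Int.natAbs_odd.2 ha)
  · rfl

lemma bcoef_two_pow_odd (k : ℤ) (i : ℕ) : bcoef k (2 ^ (2 * i + 1)) = bcoef k 2 := by
  funext a
  rw [bcoef, bcoef]
  split_ifs with ha
  · rw [jac_two_pow, pow_succ, pow_mul, sq, jac_sq, one_pow, one_mul]; rfl
    exact_mod_cast Nat.coprime_two_left.2 (Int.natAbs_odd.2 ha)
  · rfl

lemma bcoef_two_pow_periodic (k : ℤ) (j : ℕ) :
    Function.Periodic (bcoef k (2 ^ j)) ((8 : ℕ) : ℤ) := by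
  rcases Nat.even_or_odd' j with ⟨i, rfl | rfl⟩
  · rw [bcoef_two_pow_even]
    have := (bcoef_periodic k one_ne_zero).int_mul 2
    simpa using this
  · rw [bcoef_two_pow_odd]
    exact bcoef_periodic k two_ne_zero

/-- The coefficients at a power of 2 have period 8, so the sum modulo 8 · 2^j is supported on 2^j ∣
h. For h ≠ 0 the Euler factor at 2 is thus a finite sum. -/
lemma bGauss_two_pow_eq_zero (k : ℤ) {j : ℕ} {h : ℤ} (hj : ¬ ((2 ^ j : ℕ) : ℤ) ∣ h) :
    bGauss k (2 ^ (j + 1)) h = 0 := by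
  have e : 4 * 2 ^ (j + 1) = 8 * 2 ^ j := by ring
  rw [bGauss, e, sum_periodic_ech _ (by norm_num) (by positivity) (bcoef_two_pow_periodic k _),
    if_neg hj, zero_mul, mul_zero]

lemma bGauss_four_pow_zero (k : ℤ) (i : ℕ) :
    bGauss k (2 ^ (2 * i)) 0 = 2 ^ i * (1 + I ^ (2 * k + 1)) := by
  have hs : Real.sqrt ((2 ^ (2 * i) : ℕ) : ℝ) = 2 ^ i := by
    rw [mul_comm, pow_mul]; push_cast; exact Real.sqrt_sq (by positivity)
  have h4 : ∑ n ∈ Finset.range 4, bcoef k 1 n * ech (4 * 2 ^ (2 * i)) (n * 0) =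
      1 + I ^ (2 * k + 1) := by
    simp only [mul_zero, ech_zero, mul_one, Finset.sum_range_succ, Finset.range_zero,
      Finset.sum_empty, bcoef, psi]
    norm_num [jac_one_left, show ¬ Odd (2 : ℤ) by decide, show Odd (3 : ℤ) by decide]
  have hper : Function.Periodic (bcoef k 1) ((4 : ℕ) : ℤ) := bcoef_periodic k one_ne_zero
  rw [bGauss, bcoef_two_pow_even, sum_periodic_ech _ (by norm_num) (by positivity) hper, h4,
    if_pos (dvd_zero _), hs]
  push_cast
  rw [pow_mul']
  have : (2 : ℂ) ^ i ≠ 0 := pow_ne_zero _ two_ne_zero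
  field_simp

/-- At h = 0 the residues 1, 3, 5, 7 contribute 1, -i^(2k+1), -1, i^(2k+1). -/
lemma bGauss_two_pow_odd_zero (k : ℤ) (i : ℕ) : bGauss k (2 ^ (2 * i + 1)) 0 = 0 := by
  have e : 4 * 2 ^ (2 * i + 1) = 8 * 2 ^ (2 * i) := by ring
  have h8 : ∑ n ∈ Finset.range 8, bcoef k 2 n * ech (8 * 2 ^ (2 * i)) (n * 0) = 0 := by
    have j3 : jacobiSym 2 3 = -1 := by norm_num
    have j5 : jacobiSym 2 5 = -1 := by norm_num
    have j7 : jacobiSym 2 7 = 1 := by norm_num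
    simp only [mul_zero, ech_zero, mul_one, Finset.sum_range_succ, Finset.range_zero,
      Finset.sum_empty, bcoef, psi]
    norm_num [jac, show ¬ Odd (2 : ℤ) by decide, show Odd (3 : ℤ) by decide,
      show ¬ Odd (4 : ℤ) by decide, show Odd (5 : ℤ) by decide, show ¬ Odd (6 : ℤ) by decide,
      show Odd (7 : ℤ) by decide, j3, j5, j7]
  have hper : Function.Periodic (bcoef k 2) ((8 : ℕ) : ℤ) := bcoef_periodic k two_ne_zero
  rw [bGauss, bcoef_two_pow_odd, e, sum_periodic_ech _ (by norm_num) (by positivity) hper, h8]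
  simp

/-- The terms of the Euler factor at `2`. -/
def twoTerm (k h : ℤ) (w : ℂ) (j : ℕ) : ℂ := bGauss k (2 ^ j) h * (2 : ℂ) ^ (-(j * w))

lemma norm_twoTerm_le (k h : ℤ) (w : ℂ) (j : ℕ) :
    ‖twoTerm k h w j‖ ≤ 4 * ((2 : ℝ) ^ (1 / 2 - w.re)) ^ j := by
  have h1 : ‖(2 : ℂ) ^ (-(j * w))‖ = (2 : ℝ) ^ (-(j * w.re)) := by
    have := norm_cpow_eq_rpow_re_of_pos (x := 2) two_pos (-(j * w))
    simpa using this
  have h2 : Real.sqrt ((2 ^ j : ℕ) : ℝ) = (2 : ℝ) ^ ((j : ℝ) / 2) := by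
    rw [Real.sqrt_eq_rpow, Nat.cast_pow, Nat.cast_ofNat, ← Real.rpow_natCast,
      ← Real.rpow_mul (by norm_num)]
    congr 1; ring
  have h3 : ((2 : ℝ) ^ (1 / 2 - w.re)) ^ j = (2 : ℝ) ^ ((j : ℝ) / 2) * (2 : ℝ) ^ (-(j * w.re)) := by
    rw [← Real.rpow_natCast, ← Real.rpow_mul (by norm_num), ← Real.rpow_add (by norm_num)]
    congr 1; ring
  rw [twoTerm, norm_mul, h1, h3, ← mul_assoc, ← h2]
  exact mul_le_mul_of_nonneg_right (norm_bGauss_le k _ h) (by positivity)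

lemma summable_norm_twoTerm (k h : ℤ) {w : ℂ} (hw : 1 / 2 < w.re) :
    Summable fun j => ‖twoTerm k h w j‖ := by
  refine Summable.of_nonneg_of_le (fun _ => norm_nonneg _) (norm_twoTerm_le k h w)
    ((summable_geometric_of_lt_one (by positivity) ?_).mul_left 4)
  exact Real.rpow_lt_one_of_one_lt_of_neg (by norm_num) (by linarith)

/-- Write n = 2^j m with m odd and use multiplicativity of the Gauss sums; absolute convergence
permits the product of series. -/
lemma tsum_bTerm_eq (k h : ℤ) {w : ℂ} (hw : 3 / 2 < w.re) :
    ∑' n, bTerm k h w n = (∑' j, twoTerm k h w j) * ∑' m, oddTerm (upsilon k h) w m := by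
  have hs := summable_mul_of_summable_norm (summable_norm_twoTerm k h (w := w) (by linarith))
    (summable_oddTerm k h hw).norm
  rw [(summable_norm_twoTerm k h (w := w) (by linarith)).of_norm.tsum_mul_tsum
    (summable_oddTerm k h hw) hs]
  have hterm : ∀ j m : ℕ, Odd m → bTerm k h w (2 ^ j * m) =
      twoTerm k h w j * oddTerm (upsilon k h) w m := by
    intro j m hm
    have hm0 : m ≠ 0 := hm.pos.ne'
    rw [bTerm, if_neg (by positivity), bGauss_mul k (by positivity) hm
      ((Nat.coprime_two_left.2 hm).pow_left j), oddTerm, if_pos hm, twoTerm, Nat.cast_mul,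
      natCast_mul_natCast_cpow, cpow_neg]
    have : ((2 ^ j : ℕ) : ℂ) ^ w = (2 : ℂ) ^ (j * w) := by
      have := natCast_cpow_natCast_mul 2 j w
      push_cast at this ⊢
      exact this.symm
    rw [this]
    field_simp
  have hodd : ∀ x : ℕ × ℕ, twoTerm k h w x.1 * oddTerm (upsilon k h) w x.2 ≠ 0 → Odd x.2 := by
    intro x hx
    by_contra ho
    rw [oddTerm, if_neg ho, mul_zero] at hx
    exact hx rfl
  refine tsum_eq_tsum_of_ne_zero_bij (fun x => 2 ^ x.1.1 * x.1.2) ?_ ?_ ?_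
  · rintro ⟨⟨j, m⟩, hx⟩ ⟨⟨j', m'⟩, hx'⟩ he
    have hm : Odd m := hodd _ hx
    have hm' : Odd m' := hodd _ hx'
    simp only at he
    have key : ∀ {a b c d : ℕ}, Odd c → Odd d → a ≤ b → 2 ^ a * c = 2 ^ b * d → a = b ∧ c = d := by
      intro a b c d hc hd hab heq
      obtain ⟨t, rfl⟩ := Nat.exists_eq_add_of_le hab
      rw [pow_add, mul_assoc] at heq
      have h1 := Nat.eq_of_mul_eq_mul_left (by positivity) heq
      rcases Nat.eq_zero_or_pos t with rfl | ht
      · simpa using h1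
      · exfalso
        rw [h1, Nat.odd_mul, Nat.odd_pow_iff ht.ne'] at hc
        exact absurd hc.1 (by decide)
    rcases le_total j j' with hj | hj
    · obtain ⟨rfl, rfl⟩ := key hm hm' hj he; rfl
    · obtain ⟨rfl, rfl⟩ := key hm' hm hj he.symm; rfl
  · intro n hn
    have hn0 : n ≠ 0 := by rintro rfl; simp [bTerm] at hn
    obtain ⟨j, m, hm, rfl⟩ := Nat.exists_eq_two_pow_mul_odd hn0
    refine ⟨⟨(j, m), ?_⟩, rfl⟩
    rw [Function.mem_support] at hn ⊢
    rwa [← hterm j m hm]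
  · rintro ⟨⟨j, m⟩, hx⟩
    exact hterm j m (hodd _ hx)

lemma tsum_twoTerm_zero (k : ℤ) {w : ℂ} (hw : 1 / 2 < w.re) :
    (1 - (2 : ℂ) ^ (1 - 2 * w)) * ∑' j, twoTerm k 0 w j = 1 + I ^ (2 * k + 1) := by
  have hinj : Function.Injective fun n : ℕ => 2 * n := fun a b h => by simpa using h
  have hr : ‖(2 : ℂ) ^ (1 - 2 * w)‖ < 1 := by
    have := norm_cpow_eq_rpow_re_of_pos (x := 2) two_pos (1 - 2 * w)
    have h2 : ‖(2 : ℂ) ^ (1 - 2 * w)‖ = (2 : ℝ) ^ (1 - 2 * w.re) := by simpa using this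
    rw [h2]
    exact Real.rpow_lt_one_of_one_lt_of_neg (by norm_num) (by linarith)
  have hne : 1 - (2 : ℂ) ^ (1 - 2 * w) ≠ 0 := by
    intro h
    rw [← sub_eq_zero.1 h, norm_one] at hr
    exact lt_irrefl _ hr
  have h : HasSum (twoTerm k 0 w)
      ((1 + I ^ (2 * k + 1)) * (1 - (2 : ℂ) ^ (1 - 2 * w))⁻¹) := by
    rw [← hinj.hasSum_iff]
    · have e : (twoTerm k 0 w ∘ fun n : ℕ => 2 * n) =
          fun n => (1 + I ^ (2 * k + 1)) * ((2 : ℂ) ^ (1 - 2 * w)) ^ n := by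
        funext n
        simp only [Function.comp, twoTerm]
        rw [bGauss_four_pow_zero, ← cpow_nat_mul, ← cpow_natCast (2 : ℂ) n, mul_right_comm,
          ← cpow_add _ _ two_ne_zero, mul_comm]
        congr 2; push_cast; ring
      rw [e]
      exact (hasSum_geometric_of_norm_lt_one hr).mul_left _
    · intro j hj
      rcases Nat.even_or_odd' j with ⟨i, rfl | rfl⟩
      · exact absurd ⟨i, rfl⟩ hj
      · rw [twoTerm, bGauss_two_pow_odd_zero, zero_mul]
  rw [h.tsum_eq]
  field_simp

end

section
open Complex Filter Topology

/-! ### Continuation of the Fourier coefficients -/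

lemma periodicBound_nonneg (N : ℕ) (w : ℂ) : 0 ≤ periodicBound N w := by
  rw [periodicBound]; positivity

lemma exists_continuation_oddL (N : ℕ) {D : ℤ} (hD : D ≠ 0) :
    ∃ E : ℂ → ℂ, DifferentiableOn ℂ E {w | 1 < w.re + N} ∧
      (∀ w : ℂ, 1 < w.re → E w = (w - 1) * oddL D w) ∧
      ∀ w : ℂ, 1 < w.re + N → ‖E w‖ ≤ periodicBound N w * (4 * D.natAbs : ℕ) ^ N := by
  have hQ : 4 * D.natAbs ≠ 0 := by
    have := Int.natAbs_ne_zero.2 hD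
    positivity
  -- The index is shifted by one so that the series starts at 1; the symbol on odd arguments has
  -- period 4|D|.
  have hper : Function.Periodic (fun m : ℕ => if Odd (m + 1) then jac D (m + 1) else 0)
      (4 * D.natAbs) := by
    intro m
    have ho : Odd (m + 4 * D.natAbs + 1) ↔ Odd (m + 1) := by
      rw [Nat.odd_iff, Nat.odd_iff]; omega
    simp only [ho]
    split_ifs with hm
    · rw [jac, jac, jacobiSym.mod_right D (ho.2 hm), jacobiSym.mod_right D hm,
        show m + 4 * D.natAbs + 1 = m + 1 + 4 * D.natAbs by ring, Nat.add_mod_right]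
    · rfl
  have hb : ∀ m : ℕ, ‖(if Odd (m + 1) then jac D (m + 1) else 0)‖ ≤ 1 := by
    intro m
    split_ifs
    · exact norm_jac_le _ _
    · simp
  obtain ⟨E, h1, h2, h3⟩ := exists_continuation_periodic N hQ hper hb
  refine ⟨E, h1, fun w hw => ?_, h3⟩
  rw [h2 w hw, oddL, (summable_oddTerm_of_bounded (norm_jac_le D) hw).tsum_eq_zero_add]
  congr 1
  have h0 : oddTerm (jac D) w 0 = 0 := by simp [oddTerm]
  rw [h0, zero_add]
  refine tsum_congr fun m => ?_
  rw [oddTerm]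
  split_ifs
  · push_cast; rfl
  · simp

lemma natAbs_signed (k h : ℤ) : (signed k h).natAbs = h.natAbs := by
  rcases negOnePow_cases k with ⟨-, h1⟩ | ⟨-, h1⟩ <;> rw [signed, h1] <;> simp

/-- From j = |h| + 2 on, 2^(j-1) exceeds |h| and cannot divide it. -/
lemma twoTerm_eq_zero (k : ℤ) {h : ℤ} (hh : h ≠ 0) (w : ℂ) {j : ℕ}
    (hj : j ∉ Finset.range (h.natAbs + 2)) : twoTerm k h w j = 0 := by
  rw [Finset.mem_range, not_lt] at hj
  obtain ⟨i, rfl⟩ : ∃ i, j = i + 1 := ⟨j - 1, by omega⟩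
  rw [twoTerm, bGauss_two_pow_eq_zero, zero_mul]
  intro hd
  rw [Int.natCast_dvd] at hd
  have h1 := Nat.le_of_dvd (Int.natAbs_pos.2 hh) hd
  have h2 : i < 2 ^ i := Nat.lt_two_pow_self
  omega

/-- A nonzero term with index i + 1 has 2^i ≤ |h|, which converts growth exponential in the index
into growth polynomial in h. -/
lemma norm_twoTerm_le_pow (k : ℤ) {h : ℤ} (hh : h ≠ 0) {N : ℕ} {w : ℂ} (hw : 1 < w.re + N)
    (j : ℕ) : ‖twoTerm k h w j‖ ≤ 4 * (2 * h.natAbs : ℝ) ^ N := by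
  have hh1 : (1 : ℝ) ≤ h.natAbs := by exact_mod_cast Nat.one_le_iff_ne_zero.2 (Int.natAbs_ne_zero.2 hh)
  rcases j with _ | i
  · refine (norm_twoTerm_le k h w 0).trans ?_
    rw [pow_zero]
    have : (1 : ℝ) ≤ (2 * h.natAbs : ℝ) ^ N := one_le_pow₀ (by linarith)
    linarith
  · by_cases hd : ((2 ^ i : ℕ) : ℤ) ∣ h
    · refine (norm_twoTerm_le k h w (i + 1)).trans ?_
      rw [Int.natCast_dvd] at hd
      have h1 := Nat.le_of_dvd (Int.natAbs_pos.2 hh) hd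
      have h1R : (2 : ℝ) ^ i ≤ h.natAbs := by exact_mod_cast h1
      have h2 : (2 : ℝ) ^ (1 / 2 - w.re) ≤ 2 ^ N := by
        rw [← Real.rpow_natCast]
        exact Real.rpow_le_rpow_of_exponent_le (by norm_num) (by linarith)
      calc 4 * ((2 : ℝ) ^ (1 / 2 - w.re)) ^ (i + 1) ≤ 4 * ((2 : ℝ) ^ N) ^ (i + 1) := by gcongr
        _ = 4 * (2 * (2 : ℝ) ^ i) ^ N := by rw [← pow_mul, mul_comm N, pow_mul, pow_succ']
        _ ≤ _ := by gcongr
    · rw [twoTerm, bGauss_two_pow_eq_zero k hd, zero_mul, norm_zero]; positivity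

/-- The factor that removes the poles of the Fourier coefficients. -/
def coeffReg (w : ℂ) : ℂ := oddZetaReg (2 * w) * (w - 1)

/-- The Dirichlet series in the Fourier coefficient at `h`, up to a constant. -/
def coeffSeries (k h : ℤ) (w : ℂ) : ℂ :=
  (1 + I ^ (2 * k + 1)) * ∑' m, oddTerm (upsilon k h) w m + ∑' n, bTerm k h w n

lemma coeffSeries_eq (k h : ℤ) {w : ℂ} (hw : 3 / 2 < w.re) :
    coeffSeries k h w = (1 + I ^ (2 * k + 1) + ∑' j, twoTerm k h w j) *
      ∑' m, oddTerm (upsilon k h) w m := by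
  rw [coeffSeries, tsum_bTerm_eq k h hw]; ring

/-- The constant in the bound for the continued Fourier coefficients. -/
def coeffBound (N : ℕ) (w : ℂ) : ℝ :=
  ‖2 * w - 1‖ * (periodicBound N w * 4 ^ N) * (2 + 12 * 2 ^ N)

lemma exists_local_bound_coeffBound (N : ℕ) {w₀ : ℂ} (hw₀ : 1 < w₀.re + N) :
    ∃ C : ℝ, 0 ≤ C ∧ ∀ᶠ w in 𝓝 w₀, coeffBound N w ≤ C := by
  obtain ⟨C, hC⟩ := exists_local_bound_periodicBound N hw₀
  have hC0 : 0 ≤ C := (periodicBound_nonneg N w₀).trans hC.self_of_nhds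
  have e : ∀ᶠ w : ℂ in 𝓝 w₀, ‖2 * w - 1‖ < ‖2 * w₀ - 1‖ + 1 := by
    have hc : Continuous fun w : ℂ => ‖2 * w - 1‖ := by fun_prop
    exact hc.continuousAt.eventually (gt_mem_nhds (by linarith))
  refine ⟨(‖2 * w₀ - 1‖ + 1) * (C * 4 ^ N) * (2 + 12 * 2 ^ N), by positivity, ?_⟩
  filter_upwards [hC, e] with w h1 h2
  rw [coeffBound]
  have := periodicBound_nonneg N w
  gcongr

lemma norm_one_add_I_zpow_le (k : ℤ) : ‖(1 + I ^ (2 * k + 1) : ℂ)‖ ≤ 2 := by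
  refine (norm_add_le _ _).trans ?_
  rw [norm_one, I_zpow_eq]
  split_ifs <;> simp <;> norm_num

/-- The exponent 4N + 2 collects 1 from the number of f, 2N from f^(1-2w), N from the period of the
L-series, and N + 1 from the Euler factor at 2. -/
lemma exists_continuation_coeff (k : ℤ) (N : ℕ) {h : ℤ} (hh : h ≠ 0) :
    ∃ V : ℂ → ℂ, DifferentiableOn ℂ V {w | 1 < w.re + N} ∧
      (∀ w : ℂ, 3 / 2 < w.re → V w = coeffReg w * coeffSeries k h w) ∧
      ∀ w : ℂ, 1 < w.re + N → ‖V w‖ ≤ coeffBound N w * (h.natAbs : ℝ) ^ (4 * N + 2) := by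
  have hh1 : (1 : ℝ) ≤ h.natAbs := by
    exact_mod_cast Nat.one_le_iff_ne_zero.2 (Int.natAbs_ne_zero.2 hh)
  have hD : ∀ f ∈ oddSqDivisors h, signed k (h / (f ^ 2 : ℕ)) ≠ 0 ∧
      (signed k (h / (f ^ 2 : ℕ))).natAbs ≤ h.natAbs := by
    intro f hf
    obtain ⟨⟨t, ht⟩, ho⟩ := (mem_oddSqDivisors hh).1 hf
    have hf0 : ((f ^ 2 : ℕ) : ℤ) ≠ 0 := by have := ho.pos; positivity
    have e : h / (f ^ 2 : ℕ) = t := by rw [ht, Int.mul_ediv_cancel_left _ hf0]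
    have ht0 : t ≠ 0 := by rintro rfl; simp at ht; exact hh ht
    constructor
    · rw [← Int.natAbs_ne_zero, natAbs_signed, e, Int.natAbs_ne_zero]; exact ht0
    · rw [natAbs_signed, e]
      exact Nat.le_of_dvd (Int.natAbs_pos.2 hh) (Int.natAbs_dvd_natAbs.2 ⟨_, by rw [ht]; ring⟩)
  have hE : ∀ f : ℕ, ∃ E : ℂ → ℂ, f ∈ oddSqDivisors h →
      DifferentiableOn ℂ E {w | 1 < w.re + N} ∧
      (∀ w : ℂ, 1 < w.re → E w = (w - 1) * oddL (signed k (h / (f ^ 2 : ℕ))) w) ∧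
      ∀ w : ℂ, 1 < w.re + N → ‖E w‖ ≤ periodicBound N w *
        (4 * (signed k (h / (f ^ 2 : ℕ))).natAbs : ℕ) ^ N := by
    intro f
    by_cases hf : f ∈ oddSqDivisors h
    · obtain ⟨E, hE⟩ := exists_continuation_oddL N (hD f hf).1
      exact ⟨E, fun _ => hE⟩
    · exact ⟨0, fun h => absurd h hf⟩
  choose E hE using hE
  -- The factor 2w - 1 belongs to `oddZetaReg (2 * w)`, and w - 1 is contained in each E f.
  refine ⟨fun w => (2 * w - 1) * (∑ f ∈ oddSqDivisors h, (f : ℂ) ^ (1 - 2 * w) * E f w) *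
    (1 + I ^ (2 * k + 1) + ∑ j ∈ Finset.range (h.natAbs + 2), twoTerm k h w j), ?_, ?_, ?_⟩
  · refine DifferentiableOn.mul (DifferentiableOn.mul (by fun_prop) ?_) ?_
    · refine DifferentiableOn.fun_sum fun f hf => ?_
      have hf0 : (f : ℂ) ≠ 0 := by
        exact_mod_cast ((mem_oddSqDivisors hh).1 hf).2.pos.ne'
      refine DifferentiableOn.mul (fun w _ => ?_) (hE f hf).1
      exact (DifferentiableAt.const_cpow (by fun_prop) (Or.inl hf0)).differentiableWithinAt
    · refine (differentiableOn_const _).add (DifferentiableOn.fun_sum fun j _ => ?_)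
      refine DifferentiableOn.const_mul (fun w _ => ?_) _
      exact (DifferentiableAt.const_cpow (by fun_prop) (Or.inl two_ne_zero)).differentiableWithinAt
  · intro w hw
    have h1 : ∑' j, twoTerm k h w j = ∑ j ∈ Finset.range (h.natAbs + 2), twoTerm k h w j :=
      tsum_eq_sum fun j hj => twoTerm_eq_zero k hh w hj
    have h2 : ∑ f ∈ oddSqDivisors h, (f : ℂ) ^ (1 - 2 * w) * E f w =
        (w - 1) * (oddZeta (2 * w) * ∑' m, oddTerm (upsilon k h) w m) := by
      rw [oddZeta_mul_upsilon k hh hw, Finset.mul_sum]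
      refine Finset.sum_congr rfl fun f hf => ?_
      rw [(hE f hf).2.1 w (by linarith)]; ring
    simp only
    rw [h2, coeffSeries_eq k h hw, h1, coeffReg, oddZetaReg_eq (by simp; linarith)]
    ring
  · intro w hw
    have hP := periodicBound_nonneg N w
    have b1 : ‖∑ f ∈ oddSqDivisors h, (f : ℂ) ^ (1 - 2 * w) * E f w‖ ≤
        (h.natAbs : ℝ) * ((h.natAbs : ℝ) ^ (2 * N) * (periodicBound N w * (4 * h.natAbs) ^ N)) := by
      have hcard : (oddSqDivisors h).card ≤ h.natAbs :=
        (Finset.card_filter_le _ _).trans ((Finset.card_filter_le _ _).trans (Nat.card_divisors_le_self _))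
      have hcardR : ((oddSqDivisors h).card : ℝ) ≤ h.natAbs := by exact_mod_cast hcard
      calc _ ≤ ∑ f ∈ oddSqDivisors h,
            ((h.natAbs : ℝ) ^ (2 * N) * (periodicBound N w * (4 * h.natAbs) ^ N)) := by
            refine (norm_sum_le _ _).trans (Finset.sum_le_sum fun f hf => ?_)
            have hmem := (mem_oddSqDivisors hh).1 hf
            have hf1 : 0 < f := hmem.2.pos
            have hfh : f ≤ h.natAbs := by
              have := Nat.le_of_dvd (Int.natAbs_pos.2 hh) (Int.natCast_dvd.1 hmem.1)
              exact (Nat.le_self_pow two_ne_zero f).trans this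
            have hfR : (1 : ℝ) ≤ f := by exact_mod_cast hf1
            have hfhR : (f : ℝ) ≤ h.natAbs := by exact_mod_cast hfh
            rw [norm_mul]
            refine mul_le_mul ?_ ?_ (norm_nonneg _) (by positivity)
            · rw [norm_natCast_cpow_of_pos hf1]
              have hre : (1 - 2 * w).re = 1 - 2 * w.re := by simp
              calc (f : ℝ) ^ (1 - 2 * w).re ≤ (f : ℝ) ^ ((2 * N : ℕ) : ℝ) :=
                    Real.rpow_le_rpow_of_exponent_le hfR (by rw [hre]; push_cast; linarith)
                _ = (f : ℝ) ^ (2 * N) := Real.rpow_natCast _ _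
                _ ≤ _ := by gcongr
            · refine ((hE f hf).2.2 w hw).trans ?_
              have h5 : ((signed k (h / (f ^ 2 : ℕ))).natAbs : ℝ) ≤ h.natAbs := by
                exact_mod_cast (hD f hf).2
              push_cast at h5 ⊢
              gcongr
        _ = (oddSqDivisors h).card *
            ((h.natAbs : ℝ) ^ (2 * N) * (periodicBound N w * (4 * h.natAbs) ^ N)) := by
            rw [Finset.sum_const, nsmul_eq_mul]
        _ ≤ _ := by gcongr
    have b2 : ‖1 + I ^ (2 * k + 1) + ∑ j ∈ Finset.range (h.natAbs + 2), twoTerm k h w j‖ ≤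
        (2 + 12 * 2 ^ N) * (h.natAbs : ℝ) ^ (N + 1) := by
      have h6 : ‖∑ j ∈ Finset.range (h.natAbs + 2), twoTerm k h w j‖ ≤
          (h.natAbs + 2) * (4 * (2 * h.natAbs : ℝ) ^ N) := by
        refine (norm_sum_le _ _).trans ?_
        refine (Finset.sum_le_sum fun j _ => norm_twoTerm_le_pow k hh hw j).trans (le_of_eq ?_)
        rw [Finset.sum_const, Finset.card_range, nsmul_eq_mul]; push_cast; ring
      have h7 : (1 : ℝ) ≤ (h.natAbs : ℝ) ^ (N + 1) := one_le_pow₀ hh1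
      calc _ ≤ 2 + (h.natAbs + 2) * (4 * (2 * h.natAbs : ℝ) ^ N) :=
            (norm_add_le _ _).trans (add_le_add (norm_one_add_I_zpow_le k) h6)
        _ ≤ 2 * (h.natAbs : ℝ) ^ (N + 1) + (3 * h.natAbs) * (4 * (2 * h.natAbs : ℝ) ^ N) := by
            gcongr
            · linarith
            · linarith
        _ = _ := by rw [mul_pow, pow_succ]; ring
    rw [norm_mul, norm_mul]
    calc _ ≤ ‖2 * w - 1‖ * ((h.natAbs : ℝ) * ((h.natAbs : ℝ) ^ (2 * N) *
          (periodicBound N w * (4 * h.natAbs) ^ N))) * ((2 + 12 * 2 ^ N) *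
          (h.natAbs : ℝ) ^ (N + 1)) := by gcongr
      _ = _ := by rw [coeffBound, mul_pow]; ring

end

section
open Complex Filter Topology

/-! ### Meromorphic continuation -/

/-- Continuations to all half-planes glue to an entire function. -/
lemma exists_entire_of_halfPlanes {f : ℂ → ℂ} {σ : ℝ}
    (hA : ∀ n : ℕ, ∃ A : ℂ → ℂ, DifferentiableOn ℂ A {s | -(n : ℝ) < s.re} ∧
      ∀ s : ℂ, -(n : ℝ) < s.re → σ < s.re → A s = f s) :
    ∃ A : ℂ → ℂ, Differentiable ℂ A ∧ ∀ s : ℂ, σ < s.re → A s = f s := by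
  choose A hA1 hA2 using hA
  have hopen : ∀ x : ℝ, IsOpen {s : ℂ | x < s.re} := fun x => isOpen_lt continuous_const continuous_re
  have hagree : ∀ {n m : ℕ}, n ≤ m → ∀ s : ℂ, -(n : ℝ) < s.re → A n s = A m s := by
    intro n m hnm
    have hnmR : (n : ℝ) ≤ m := by exact_mod_cast hnm
    have hsub : {s : ℂ | -(n : ℝ) < s.re} ⊆ {s : ℂ | -(m : ℝ) < s.re} := fun s hs => by
      have : -(n : ℝ) < s.re := hs
      exact lt_of_le_of_lt (by linarith) this
    have a1 := (hA1 n).analyticOnNhd (hopen _)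
    have a2 := ((hA1 m).mono hsub).analyticOnNhd (hopen _)
    have hpre : IsPreconnected {s : ℂ | -(n : ℝ) < s.re} :=
      (convex_halfSpace_re_gt _).isPreconnected
    -- A point to the right of both σ and 0: it lies in every half-plane, and near it all
    -- continuations equal f.
    set z₀ : ℂ := ((max σ 0 + 1 : ℝ) : ℂ) with hz₀
    have hzre : z₀.re = max σ 0 + 1 := by rw [hz₀, ofReal_re]
    have hn0 : (0 : ℝ) ≤ n := by positivity
    have hz1 : -(n : ℝ) < z₀.re := by rw [hzre]; linarith [le_max_right σ 0]
    have hz2 : σ < z₀.re := by rw [hzre]; linarith [le_max_left σ 0]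
    have hev : A n =ᶠ[𝓝 z₀] A m := by
      filter_upwards [(hopen _).mem_nhds hz1, (hopen _).mem_nhds hz2] with s h1 h2
      rw [hA2 n s h1 h2, hA2 m s (hsub h1) h2]
    exact a1.eqOn_of_preconnected_of_eventuallyEq a2 hpre hz1 hev
  let idx : ℂ → ℕ := fun s => ⌊|s.re|⌋₊ + 1
  have hidx : ∀ s : ℂ, -(idx s : ℝ) < s.re := by
    intro s
    have h1 := Nat.lt_floor_add_one |s.re|
    have h2 := neg_abs_le s.re
    simp only [idx]; push_cast; linarith
  refine ⟨fun s => A (idx s) s, fun s => ?_, fun s hs => hA2 _ s (hidx s) hs⟩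
  -- An index at least as large as `idx t` for all t near s, so that near s the glued function is
  -- the single A m.
  set m : ℕ := ⌊|s.re| + 1⌋₊ + 1 with hm
  have hsm : -(m : ℝ) < s.re := by
    have h1 := Nat.lt_floor_add_one (|s.re| + 1)
    have h2 := neg_abs_le s.re
    rw [hm]; push_cast; linarith
  have hd : DifferentiableAt ℂ (A m) s := (hA1 m).differentiableAt ((hopen _).mem_nhds hsm)
  refine hd.congr_of_eventuallyEq ?_
  have hc : ∀ᶠ t : ℂ in 𝓝 s, |t.re| < |s.re| + 1 :=
    (continuous_abs.comp continuous_re).continuousAt.eventually (gt_mem_nhds (by simp))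
  filter_upwards [hc] with t ht
  refine hagree ?_ t (hidx t)
  simp only [idx, hm]
  exact Nat.add_le_add_right (Nat.floor_le_floor ht.le) 1

/-- An entire function whose product with `H` is entire in `s`. -/
def poleReg (k : ℤ) (s : ℂ) : ℂ :=
  coeffReg ((k : ℂ) + 2 * s) * (1 - (2 : ℂ) ^ (1 - 2 * ((k : ℂ) + 2 * s))) *
    (Gamma ((k : ℂ) + 2 * s - 1 / 2))⁻¹

lemma differentiable_coeffReg : Differentiable ℂ coeffReg :=
  (differentiable_oddZetaReg.comp (differentiable_id.const_mul 2)).mul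
    (differentiable_id.sub_const 1)

lemma differentiable_eulerTwo (k : ℤ) :
    Differentiable ℂ fun s : ℂ => 1 - (2 : ℂ) ^ (1 - 2 * ((k : ℂ) + 2 * s)) := fun s =>
  (differentiableAt_const _).sub
    (DifferentiableAt.const_cpow (by fun_prop) (Or.inl two_ne_zero))

lemma differentiable_invGamma (k : ℤ) :
    Differentiable ℂ fun s : ℂ => (Gamma ((k : ℂ) + 2 * s - 1 / 2))⁻¹ :=
  differentiable_one_div_Gamma.comp (f := fun s : ℂ => (k : ℂ) + 2 * s - 1 / 2) (by fun_prop)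

lemma differentiable_poleReg (k : ℤ) : Differentiable ℂ (poleReg k) :=
  ((differentiable_coeffReg.comp (f := fun s : ℂ => (k : ℂ) + 2 * s) (by fun_prop)).mul
    (differentiable_eulerTwo k)).mul (differentiable_invGamma k)

lemma norm_two_cpow (x : ℂ) : ‖(2 : ℂ) ^ x‖ = (2 : ℝ) ^ x.re := by
  have := norm_cpow_eq_rpow_re_of_pos (x := 2) two_pos x
  simpa using this

lemma one_sub_two_cpow_ne_zero {x : ℂ} (hx : x.re < 0) : 1 - (2 : ℂ) ^ x ≠ 0 := by
  intro h
  have h1 : ‖(2 : ℂ) ^ x‖ < 1 := by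
    rw [norm_two_cpow]; exact Real.rpow_lt_one_of_one_lt_of_neg (by norm_num) hx
  rw [← sub_eq_zero.1 h, norm_one] at h1
  exact lt_irrefl _ h1

lemma exists_poleReg_ne_zero (k : ℤ) : ∃ s, poleReg k s ≠ 0 := by
  -- This s corresponds to w = 2, where all factors are in their range of convergence.
  refine ⟨(2 - k) / 2, ?_⟩
  have e : (k : ℂ) + 2 * ((2 - k) / 2) = 2 := by ring
  have hz : oddZetaReg (2 * 2) ≠ 0 := by
    rw [oddZetaReg, zetaReg_eq (by norm_num)]
    refine mul_ne_zero (one_sub_two_cpow_ne_zero (by norm_num)) (mul_ne_zero (by norm_num) ?_)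
    exact riemannZeta_ne_zero_of_one_lt_re (by norm_num)
  rw [poleReg, e, coeffReg]
  refine mul_ne_zero (mul_ne_zero (mul_ne_zero hz (by norm_num))
    (one_sub_two_cpow_ne_zero (by norm_num))) (inv_ne_zero (Gamma_ne_zero_of_re_pos (by norm_num)))

lemma summable_lineChar_coeffSeries {k : ℤ} {s : ℂ} (hs : 2 < (k : ℝ) + 1 / 2 + 2 * s.re)
    (τ : UpperHalfPlane) :
    Summable fun h => lineChar k s τ h * coeffSeries k h ((k : ℂ) + 2 * s) := by
  refine ((summable_fourierTerm hs τ).mul_left (2 * (1 + I ^ (2 * k + 1)))).congr fun h => ?_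
  rw [fourierTerm_eq, coeffSeries, ← two_mul_twistedE k h (weight_re hs)]
  ring

/-- The odd series is a quotient of zeta values and the Euler factor at 2 is (1 + i^(2k+1))/(1 -
2^(1-2w)). The denominator 2 arises because `oddZetaReg (2 * w - 1)` contains 2w - 2 while
`coeffReg` contains w - 1. -/
lemma coeffReg_mul_coeffSeries_zero (k : ℤ) {w : ℂ} (hw : 3 / 2 < w.re) :
    (1 - (2 : ℂ) ^ (1 - 2 * w)) * (coeffReg w * coeffSeries k 0 w) =
      (2 * w - 1) / 2 * oddZetaReg (2 * w - 1) * (1 + I ^ (2 * k + 1)) *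
        ((1 - (2 : ℂ) ^ (1 - 2 * w)) + 1) := by
  have h1 := tsum_twoTerm_zero k (w := w) (by linarith)
  have h2 := oddZeta_mul_upsilon_zero k hw
  rw [coeffSeries_eq k 0 hw, coeffReg, oddZetaReg_eq (by simp; linarith),
    oddZetaReg_eq (x := 2 * w - 1) (by simp; linarith), ← h2]
  linear_combination (2 * w - 1) * (w - 1) * oddZeta (2 * w) *
    (∑' m, oddTerm (upsilon k 0) w m) * h1

lemma norm_exp_char (h : ℤ) (u : ℝ) : ‖exp (2 * Real.pi * I * h * u)‖ = 1 := by
  have : (2 * Real.pi * I * h * u : ℂ) = ((2 * Real.pi * h * u : ℝ) : ℂ) * I := by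
    push_cast; ring
  rw [this, norm_exp_ofReal_mul_I]

lemma exists_continuation_halfPlane (k : ℤ) (τ : UpperHalfPlane) (n : ℕ) :
    ∃ A : ℂ → ℂ, DifferentiableOn ℂ A {s | -(n : ℝ) < s.re} ∧
      ∀ s : ℂ, -(n : ℝ) < s.re → 3 / 4 - (k : ℝ) / 2 < s.re →
        A s = poleReg k s * eisH k s τ := by
  -- For Re s > -n this ensures Re w + N > 1.
  set N : ℕ := k.natAbs + 2 * n + 2 with hN
  -- Decay |h|^(-M) against growth |h|^(4N+2) leaves the summable h^(-2).
  set M : ℕ := 4 * N + 4 with hM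
  have hkN : -(k : ℝ) ≤ k.natAbs := by
    rw [Nat.cast_natAbs, Int.cast_abs]; exact neg_le_abs _
  have hNR : (N : ℝ) = k.natAbs + 2 * n + 2 := by rw [hN]; push_cast; ring
  have hN0 : (0 : ℝ) ≤ N := by positivity
  have hMR : (M : ℝ) = 4 * N + 4 := by rw [hM]; push_cast; ring
  have hwN : ∀ s : ℂ, -(n : ℝ) < s.re → 1 < ((k : ℂ) + 2 * s).re + N := by
    intro s hs; simp; rw [hNR]; linarith
  have hsM : ∀ s : ℂ, -(n : ℝ) < s.re →
      1 < ((k : ℂ) + 1 / 2).re + (0 : ℂ).re + 2 * s.re + M := by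
    intro s hs; simp; rw [hMR]; linarith
  have hopen : IsOpen {s : ℂ | -(n : ℝ) < s.re} := isOpen_lt continuous_const continuous_re
  have hV : ∀ h : ℤ, ∃ V : ℂ → ℂ, h ≠ 0 → DifferentiableOn ℂ V {w | 1 < w.re + N} ∧
      (∀ w : ℂ, 3 / 2 < w.re → V w = coeffReg w * coeffSeries k h w) ∧
      ∀ w : ℂ, 1 < w.re + N → ‖V w‖ ≤ coeffBound N w * (h.natAbs : ℝ) ^ (4 * N + 2) := by
    intro h
    by_cases hh : h = 0
    · exact ⟨0, fun h' => absurd hh h'⟩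
    · obtain ⟨V, hV⟩ := exists_continuation_coeff k N hh
      exact ⟨V, fun _ => hV⟩
  choose V hV using hV
  obtain ⟨E, hE1, hE2, hE3⟩ := exists_continuation_lineFT τ.im_pos M ((k : ℂ) + 1 / 2) 0
  obtain ⟨E₀, hE₀1, hE₀2⟩ := exists_continuation_lineFT_zero τ.im_pos M ((k : ℂ) + 1 / 2) 0
  have hmaps : Set.MapsTo (fun s : ℂ => (k : ℂ) + 2 * s) {s | -(n : ℝ) < s.re}
      {w | 1 < w.re + N} := fun s hs => hwN s hs
  let term : ℤ → ℂ → ℂ := fun h s => if h = 0 then 0 else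
    V h ((k : ℂ) + 2 * s) * (E h s * exp (2 * Real.pi * I * h * τ.re))
  have hterm : DifferentiableOn ℂ (fun s => ∑' h, term h s) {s | -(n : ℝ) < s.re} := by
    refine differentiableOn_tsum_of_locally_dominated hopen (fun h => ?_) fun s₀ hs₀ => ?_
    · by_cases hh : h = 0
      · simp only [term, hh, if_true]; exact differentiableOn_const 0
      · simp only [term, hh, if_false]
        refine DifferentiableOn.mul ((hV h hh).1.comp (by fun_prop) hmaps) ?_
        exact ((hE1 h hh).mono fun s hs => hsM s hs).mul_const _
    · obtain ⟨C, hC0, hC⟩ := exists_local_bound_coeffBound N (hwN s₀ hs₀)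
      obtain ⟨B, hB0, hB⟩ := hE3 s₀ (hsM s₀ hs₀)
      have hcont : Continuous fun s : ℂ => (k : ℂ) + 2 * s := by fun_prop
      have hC' := hcont.continuousAt.eventually hC
      refine ⟨fun h => C * B * (1 / (h : ℝ) ^ 2),
        (Real.summable_one_div_int_pow.2 (by norm_num)).mul_left _, ?_⟩
      filter_upwards [hC', hB, hopen.mem_nhds hs₀] with s h1 h2 h3 h
      by_cases hh : h = 0
      · simp only [term, hh, if_true, norm_zero]; positivity
      · simp only [term, hh, if_false]
        have habs : (h.natAbs : ℝ) = |(h : ℝ)| := by rw [Nat.cast_natAbs, Int.cast_abs]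
        have hpos : 0 < |(h : ℝ)| := abs_pos.2 (by exact_mod_cast hh)
        rw [norm_mul, norm_mul, norm_exp_char, mul_one]
        have h4 := ((hV h hh).2.2 _ (hwN s h3)).trans
          (mul_le_mul_of_nonneg_right h1 (by positivity))
        calc _ ≤ (C * (h.natAbs : ℝ) ^ (4 * N + 2)) * (B / |(h : ℝ)| ^ M) :=
              mul_le_mul h4 (h2 h hh) (norm_nonneg _) (by positivity)
          _ = _ := by
            rw [habs, hM, show 4 * N + 4 = (4 * N + 2) + 2 by ring, pow_add _ (4 * N + 2) 2, sq_abs]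
            field_simp
  -- Three contributions, each multiplied by `poleReg`: the constant term, frequency 0, where the
  -- Gamma factor goes to the transform and the rest to the coefficient, and the series over h ≠ 0,
  -- where `coeffReg` goes to the coefficients.
  refine ⟨fun s => riemannZeta (1 - 2 * (k : ℂ)) / (2 : ℂ) ^ (2 * k + 1) *
    (poleReg k s * (4 : ℂ) ^ ((k : ℂ) + 1 / 2 + 2 * s) +
      E₀ s * ((2 * ((k : ℂ) + 2 * s) - 1) / 2 * oddZetaReg (2 * ((k : ℂ) + 2 * s) - 1) *
        (1 + I ^ (2 * k + 1)) * ((1 - (2 : ℂ) ^ (1 - 2 * ((k : ℂ) + 2 * s))) + 1)) +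
      (1 - (2 : ℂ) ^ (1 - 2 * ((k : ℂ) + 2 * s))) * (Gamma ((k : ℂ) + 2 * s - 1 / 2))⁻¹ *
        ∑' h, term h s), ?_, ?_⟩
  · have d1 := differentiable_poleReg k
    have d2 := differentiable_eulerTwo k
    have d3 := differentiable_invGamma k
    have d4 : Differentiable ℂ fun s : ℂ => (4 : ℂ) ^ ((k : ℂ) + 1 / 2 + 2 * s) := fun s =>
      DifferentiableAt.const_cpow (by fun_prop) (Or.inl (by norm_num))
    have d5 : Differentiable ℂ fun s : ℂ => oddZetaReg (2 * ((k : ℂ) + 2 * s) - 1) :=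
      differentiable_oddZetaReg.comp (f := fun s : ℂ => 2 * ((k : ℂ) + 2 * s) - 1) (by fun_prop)
    have d6 : Differentiable ℂ fun s : ℂ => (2 * ((k : ℂ) + 2 * s) - 1) / 2 := by fun_prop
    have d7 : DifferentiableOn ℂ E₀ {s | -(n : ℝ) < s.re} := hE₀1.mono fun s hs => hsM s hs
    refine DifferentiableOn.const_mul (DifferentiableOn.add (DifferentiableOn.add
      (d1.mul d4).differentiableOn (d7.mul ?_)) ((d2.mul d3).differentiableOn.mul hterm)) _
    exact (((d6.mul d5).mul_const _).mul (d2.add_const 1)).differentiableOn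
  · intro s hsn hs
    have hs' : 2 < (k : ℝ) + 1 / 2 + 2 * s.re := by linarith
    have hw := weight_re hs'
    have hcond : 1 < ((k : ℂ) + 1 / 2).re + (0 : ℂ).re + 2 * s.re := by simp; linarith
    have hsum := summable_lineChar_coeffSeries hs' τ
    have hzero : E₀ s = (Gamma ((k : ℂ) + 2 * s - 1 / 2))⁻¹ * lineChar k s τ 0 := by
      rw [hE₀2 s hcond, lineChar]
      congr 1
      · congr 2; ring
      · simp
    have hnz : (1 - (2 : ℂ) ^ (1 - 2 * ((k : ℂ) + 2 * s))) *
        (Gamma ((k : ℂ) + 2 * s - 1 / 2))⁻¹ * ∑' h, term h s = poleReg k s *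
        ∑' h : ℤ, (if h = 0 then 0 else lineChar k s τ h * coeffSeries k h ((k : ℂ) + 2 * s)) := by
      rw [← tsum_mul_left, ← tsum_mul_left]
      refine tsum_congr fun h => ?_
      by_cases hh : h = 0
      · simp [term, hh]
      · simp only [term, hh, if_false]
        rw [(hV h hh).2.1 _ hw, hE2 h hh s hcond, poleReg, lineChar]
        ring
    have hH : eisH k s τ = riemannZeta (1 - 2 * (k : ℂ)) / (2 : ℂ) ^ (2 * k + 1) *
      ((4 : ℂ) ^ ((k : ℂ) + 1 / 2 + 2 * s) + ∑' h : ℤ, lineChar k s τ h *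
        coeffSeries k h ((k : ℂ) + 2 * s)) := eisH_eq hs' τ
    simp only
    rw [hH, hsum.tsum_eq_add_tsum_ite 0, hnz, hzero, ← coeffReg_mul_coeffSeries_zero k hw]
    simp only [poleReg]
    ring

/-- Divide the entire function that extends `poleReg k s * eisH k s τ` by `poleReg k`. The zeros of
the latter are discrete, because it does not vanish identically, and they do not involve τ. -/
theorem exists_meromorphic_continuation (k : ℤ) :
    ∃ (P : Set ℂ) (G : UpperHalfPlane → ℂ → ℂ), Pᶜ ∈ codiscrete ℂ ∧
      ∀ τ : UpperHalfPlane, Meromorphic (G τ) ∧ AnalyticOnNhd ℂ (G τ) Pᶜ ∧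
        ∀ s : ℂ, 3 / 4 - (k : ℝ) / 2 < s.re → G τ s = eisH k s τ := by
  have hA := fun τ : UpperHalfPlane =>
    exists_entire_of_halfPlanes (f := fun s => poleReg k s * eisH k s τ)
      (σ := 3 / 4 - (k : ℝ) / 2) fun n => exists_continuation_halfPlane k τ n
  choose A hA1 hA2 using hA
  have hZ := differentiable_poleReg k
  have hZan : AnalyticOnNhd ℂ (poleReg k) Set.univ := fun s _ => hZ.analyticAt s
  obtain ⟨s₁, hs₁⟩ := exists_poleReg_ne_zero k
  have hcod : (poleReg k) ⁻¹' {0}ᶜ ∈ codiscrete ℂ := hZan.preimage_zero_mem_codiscrete hs₁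
  classical
  -- On the original half-plane G is H itself, so that equality holds there also at zeros of
  -- `poleReg`, where the quotient has the default value 0.
  let G : UpperHalfPlane → ℂ → ℂ := fun τ s =>
    if 3 / 4 - (k : ℝ) / 2 < s.re then eisH k s τ else A τ s / poleReg k s
  have hG : ∀ τ s, poleReg k s ≠ 0 → G τ s = A τ s / poleReg k s := by
    intro τ s hs
    simp only [G]
    split_ifs with h
    · rw [hA2 τ s h, mul_div_cancel_left₀ _ hs]
    · rfl
  refine ⟨(poleReg k) ⁻¹' {0}, G, hcod, fun τ => ⟨fun s => ?_, fun s hs => ?_, fun s hs => if_pos hs⟩⟩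
  · have hm : MeromorphicAt (fun s => A τ s / poleReg k s) s :=
      ((hA1 τ).analyticAt s).meromorphicAt.div (hZ.analyticAt s).meromorphicAt
    refine hm.congr ?_
    have : (poleReg k) ⁻¹' {0}ᶜ ∈ 𝓝[≠] s := by
      have h1 := (mem_codiscrete.1 hcod) s
      rw [Filter.disjoint_principal_right, compl_compl] at h1
      exact h1
    filter_upwards [this] with t ht
    exact (hG τ t ht).symm
  · have hs0 : poleReg k s ≠ 0 := hs
    have ha : AnalyticAt ℂ (fun s => A τ s / poleReg k s) s :=
      ((hA1 τ).analyticAt s).div (hZ.analyticAt s) hs0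
    refine ha.congr ?_
    filter_upwards [hZ.continuous.continuousAt.eventually_ne hs0] with t ht
    exact (hG τ t ht).symm

end

end CohenEisenstein

end

open CohenEisenstein in
theorem mainTheorem3 (k : ℤ) (hk : k ≠ 0) :
    (∀ (s : ℂ) (τ : UpperHalfPlane), 3 / 4 - (k : ℝ) / 2 < s.re →
      -- the series and integrals involved converge absolutely
      Summable (eisTerm k s τ) ∧
      Summable (eisTerm k s (-1 / (4 * (τ : ℂ)))) ∧
      (∀ h : ℤ, MeasureTheory.Integrable (rhoIntegrand k h s τ.im)) ∧
      (∀ h : ℤ, Summable (oddTerm (upsilon k h) ((k : ℂ) + 2 * s)) ∧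
        Summable (evenTerm (upsilon k h) ((k : ℂ) + 2 * s))) ∧
      -- the Dirichlet series in the coefficients are Zagier's
      (∀ h : ℤ, twistedE k h ((k : ℂ) + 2 * s) = zagierE (signed k h) ((k : ℂ) + 2 * s)) ∧
      -- the Fourier expansion
      Summable (fourierTerm k s τ) ∧
      eisH k s τ =
        riemannZeta (1 - 2 * (k : ℂ)) * (2 : ℂ) ^ (4 * s) +
          (1 + Complex.I ^ (2 * k + 1)) * riemannZeta (1 - 2 * (k : ℂ)) / (2 : ℂ) ^ (2 * k) *
            ∑' h : ℤ, fourierTerm k s τ h) ∧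
    -- the meromorphic continuation in `s`, with possible poles in a closed discrete set
    -- that does not depend on `τ`
    (∃ (P : Set ℂ) (G : UpperHalfPlane → ℂ → ℂ),
      Pᶜ ∈ Filter.codiscrete ℂ ∧
      ∀ τ : UpperHalfPlane,
        Meromorphic (G τ) ∧ AnalyticOnNhd ℂ (G τ) Pᶜ ∧
        ∀ s : ℂ, 3 / 4 - (k : ℝ) / 2 < s.re → G τ s = eisH k s τ) := by

  have hcond : ∀ s : ℂ, 3 / 4 - (k : ℝ) / 2 < s.re → 2 < (k : ℝ) + 1 / 2 + 2 * s.re :=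
    fun s hs => by linarith
  refine ⟨fun s τ hs => ?_, ?_⟩
  · have hs' := hcond s hs
    have hw := weight_re hs'
    exact ⟨summable_eisTerm hs' τ.im_pos, summable_eisTerm hs' (im_neg_inv_pos τ),
      fun h => integrable_rhoIntegrand hs' h τ.im_pos,
      fun h => ⟨summable_oddTerm k h hw, (hasSum_evenTerm k h hw).summable⟩,
      fun h => twistedE_eq_zagierE k h _, summable_fourierTerm hs' τ, eisH_fourier hs' τ⟩
  · exact exists_meromorphic_continuation k
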